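/- Fix real parameters $g>0$, $\beta>0$. For $n\ge 0$ let $\mathcal P_n$ be the space of continuous functions $\phi:\mathbb R^n\to\mathbb C$ such that $|\phi(x)|\le P(|x_1|,\dots,|x_n|)$ for some real polynomial $P$. Write $\underline{x}=x_1+\dots+x_n$ for $x\in\mathbb R^n$, let $\theta$ be the Heaviside function ($\theta(t)=1$ for $t\ge0$, $\theta(t)=0$ for $t<0$), and put $$c_\lambda=\frac{(2\beta)^{i\lambda}}{\Gamma(g-i\lambda)},\qquad b_\lambda(t)=(1+\beta e^{-t})^{-i\lambda-g}\,(1-\beta e^{-t})^{-i\lambda+g-1}\,\theta(t-\ln\beta).$$ For $n\ge1$ define the kernels $$\Lambda_\lambda(x_n|y_{n-1})=c_\lambda\int_{\mathbb R^n}dz\;b_\lambda(z_1)\exp\Bigl(i\lambda(\underline{x}+\underline{y}-2\underline{z})-\sum_{j=1}^{n-1}(e^{z_j-x_j}+e^{z_j-y_j}+e^{x_j-z_{j+1}}+e^{y_j-z_{j+1}})-e^{z_n-x_n}\Bigr),$$ $$Q_\lambda(x_n|y_n)=c_\lambda\int_{\mathbb R^{n+1}}dz\;b_\lambda(z_1)\exp\Bigl(i\lambda(\underline{x}+\underline{y}-2\underline{z})-\sum_{j=1}^{n}(e^{z_j-x_j}+e^{z_j-y_j}+e^{x_j-z_{j+1}}+e^{y_j-z_{j+1}})\Bigr),$$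 $$Q'_\lambda(x_n|y_n)=c_{-\lambda}\int_{\mathbb R^{n}}dz\;b_{-\lambda}(z_1)\exp\Bigl(i\lambda(2\underline{z}-\underline{x}-\underline{y})-\sum_{j=1}^{n-1}(e^{z_j-x_j}+e^{z_j-y_j}+e^{x_j-z_{j+1}}+e^{y_j-z_{j+1}})-e^{z_n-x_n}-e^{z_n-y_n}\Bigr)$$ (where $x_n\in\mathbb R^n$ and $y_{n-1}\in\mathbb R^{n-1}$, $y_n\in\mathbb R^n$ denote tuples on the left-hand sides), and let $\Lambda_n(\lambda)$ (the $BC$ raising operator), $Q_n(\lambda)$ (the $BC$ Baxter operator) and $Q'_n(\lambda)$ (the reduced Baxter operator) be the integral operators $[K\phi](x)=\int K(x|y)\,\phi(y)\,dy$ with these kernels. For $n=0$ put $$Q_0(\lambda)=\frac{(2\beta)^{-i\lambda}\,\Gamma(2i\lambda)}{\Gamma(g+i\lambda)}\,\mathrm{Id},\qquad Q'_0(\lambda)=\frac{(2\beta)^{-i\lambda}}{\Gamma(g+i\lambda)}\,\mathrm{Id}.$$ For $n\ge1$ the operators $\Lambda_n(\lambda):\mathcal P_{n-1}\to\mathcal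 P_n$ ($\lambda\in\mathbb R$), $Q_n(\lambda):\mathcal P_n\to\mathcal P_n$ ($\operatorname{Im}\lambda\in(-g,0)$) and $Q'_n(\lambda):\mathcal P_n\to\mathcal P_n$ ($\operatorname{Im}\lambda<0$) are well defined: the integrals for their kernels and the integrals for their action on functions of these spaces converge absolutely, and the images lie in the indicated spaces. Moreover, with $\Gamma(a\pm b)=\Gamma(a+b)\Gamma(a-b)$, the following relations hold. 1. On $\mathcal P_n$, $n\ge0$: $Q_n(\lambda)\,Q_n(\rho)=Q_n(\rho)\,Q_n(\lambda)$ for $\operatorname{Im}\lambda,\operatorname{Im}\rho\in(-g,0)$. 2. On $\mathcal P_n$, $n\ge0$: $Q'_n(\lambda)\,Q'_n(\rho)=Q'_n(\rho)\,Q'_n(\lambda)$ for $\operatorname{Im}\lambda,\operatorname{Im}\rho<0$. 3. On $\mathcal P_{n-1}$, $n\ge1$: $Q_n(\lambda)\,\Lambda_n(\rho)=\Gamma(i\lambda\pm i\rho)\,\Lambda_n(\rho)\,Q_{n-1}(\lambda)$ for $\operatorname{Im}\lambda\in(-g,0)$, $\rho\in\mathbb R$. 4. On $\mathcal P_{n-1}$,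 $n\ge1$: $Q'_n(\lambda)\,\Lambda_n(\rho)=\Gamma(i\lambda\pm i\rho)\,\Lambda_n(\rho)\,Q'_{n-1}(\lambda)$ for $\operatorname{Im}\lambda<0$, $\rho\in\mathbb R$. 5. On $\mathcal P_{n-1}$, $n\ge1$: $\Lambda_{n+1}(\lambda)\,\Lambda_n(\rho)=\Lambda_{n+1}(\rho)\,\Lambda_n(\lambda)$ for $\lambda,\rho\in\mathbb R$. -/

import Mathlib

open MeasureTheory

noncomputable section

namespace BCToda

/-- Membership in the space `𝒫_n`: continuous functions on `ℝⁿ` whose modulus is bounded by a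
polynomial in `|x_1|, …, |x_n|`. -/
def PolyBdd (n : ℕ) : Set ((Fin n → ℝ) → ℂ) :=
  {φ | Continuous φ ∧
    ∃ P : MvPolynomial (Fin n) ℝ, ∀ x, ‖φ x‖ ≤ MvPolynomial.eval (fun i => |x i|) P}

/-- Heaviside step function, with value `1` at `0`. -/
def heaviside (x : ℝ) : ℝ := if 0 ≤ x then 1 else 0

/-- The integral operator `[K φ](x) = ∫ K(x | y) φ(y) dy` with kernel `K`. -/
def integralOp {m n : ℕ} (K : (Fin n → ℝ) → (Fin m → ℝ) → ℂ) (φ : (Fin m → ℝ) → ℂ) :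
    (Fin n → ℝ) → ℂ :=
  fun x => ∫ y, K x y * φ y

/-- The prefactor `(2β)^{iλ} / Γ(g - iλ)`. -/
def coef (g β : ℝ) (l : ℂ) : ℂ :=
  ((2 * β : ℝ) : ℂ) ^ (Complex.I * l) / Complex.Gamma (g - Complex.I * l)

/-- The boundary factor
`(1 + β e^{-z})^{-iλ-g} (1 - β e^{-z})^{-iλ+g-1} θ(z - ln β)`. -/
def boundary (g β : ℝ) (l : ℂ) (z : ℝ) : ℂ :=
  ((1 + β * Real.exp (-z) : ℝ) : ℂ) ^ (-(Complex.I * l) - g)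
    * ((1 - β * Real.exp (-z) : ℝ) : ℂ) ^ (-(Complex.I * l) + g - 1)
    * (heaviside (z - Real.log β) : ℂ)

/-- The `z`-integrand in the kernel of the raising operator `Λ_{n+1}(λ)`, without the prefactor. -/
def raisingIntegrand (g β : ℝ) (n : ℕ) (l : ℂ)
    (x : Fin (n + 1) → ℝ) (y : Fin n → ℝ) (z : Fin (n + 1) → ℝ) : ℂ :=
  boundary g β l (z 0) *
    Complex.exp (Complex.I * l * ((∑ j, x j + ∑ j, y j - 2 * ∑ j, z j : ℝ) : ℂ)
      - ((∑ j : Fin n, (Real.exp (z j.castSucc - x j.castSucc) + Real.exp (z j.castSucc - y j)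
            + Real.exp (x j.castSucc - z j.succ) + Real.exp (y j - z j.succ))
          + Real.exp (z (Fin.last n) - x (Fin.last n)) : ℝ) : ℂ))

/-- The kernel `Λ_λ(x_{n+1} | y_n)`. -/
def raisingKernel (g β : ℝ) (n : ℕ) (l : ℂ) (x : Fin (n + 1) → ℝ) (y : Fin n → ℝ) : ℂ :=
  coef g β l * ∫ z, raisingIntegrand g β n l x y z

/-- The raising operator from functions of `n` variables to functions of `n + 1` variables;
`raising g β n l` is `Λ_{n+1}(λ)`. -/
def raising (g β : ℝ) (n : ℕ) (l : ℂ) (φ : (Fin n → ℝ) → ℂ) : (Fin (n + 1) → ℝ) → ℂ :=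
  integralOp (raisingKernel g β n l) φ

/-- The `z`-integrand in the kernel of the Baxter operator `Q_n(λ)`, without the prefactor. -/
def baxterIntegrand (g β : ℝ) (n : ℕ) (l : ℂ)
    (x y : Fin n → ℝ) (z : Fin (n + 1) → ℝ) : ℂ :=
  boundary g β l (z 0) *
    Complex.exp (Complex.I * l * ((∑ j, x j + ∑ j, y j - 2 * ∑ j, z j : ℝ) : ℂ)
      - ((∑ j : Fin n, (Real.exp (z j.castSucc - x j) + Real.exp (z j.castSucc - y j)
            + Real.exp (x j - z j.succ) + Real.exp (y j - z j.succ)) : ℝ) : ℂ))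

/-- The kernel `Q_λ(x_n | y_n)`. -/
def baxterKernel (g β : ℝ) (n : ℕ) (l : ℂ) (x y : Fin n → ℝ) : ℂ :=
  coef g β l * ∫ z, baxterIntegrand g β n l x y z

/-- The Baxter operator `Q_n(λ)`; for `n = 0` it is the scalar
`(2β)^{-iλ} Γ(2iλ) / Γ(g + iλ)`. -/
def baxter (g β : ℝ) : (n : ℕ) → ℂ → ((Fin n → ℝ) → ℂ) → (Fin n → ℝ) → ℂ
  | 0, l, φ => (coef g β (-l) * Complex.Gamma (2 * Complex.I * l)) • φ
  | n + 1, l, φ => integralOp (baxterKernel g β (n + 1) l) φ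

/-- The `z`-integrand in the kernel of the reduced Baxter operator `Q'_{n+1}(λ)`, without the
prefactor. The spectral parameter enters with the opposite sign. -/
def redBaxterIntegrand (g β : ℝ) (n : ℕ) (l : ℂ) (x y z : Fin (n + 1) → ℝ) : ℂ :=
  boundary g β (-l) (z 0) *
    Complex.exp (Complex.I * l * ((2 * ∑ j, z j - ∑ j, x j - ∑ j, y j : ℝ) : ℂ)
      - ((∑ j : Fin n, (Real.exp (z j.castSucc - x j.castSucc)
            + Real.exp (z j.castSucc - y j.castSucc)
            + Real.exp (x j.castSucc - z j.succ) + Real.exp (y j.castSucc - z j.succ))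
          + Real.exp (z (Fin.last n) - x (Fin.last n))
          + Real.exp (z (Fin.last n) - y (Fin.last n)) : ℝ) : ℂ))

/-- The kernel `Q'_λ(x_{n+1} | y_{n+1})`. -/
def redBaxterKernel (g β : ℝ) (n : ℕ) (l : ℂ) (x y : Fin (n + 1) → ℝ) : ℂ :=
  coef g β (-l) * ∫ z, redBaxterIntegrand g β n l x y z

/-- The reduced Baxter operator `Q'_n(λ)`; for `n = 0` it is the scalar
`(2β)^{-iλ} / Γ(g + iλ)`. -/
def redBaxter (g β : ℝ) : (n : ℕ) → ℂ → ((Fin n → ℝ) → ℂ) → (Fin n → ℝ) → ℂ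
  | 0, l, φ => coef g β (-l) • φ
  | n + 1, l, φ => integralOp (redBaxterKernel g β n l) φ

/-- The integral operator with kernel `K(x | y) = c ∫ k(x, y, z) dz` is well defined as a map
`𝒫_m → 𝒫_n`: the integral for the kernel converges absolutely, the integral for `K φ` converges
absolutely for every `φ ∈ 𝒫_m`, and `K φ ∈ 𝒫_n`. -/
def WellDefined {m n p : ℕ} (c : ℂ)
    (k : (Fin n → ℝ) → (Fin m → ℝ) → (Fin p → ℝ) → ℂ) : Prop :=
  (∀ x y, Integrable (k x y)) ∧
  ∀ φ ∈ PolyBdd m,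
    (∀ x, Integrable fun y => (c * ∫ z, k x y z) * φ y) ∧
    integralOp (fun x y => c * ∫ z, k x y z) φ ∈ PolyBdd n

end BCToda

end

open MeasureTheory

noncomputable section

namespace BCToda

/-! Put a = iλ for Λ and Q, and a = -iλ for Q'. All three kernels then have the form c ∫ `genInt`
dz; they differ in the numbers of variables and in Re a, which is 0 for Λ, lies in (0, g) for Q and
is negative for Q'. Each relation exchanges the parameters a and b of a product of two operators,
and by Fubini it suffices to compare kernels.

In the kernel of a product the intermediate variables w couple to the auxiliary tuples z and u of
the two factors but not to each other. Each w_j therefore contributes a Macdonald-type integral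
`siteK`, which is even in its spectral parameter up to a power of its couplings (`siteK_neg`). The
powers telescope, so a + b may be replaced by -(a + b) in the weight of w at the cost of `reflFac`
to the power a + b (`MidReflection`). A site at the open end gives a Gamma function, which is how
the number of w's changes by one.

After this reflection fix w and integrate over z and u. The weights are now e^{(b-a)Σz} and
e^{(a-b)Σu}; all sites but the first separate into Macdonald-type integrals, whose evenness
exchanges a and b (`chainK_neg`, `chainK_succ`). The first coordinates stay coupled, through a power
of e^{-z_0} + e^{-u_0}, and for them the exchange is `siteJ_reflection`. The powers it produces
cancel those of the chains.

That last identity is the analytic core (`reflJ_reflection`). For Re(a - b) > 0, multiply the double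
Laplace integral by Γ(a - b) X^{b-a}, itself a Laplace transform. The convolution theorem gives a
double Laplace transform of `reflConv` in (P, q), which a Möbius substitution shows to be symmetric
in P and q. Equal real parts follow by a limit, the opposite sign by symmetry.

Convergence rests on linear decay of the exponent (`ExponentBound`), turned into arbitrary
polynomial decay of the kernels. The reflected integrands need no new estimate: their moduli satisfy
the same reflection with real parameters. -/

/-- The power `x ^ a` of a positive real number, written as an exponential. -/
def pw (x : ℝ) (a : ℂ) : ℂ := Complex.exp (a * (Real.log x : ℝ))

/-! ### Complex powers of positive reals -/

lemma pw_eq_cpow {x : ℝ} (hx : 0 < x) (a : ℂ) : pw x a = (x : ℂ) ^ a := by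
  rw [pw, Complex.cpow_def_of_ne_zero (by exact_mod_cast hx.ne'), Complex.ofReal_log hx.le, mul_comm]

lemma pw_ne_zero (x : ℝ) (a : ℂ) : pw x a ≠ 0 := Complex.exp_ne_zero _

lemma pw_add (x : ℝ) (a b : ℂ) : pw x (a + b) = pw x a * pw x b := by
  rw [pw, pw, pw, ← Complex.exp_add, add_mul]

@[simp] lemma pw_zero (x : ℝ) : pw x 0 = 1 := by simp [pw]

@[simp] lemma pw_one_base (a : ℂ) : pw 1 a = 1 := by simp [pw]

lemma pw_neg (x : ℝ) (a : ℂ) : pw x (-a) = (pw x a)⁻¹ := by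
  rw [pw, pw, ← Complex.exp_neg, neg_mul]

lemma pw_mul {x y : ℝ} (hx : 0 < x) (hy : 0 < y) (a : ℂ) : pw (x * y) a = pw x a * pw y a := by
  rw [pw, pw, pw, ← Complex.exp_add, Real.log_mul hx.ne' hy.ne']
  push_cast
  rw [mul_add]

lemma pw_inv (x : ℝ) (a : ℂ) : pw x⁻¹ a = pw x (-a) := by
  rw [pw, pw, Real.log_inv]
  push_cast
  rw [mul_neg, neg_mul]

lemma pw_div {x y : ℝ} (hx : 0 < x) (hy : 0 < y) (a : ℂ) : pw (x / y) a = pw x a * pw y (-a) := by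
  rw [div_eq_mul_inv, pw_mul hx (inv_pos.2 hy), pw_inv]

lemma pw_exp (x : ℝ) (a : ℂ) : pw (Real.exp x) a = Complex.exp (a * x) := by
  rw [pw, Real.log_exp]

lemma norm_pw (x : ℝ) (a : ℂ) : ‖pw x a‖ = Real.exp (a.re * Real.log x) := by
  rw [pw, Complex.norm_exp]
  simp

lemma norm_pw_eq_rpow {x : ℝ} (hx : 0 < x) (a : ℂ) : ‖pw x a‖ = x ^ a.re := by
  rw [norm_pw, Real.rpow_def_of_pos hx, mul_comm]

lemma pw_ofReal (x r : ℝ) : pw x r = (Real.exp (r * Real.log x) : ℝ) := by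
  simp [pw]

lemma pw_one {x : ℝ} (hx : 0 < x) : pw x 1 = x := by
  rw [pw_eq_cpow hx, Complex.cpow_one]

@[fun_prop]
lemma Measurable.pw {α : Type*} [MeasurableSpace α] {f : α → ℝ} (hf : Measurable f) (a : ℂ) :
    Measurable fun t => pw (f t) a := by
  unfold BCToda.pw
  fun_prop

/-! ### Integrals of Gamma and Beta type -/

lemma integrableOn_pw_mul_exp {c : ℂ} (hc : 0 < c.re) {X : ℝ} (hX : 0 < X) :
    IntegrableOn (fun r : ℝ => pw r (c - 1) * Complex.exp (-(X * r : ℝ))) (Set.Ioi 0) := by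
  have h := (integrableOn_Ioi_comp_mul_left_iff (fun t : ℝ => Complex.exp (-t) * (t : ℂ) ^ (c - 1))
    0 hX).2 (by simpa using Complex.GammaIntegral_convergent hc)
  refine IntegrableOn.congr_fun (h.const_mul (pw X (-(c - 1)))) (fun r hr => ?_) measurableSet_Ioi
  have hr : 0 < r := hr
  rw [← pw_eq_cpow (mul_pos hX hr), pw_mul hX hr, pw_neg]
  field_simp [pw_ne_zero]

lemma integral_pw_mul_exp {c : ℂ} (hc : 0 < c.re) {X : ℝ} (hX : 0 < X) :
    ∫ r in Set.Ioi (0 : ℝ), pw r (c - 1) * Complex.exp (-(X * r : ℝ)) =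
      Complex.Gamma c * pw X (-c) := by
  have h := Complex.integral_cpow_mul_exp_neg_mul_Ioi (a := c) (r := X) hc (by simpa using hX)
  rw [pw_neg, pw_eq_cpow hX, mul_comm, ← Complex.inv_cpow, ← one_div, ← h]
  · refine setIntegral_congr_fun measurableSet_Ioi fun r hr => ?_
    have hr : 0 < r := hr
    rw [pw_eq_cpow hr]
    push_cast
    rfl
  · rw [Complex.arg_ofReal_of_nonneg hX.le]
    exact Real.pi_pos.ne

lemma integrableOn_beta {u v : ℂ} (hu : 0 < u.re) (hv : 0 < v.re) :
    IntegrableOn (fun t : ℝ => pw t (u - 1) * pw (1 - t) (v - 1)) (Set.Ioo 0 1) := by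
  have h := Complex.betaIntegral_convergent hu hv
  rw [intervalIntegrable_iff_integrableOn_Ioo_of_le zero_le_one] at h
  refine h.congr_fun (fun t ht => ?_) measurableSet_Ioo
  have h1 : 0 < 1 - t := sub_pos.2 ht.2
  simp only
  rw [pw_eq_cpow ht.1, pw_eq_cpow h1]
  push_cast
  rfl

lemma integral_beta {u v : ℂ} (hu : 0 < u.re) (hv : 0 < v.re) :
    ∫ t in Set.Ioo (0 : ℝ) 1, pw t (u - 1) * pw (1 - t) (v - 1) =
      Complex.Gamma u * Complex.Gamma v / Complex.Gamma (u + v) := by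
  rw [Complex.Gamma_mul_Gamma_eq_betaIntegral hu hv, mul_div_cancel_left₀]
  · rw [Complex.betaIntegral, intervalIntegral.integral_of_le zero_le_one, integral_Ioc_eq_integral_Ioo]
    refine setIntegral_congr_fun measurableSet_Ioo fun t ht => ?_
    have h1 : 0 < 1 - t := sub_pos.2 ht.2
    rw [pw_eq_cpow ht.1, pw_eq_cpow h1]
    push_cast
    rfl
  · exact Complex.Gamma_ne_zero_of_re_pos (by simpa using add_pos hu hv)

/-! ### A Möbius substitution -/

lemma injOn_mobius {ρ : ℝ} (h0 : 0 < ρ) (h1 : ρ ≤ 1) :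
    Set.InjOn (fun v : ℝ => 2 * ρ * v / (1 - ρ * v)) (Set.Ioo 0 1) := by
  intro v hv w hw h
  have h2 : 0 < 1 - ρ * v := by nlinarith [hv.1, hv.2]
  have h3 : 0 < 1 - ρ * w := by nlinarith [hw.1, hw.2]
  simp only at h
  rw [div_eq_div_iff h2.ne' h3.ne'] at h
  have : 2 * ρ * (v - w) = 0 := by linear_combination h
  rcases mul_eq_zero.1 this with h | h
  · linarith
  · linarith

lemma image_mobius {ρ : ℝ} (h0 : 0 < ρ) (h1 : ρ < 1) :
    (fun v : ℝ => 2 * ρ * v / (1 - ρ * v)) '' Set.Ioo 0 1 = Set.Ioo 0 (2 * ρ / (1 - ρ)) := by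
  ext t
  constructor
  · rintro ⟨v, hv, rfl⟩
    have h2 : 0 < 1 - ρ * v := by nlinarith [hv.1, hv.2]
    have h3 := hv.1
    refine ⟨by positivity, ?_⟩
    rw [div_lt_div_iff₀ h2 (by linarith)]
    nlinarith [hv.2]
  · rintro ⟨ht0, ht⟩
    rw [lt_div_iff₀ (by linarith)] at ht
    refine ⟨t / (ρ * (t + 2)), ⟨by positivity, ?_⟩, ?_⟩
    · rw [div_lt_one (by positivity)]
      nlinarith
    · have : t + 2 ≠ 0 := by positivity
      simp only
      field_simp
      ring

/-- At ρ = 1 the right endpoint escapes to infinity. Integrals over a bounded interval and over the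
half-line can thus be brought to the same form on (0, 1). -/
lemma image_mobius_one :
    (fun v : ℝ => 2 * (1 : ℝ) * v / (1 - 1 * v)) '' Set.Ioo 0 1 = Set.Ioi 0 := by
  ext t
  constructor
  · rintro ⟨v, hv, rfl⟩
    have h2 : 0 < 1 - 1 * v := by linarith [hv.2]
    have h3 := hv.1
    exact Set.mem_Ioi.2 (by positivity)
  · intro ht
    have ht : 0 < t := ht
    refine ⟨t / (t + 2), ⟨by positivity, ?_⟩, ?_⟩
    · rw [div_lt_one (by positivity)]
      linarith
    · have : t + 2 ≠ 0 := by positivity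
      simp only
      field_simp
      ring

lemma integral_image_mobius {ρ : ℝ} (h0 : 0 < ρ) (h1 : ρ ≤ 1) (f : ℝ → ℂ) :
    ∫ t in (fun v : ℝ => 2 * ρ * v / (1 - ρ * v)) '' Set.Ioo 0 1, f t =
      ∫ v in Set.Ioo (0 : ℝ) 1, pw 2 1 * pw ρ 1 * pw (1 - ρ * v) (-2) *
        f (2 * ρ * v / (1 - ρ * v)) := by
  have hd : ∀ v ∈ Set.Ioo (0 : ℝ) 1, HasDerivWithinAt (fun v : ℝ => 2 * ρ * v / (1 - ρ * v))
      (2 * ρ / (1 - ρ * v) ^ 2) (Set.Ioo 0 1) v := by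
    intro v hv
    have h2 : 0 < 1 - ρ * v := by nlinarith [hv.1, hv.2]
    have := (((hasDerivAt_id v).const_mul (2 * ρ)).div
      (((hasDerivAt_id v).const_mul ρ).const_sub 1) h2.ne').hasDerivWithinAt (s := Set.Ioo 0 1)
    refine this.congr_deriv ?_
    simp only [id]
    field_simp
    ring
  rw [integral_image_eq_integral_abs_deriv_smul measurableSet_Ioo hd (injOn_mobius h0 h1)]
  refine setIntegral_congr_fun measurableSet_Ioo fun v hv => ?_
  have h2 : 0 < 1 - ρ * v := by nlinarith [hv.1, hv.2]
  rw [abs_of_pos (by positivity), Complex.real_smul, pw_one h0, pw_one two_pos, pw_eq_cpow h2]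
  congr 1
  rw [Complex.cpow_neg, show (2 : ℂ) = ((2 : ℕ) : ℂ) by norm_num, Complex.cpow_natCast]
  push_cast
  rw [div_eq_mul_inv]

/-- Each base becomes a quotient of linear functions of v, with denominator 1 - ρv up to constants.
Together with the Jacobian these denominators collect into the last factor; otherwise v meets ρ and
σ only through ρσ. -/
lemma integral_Ioo_mobius {ρ σ : ℝ} (h0 : 0 < ρ) (h1 : ρ < 1) (k0 : 0 < σ) (k1 : σ < 1)
    (e₁ e₂ e₃ e₄ : ℂ) :
    ∫ t in Set.Ioo 0 (2 * ρ / (1 - ρ)), pw t e₁ * pw (t + 2) e₂ * pw (t + 2 * σ / (1 - σ) + 2) e₃ *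
        pw (2 * ρ / (1 - ρ) - t) e₄ =
      pw 2 (1 + e₁ + e₂ + e₃ + e₄) * pw ρ (1 + e₁ + e₄) * pw (1 - ρ) (-e₄) * pw (1 - σ) (-e₃) *
        ∫ v in Set.Ioo (0 : ℝ) 1, pw v e₁ * pw (1 - v) e₄ * pw (1 - ρ * σ * v) e₃ *
          pw (1 - ρ * v) (-2 - e₁ - e₂ - e₃ - e₄) := by
  rw [← image_mobius h0 h1, integral_image_mobius h0 h1.le, ← integral_const_mul]
  refine setIntegral_congr_fun measurableSet_Ioo fun v hv => ?_
  obtain ⟨hv0, hv1⟩ := hv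
  have p1 : 0 < 1 - ρ * v := by nlinarith
  have p2 : 0 < 1 - ρ := by linarith
  have p3 : 0 < 1 - σ := by linarith
  have p4 : 0 < 1 - v := by linarith
  have p5 : 0 < 1 - ρ * σ * v := by nlinarith [mul_pos h0 k0, mul_lt_one_of_nonneg_of_lt_one_left h0.le h1 k1.le]
  have q1 : 2 * ρ * v / (1 - ρ * v) + 2 = 2 / (1 - ρ * v) := by field_simp; ring
  have q2 : 2 * ρ * v / (1 - ρ * v) + 2 * σ / (1 - σ) + 2 =
      2 * (1 - ρ * σ * v) / ((1 - ρ * v) * (1 - σ)) := by field_simp; ring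
  have q3 : 2 * ρ / (1 - ρ) - 2 * ρ * v / (1 - ρ * v) =
      2 * ρ * (1 - v) / ((1 - ρ) * (1 - ρ * v)) := by field_simp; ring
  rw [q1, q2, q3, pw_div (by positivity) p1, pw_div (by positivity) p1,
    pw_div (by positivity) (by positivity), pw_div (by positivity) (by positivity),
    pw_mul (by positivity) hv0, pw_mul two_pos h0, pw_mul two_pos p5, pw_mul p1 p3,
    pw_mul (by positivity) p4, pw_mul two_pos h0, pw_mul p2 p1]
  simp only [pw, ← Complex.exp_add]
  congr 1
  ring

lemma integral_Ioi_mobius {σ : ℝ} (k0 : 0 < σ) (k1 : σ < 1) (e₁ e₂ e₃ : ℂ) :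
    ∫ t in Set.Ioi 0, pw t e₁ * pw (t + 2) e₂ * pw (t + 2 * σ / (1 - σ) + 2) e₃ =
      pw 2 (1 + e₁ + e₂ + e₃) * pw (1 - σ) (-e₃) *
        ∫ v in Set.Ioo (0 : ℝ) 1, pw v e₁ * pw (1 - σ * v) e₃ *
          pw (1 - v) (-2 - e₁ - e₂ - e₃) := by
  rw [← image_mobius_one, integral_image_mobius one_pos le_rfl, ← integral_const_mul]
  refine setIntegral_congr_fun measurableSet_Ioo fun v hv => ?_
  obtain ⟨hv0, hv1⟩ := hv
  have p3 : 0 < 1 - σ := by linarith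
  have p4 : 0 < 1 - v := by linarith
  have p5 : 0 < 1 - σ * v := by nlinarith
  have q1 : 2 * v / (1 - v) + 2 = 2 / (1 - v) := by field_simp; ring
  have q2 : 2 * v / (1 - v) + 2 * σ / (1 - σ) + 2 =
      2 * (1 - σ * v) / ((1 - v) * (1 - σ)) := by field_simp; ring
  simp only [one_mul, mul_one, pw_one_base]
  rw [q1, q2, pw_div (by positivity) p4, pw_div (by positivity) p4,
    pw_div (by positivity) (by positivity), pw_mul two_pos hv0, pw_mul two_pos p5, pw_mul p4 p3]
  simp only [pw, ← Complex.exp_add]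
  congr 1
  ring

/-! ### The reflection identity for two boundary weights -/

/-- The boundary weight in the variable `r = e^z / β - 1`. -/
def bdWeight (g : ℝ) (a : ℂ) (r : ℝ) : ℂ := pw r (g - 1 - a) * pw (r + 2) (-g - a)

@[fun_prop]
lemma measurable_bdWeight (g : ℝ) (a : ℂ) : Measurable (bdWeight g a) := by
  unfold bdWeight
  fun_prop

/-- The inner convolution in the reflection identity. -/
def reflConv (g : ℝ) (a b : ℂ) (P q : ℝ) : ℂ :=
  bdWeight g b q * ∫ t in Set.Ioo 0 P, bdWeight g a t * pw (t + q + 2) (a + b) * pw (P - t) (a - b - 1)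

/-- Take ρ = P/(P+2) and σ = q/(q+2) in the Möbius substitution. The four exponents add up to -2, so
the factor 1 - ρv disappears, and what remains depends on P and q only through ρσ and (1-ρ)(1-σ).
This is the source of the symmetry. -/
lemma reflConv_eq (g : ℝ) (a b : ℂ) {P q : ℝ} (hP : 0 < P) (hq : 0 < q) :
    reflConv g a b P q = pw 2 (-2 - 2 * b) * pw (P / (P + 2) * (q / (q + 2))) (g - 1 - b) *
      pw (2 / (P + 2) * (2 / (q + 2))) (1 - a + b) *
      ∫ v in Set.Ioo (0 : ℝ) 1, pw v (g - 1 - a) * pw (1 - v) (a - b - 1) *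
        pw (1 - P / (P + 2) * (q / (q + 2)) * v) (a + b) := by
  have hP2 : P = 2 * (P / (P + 2)) / (1 - P / (P + 2)) := by field_simp; ring
  have hq2 : q = 2 * (q / (q + 2)) / (1 - q / (q + 2)) := by field_simp; ring
  have hP3 : 2 / (P + 2) = 1 - P / (P + 2) := by field_simp; ring
  have hq3 : 2 / (q + 2) = 1 - q / (q + 2) := by field_simp; ring
  have hρ0 : 0 < P / (P + 2) := by positivity
  have hσ0 : 0 < q / (q + 2) := by positivity
  have hρ1 : P / (P + 2) < 1 := by rw [div_lt_one (by positivity)]; linarith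
  have hσ1 : q / (q + 2) < 1 := by rw [div_lt_one (by positivity)]; linarith
  rw [hP3, hq3]
  generalize P / (P + 2) = ρ at *
  generalize q / (q + 2) = σ at *
  have p2 : 0 < 1 - ρ := by linarith
  have p3 : 0 < 1 - σ := by linarith
  subst hP2 hq2
  have q1 : 2 * σ / (1 - σ) + 2 = 2 / (1 - σ) := by field_simp; ring
  have key := integral_Ioo_mobius hρ0 hρ1 hσ0 hσ1 (g - 1 - a) (-g - a) (a + b) (a - b - 1)
  rw [reflConv]
  simp only [bdWeight]
  rw [key, q1, pw_div (by positivity) p3, pw_div (by positivity) p3, pw_mul two_pos hσ0,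
    pw_mul hρ0 hσ0, pw_mul p2 p3]
  rw [show -2 - (g - 1 - a) - (-g - a) - (a + b) - (a - b - 1) = 0 by ring]
  simp only [pw_zero, mul_one, ← mul_assoc]
  congr 1
  simp only [pw, ← Complex.exp_add]
  congr 1
  ring

lemma reflConv_symm (g : ℝ) (a b : ℂ) {P q : ℝ} (hP : 0 < P) (hq : 0 < q) :
    reflConv g a b P q = reflConv g a b q P := by
  rw [reflConv_eq g a b hP hq, reflConv_eq g a b hq hP, mul_comm (P / (P + 2)),
    mul_comm (2 / (P + 2))]

lemma exists_rpow_mul_exp_neg_le (E : ℝ) {κ : ℝ} (hκ : 0 < κ) :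
    ∃ C : ℝ, ∀ x : ℝ, 1 ≤ x → x ^ E * Real.exp (-(κ * x)) ≤ C := by
  obtain ⟨N, hN⟩ := exists_nat_ge E
  refine ⟨N.factorial / κ ^ N, fun x hx => ?_⟩
  have hx0 : 0 < x := by linarith
  have h1 : x ^ E ≤ x ^ N := by
    rw [← Real.rpow_natCast]
    exact Real.rpow_le_rpow_of_exponent_le hx hN
  have h2 := Real.pow_div_factorial_le_exp (κ * x) (by positivity) N
  rw [div_le_iff₀ (by positivity), mul_pow] at h2
  rw [le_div_iff₀ (by positivity), Real.exp_neg]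
  calc x ^ E * (Real.exp (κ * x))⁻¹ * κ ^ N ≤ x ^ N * (Real.exp (κ * x))⁻¹ * κ ^ N := by gcongr
    _ = (κ ^ N * x ^ N) * (Real.exp (κ * x))⁻¹ := by ring
    _ ≤ (Real.exp (κ * x) * N.factorial) * (Real.exp (κ * x))⁻¹ := by gcongr
    _ = N.factorial := by field_simp

lemma integrableOn_pw_mul_pw_mul_exp {c : ℂ} (hc : 0 < c.re) (e : ℂ) {X : ℝ} (hX : 0 < X) :
    IntegrableOn (fun r : ℝ => pw r (c - 1) * pw (r + 2) e * Complex.exp (-(X * r : ℝ)))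
      (Set.Ioi 0) := by
  obtain ⟨C, hC⟩ := exists_rpow_mul_exp_neg_le e.re (half_pos hX)
  have h := integrableOn_pw_mul_exp hc (half_pos hX)
  refine IntegrableOn.congr_fun (Integrable.bdd_mul (c := Real.exp X * C)
    (f := fun r : ℝ => pw (r + 2) e * Complex.exp (-(X / 2 * r : ℝ))) h ?_ ?_) (fun r hr => ?_)
    measurableSet_Ioi
  · exact Measurable.aestronglyMeasurable (by fun_prop)
  · refine (ae_restrict_iff' measurableSet_Ioi).2 (Filter.Eventually.of_forall fun r hr => ?_)
    have hr : 0 < r := hr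
    rw [norm_mul, norm_pw_eq_rpow (by positivity), Complex.norm_exp]
    have := hC (r + 2) (by linarith)
    calc _ = Real.exp X * ((r + 2) ^ e.re * Real.exp (-(X / 2 * (r + 2)))) := by
          rw [mul_left_comm, ← Real.exp_add]
          congr 2
          simp
          ring
      _ ≤ _ := by gcongr
  · rw [mul_mul_mul_comm, mul_comm (pw (r + 2) e), ← Complex.exp_add]
    congr 2
    push_cast
    ring

lemma integrableOn_bdWeight {g : ℝ} {a : ℂ} (ha : a.re < g) (e : ℂ) {X : ℝ} (hX : 0 < X) :
    IntegrableOn (fun r : ℝ => bdWeight g a r * pw (r + 2) e * Complex.exp (-(X * r : ℝ)))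
      (Set.Ioi 0) := by
  refine (integrableOn_pw_mul_pw_mul_exp (c := g - a) (by simpa using ha) (-g - a + e) hX).congr_fun
    (fun r _ => ?_) measurableSet_Ioi
  simp only [bdWeight, pw_add _ _ e]
  ring_nf

lemma norm_pw_le_of_one_le {x y : ℝ} (hx : 1 ≤ x) (hxy : x ≤ y) (s : ℂ) :
    ‖pw x s‖ ≤ y ^ |s.re| := by
  rw [norm_pw_eq_rpow (by linarith)]
  calc x ^ s.re ≤ x ^ |s.re| := Real.rpow_le_rpow_of_exponent_le hx (le_abs_self _)
    _ ≤ _ := Real.rpow_le_rpow (by linarith) hxy (abs_nonneg _)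

lemma norm_pw_ofReal {x : ℝ} (hx : 0 < x) (E : ℝ) : ‖pw x E‖ = x ^ E := by
  rw [norm_pw_eq_rpow hx, Complex.ofReal_re]

/-- The integrand of the reflection identity. -/
def reflInt (g X Y : ℝ) (a b : ℂ) (r q : ℝ) : ℂ :=
  bdWeight g a r * bdWeight g b q * pw (r + q + 2) (a + b) * Complex.exp (-(X * r + Y * q : ℝ))

/-- Lebesgue measure on the positive half-line. -/
abbrev volPos : Measure ℝ := volume.restrict (Set.Ioi 0)

lemma ae_volPos_prod {p : ℝ × ℝ → Prop} (h : ∀ r > 0, ∀ q > 0, p (r, q)) :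
    ∀ᵐ z ∂(volPos.prod volPos), p z := by
  rw [Measure.prod_restrict]
  refine (ae_restrict_iff' (measurableSet_Ioi.prod measurableSet_Ioi)).2
    (Filter.Eventually.of_forall fun z hz => ?_)
  exact h z.1 hz.1 z.2 hz.2

/-- From r + q + 2 ≤ (r+2)(q+2), the coupling factor is dominated by a product of a function of r
and a function of q, leaving two one-dimensional integrals. -/
lemma integrable_reflInt {g X Y : ℝ} {a b : ℂ} (ha : a.re < g) (hb : b.re < g) (hX : 0 < X)
    (hY : 0 < Y) :
    Integrable (fun z : ℝ × ℝ => reflInt g X Y a b z.1 z.2) (volPos.prod volPos) := by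
  set σ : ℝ := |(a + b).re|
  have h1 := integrableOn_bdWeight ha (σ : ℂ) hX
  have h2 := integrableOn_bdWeight hb (σ : ℂ) hY
  have h3 := Integrable.mul_prod h1 h2
  refine (Integrable.bdd_mul (c := 1) (f := fun z : ℝ × ℝ => pw (z.1 + z.2 + 2) (a + b) *
    pw (z.1 + 2) (-σ) * pw (z.2 + 2) (-σ)) h3 ?_ ?_).congr (Filter.Eventually.of_forall fun z => ?_)
  · exact Measurable.aestronglyMeasurable (by fun_prop)
  · refine ae_volPos_prod fun r hr q hq => ?_
    simp only [norm_mul, pw_neg, norm_inv]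
    rw [norm_pw_ofReal (by positivity), norm_pw_ofReal (by positivity), ← div_eq_mul_inv,
      ← div_eq_mul_inv, div_div, div_le_one (by positivity), ← Real.mul_rpow (by positivity) (by positivity)]
    exact norm_pw_le_of_one_le (by linarith) (by nlinarith) _
  · simp only [reflInt, pw_neg]
    have n1 := pw_ne_zero (z.1 + 2) σ
    have n2 := pw_ne_zero (z.2 + 2) σ
    push_cast
    rw [neg_add, Complex.exp_add]
    field_simp

/-- The two-dimensional integral of the reflection identity. -/
def reflJ (g X Y : ℝ) (a b : ℂ) : ℂ := ∫ r in Set.Ioi 0, ∫ q in Set.Ioi 0, reflInt g X Y a b r q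

lemma reflJ_eq_prod {g X Y : ℝ} {a b : ℂ} (ha : a.re < g) (hb : b.re < g) (hX : 0 < X)
    (hY : 0 < Y) :
    reflJ g X Y a b = ∫ z, reflInt g X Y a b z.1 z.2 ∂(volPos.prod volPos) :=
  (integral_prod _ (integrable_reflInt ha hb hX hY)).symm

lemma reflInt_swap (g X Y : ℝ) (a b : ℂ) (r q : ℝ) :
    reflInt g X Y a b r q = reflInt g Y X b a q r := by
  simp only [reflInt]
  rw [add_comm r q, add_comm a b, add_comm (X * r), mul_comm (bdWeight g a r)]

lemma reflJ_swap {g X Y : ℝ} {a b : ℂ} (ha : a.re < g) (hb : b.re < g) (hX : 0 < X)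
    (hY : 0 < Y) : reflJ g X Y a b = reflJ g Y X b a := by
  rw [reflJ, integral_integral_swap (integrable_reflInt ha hb hX hY)]
  simp only [reflInt_swap g X Y]
  rfl

/-- Γ(c) X^{-c} is the Laplace transform of p^{c-1}, and a product of Laplace transforms is the
transform of the convolution on the half-line. -/
lemma integral_mul_Gamma {g : ℝ} {a c s : ℂ} (ha : a.re < g) (hc : 0 < c.re) {X : ℝ} (hX : 0 < X)
    {q : ℝ} (hq : 0 ≤ q) :
    (∫ r in Set.Ioi 0, bdWeight g a r * pw (r + q + 2) s * Complex.exp (-(X * r : ℝ))) *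
        (Complex.Gamma c * pw X (-c)) =
      ∫ P in Set.Ioi 0, Complex.exp (-(X * P : ℝ)) *
        ∫ t in Set.Ioo 0 P, bdWeight g a t * pw (t + q + 2) s * pw (P - t) (c - 1) := by
  have hf : IntegrableOn (fun r : ℝ => bdWeight g a r * pw (r + q + 2) s *
      Complex.exp (-(X * r : ℝ))) (Set.Ioi 0) := by
    have h1 := integrableOn_bdWeight ha (|s.re| : ℝ) hX
    refine (Integrable.bdd_mul (c := (q + 1) ^ |s.re|) (f := fun r : ℝ => pw (r + q + 2) s *
      pw (r + 2) (-(|s.re| : ℝ))) h1 ?_ ?_).congr (Filter.Eventually.of_forall fun z => ?_)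
    · exact Measurable.aestronglyMeasurable (by fun_prop)
    · refine (ae_restrict_iff' measurableSet_Ioi).2 (Filter.Eventually.of_forall fun r hr => ?_)
      have hr : 0 < r := hr
      rw [norm_mul, pw_neg, norm_inv, norm_pw_ofReal (by positivity), ← div_eq_mul_inv,
        div_le_iff₀ (by positivity), ← Real.mul_rpow (by positivity) (by positivity)]
      exact norm_pw_le_of_one_le (by linarith) (by nlinarith) _
    · simp only [pw_neg]
      have n1 := pw_ne_zero (z + 2) (|s.re| : ℝ)
      field_simp
  rw [← integral_pw_mul_exp hc hX]
  have := integral_posConvolution hf (integrableOn_pw_mul_exp hc hX) (ContinuousLinearMap.mul ℝ ℂ)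
  simp only [ContinuousLinearMap.mul_apply'] at this
  rw [← this]
  refine setIntegral_congr_fun measurableSet_Ioi fun P hP => ?_
  have hP : 0 < P := hP
  rw [intervalIntegral.integral_of_le hP.le, integral_Ioc_eq_integral_Ioo, ← integral_const_mul]
  congr 1
  ext t
  have : Complex.exp (-(X * P : ℝ)) = Complex.exp (-(X * t : ℝ)) * Complex.exp (-(X * (P - t) : ℝ)) := by
    rw [← Complex.exp_add]
    congr 1
    push_cast
    ring
  rw [this]
  ring

lemma reflJ_mul_Gamma {g X Y : ℝ} {a b : ℂ} (ha : a.re < g) (hb : b.re < g) (hX : 0 < X)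
    (hY : 0 < Y) (hab : 0 < (a - b).re) :
    reflJ g X Y a b * (Complex.Gamma (a - b) * pw X (-(a - b))) =
      ∫ q in Set.Ioi 0, ∫ P in Set.Ioi 0, Complex.exp (-(X * P + Y * q : ℝ)) * reflConv g a b P q := by
  rw [reflJ, integral_integral_swap (integrable_reflInt ha hb hX hY), ← integral_mul_const]
  refine setIntegral_congr_fun measurableSet_Ioi fun q hq => ?_
  have hq : 0 < q := hq
  have h1 : ∀ r, reflInt g X Y a b r q = bdWeight g b q * Complex.exp (-(Y * q : ℝ)) *
      (bdWeight g a r * pw (r + q + 2) (a + b) * Complex.exp (-(X * r : ℝ))) := by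
    intro r
    rw [reflInt]
    push_cast
    rw [neg_add, Complex.exp_add]
    ring
  simp only [h1]
  rw [integral_const_mul, mul_assoc, integral_mul_Gamma ha hab hX hq.le, ← integral_const_mul]
  congr 1
  ext P
  rw [reflConv]
  push_cast
  rw [neg_add, Complex.exp_add]
  ring

/-- Justifies interchanging P and q, after which the symmetry of `reflConv` can be used. -/
lemma integrable_exp_mul_reflConv {g X Y : ℝ} {a b : ℂ} (ha : a.re < g) (hb : b.re < g)
    (hX : 0 < X) (hY : 0 < Y) (hab : 0 < (a - b).re) :
    Integrable (fun z : ℝ × ℝ => Complex.exp (-(X * z.2 + Y * z.1 : ℝ)) * reflConv g a b z.2 z.1)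
      (volPos.prod volPos) := by
  set σ : ℝ := |(a + b).re|
  set S : ℝ × ℝ → ℂ := fun z => ∫ v in Set.Ioo (0 : ℝ) 1, pw v (g - 1 - a) *
    pw (1 - v) (a - b - 1) * pw (1 - z.2 / (z.2 + 2) * (z.1 / (z.1 + 2)) * v) (a + b)
  have hS : StronglyMeasurable S := by
    refine StronglyMeasurable.integral_prod_right' (f := fun w : (ℝ × ℝ) × ℝ =>
      pw w.2 (g - 1 - a) * pw (1 - w.2) (a - b - 1) *
        pw (1 - w.1.2 / (w.1.2 + 2) * (w.1.1 / (w.1.1 + 2)) * w.2) (a + b)) ?_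
    exact Measurable.stronglyMeasurable (by fun_prop)
  have hβ := integrableOn_beta (u := g - a) (v := a - b) (by simpa using ha) hab
  set B : ℝ := ∫ v in Set.Ioo (0 : ℝ) 1, ‖pw v (g - a - 1) * pw (1 - v) (a - b - 1)‖
  -- The base of the third factor lies between 1/(P+2) and 1, because ρσv ≤ ρ = 1 - 2/(P+2). It
  -- costs at most a power of P + 2, and a Beta integral remains.
  have hSb : ∀ P > 0, ∀ q > 0, ‖S (q, P)‖ ≤ B * (P + 2) ^ σ := by
    intro P hP q hq
    refine (norm_integral_le_integral_norm _).trans ?_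
    rw [← integral_mul_const]
    refine integral_mono_of_nonneg (Filter.Eventually.of_forall fun v => norm_nonneg _)
      (hβ.norm.mul_const _) ?_
    refine (ae_restrict_iff' measurableSet_Ioo).2 (Filter.Eventually.of_forall fun v hv => ?_)
    have e1 : P / (P + 2) = 1 - 2 / (P + 2) := by field_simp; ring
    have e2 : 0 < P / (P + 2) := by positivity
    have e3 : q / (q + 2) < 1 := by rw [div_lt_one (by positivity)]; linarith
    have e4 : 0 < q / (q + 2) := by positivity
    have e5 : P / (P + 2) * (q / (q + 2)) * v ≤ P / (P + 2) := by
      rw [mul_assoc]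
      exact mul_le_of_le_one_right e2.le (mul_le_one₀ e3.le hv.1.le hv.2.le)
    have e6 : 1 / (P + 2) ≤ 1 - P / (P + 2) * (q / (q + 2)) * v := by
      have : 1 / (P + 2) ≤ 2 / (P + 2) := by gcongr; norm_num
      linarith
    have e7 : 0 ≤ P / (P + 2) * (q / (q + 2)) * v := by
      have := hv.1
      positivity
    have e8 : 0 < 1 / (P + 2) := by positivity
    simp only
    rw [norm_mul]
    rw [show (g : ℂ) - 1 - a = g - a - 1 by ring]
    gcongr
    have := norm_pw_le_of_one_le (x := (1 - P / (P + 2) * (q / (q + 2)) * v)⁻¹) (y := P + 2)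
      ((one_le_inv₀ (by linarith)).2 (by linarith))
      (by simpa using inv_anti₀ e8 e6) (-(a + b))
    rw [pw_inv, neg_neg, Complex.neg_re, abs_neg] at this
    exact this
  -- The exponents are those of P + 2 and q + 2 in `reflConv_eq`; the extra σ on the P side pays for
  -- dividing S by (P+2)^σ.
  have h1 := integrableOn_pw_mul_pw_mul_exp (c := g - b) (by simpa using hb) (-(g - 1 - b) - (1 - a + b) + σ) hX
  have h2 := integrableOn_pw_mul_pw_mul_exp (c := g - b) (by simpa using hb) (-(g - 1 - b) - (1 - a + b)) hY
  have h3 := Integrable.mul_prod h2 h1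
  have h4 := Integrable.bdd_mul (c := B) (f := fun z : ℝ × ℝ => S z * pw (z.2 + 2) (-(σ : ℂ))) h3
    (hS.aestronglyMeasurable.mul (Measurable.aestronglyMeasurable (by fun_prop))) (by
      refine ae_volPos_prod fun q hq P hP => ?_
      have hP : 0 < P := hP
      rw [norm_mul, pw_neg, norm_inv, norm_pw_ofReal (by positivity), ← div_eq_mul_inv,
        div_le_iff₀ (by positivity)]
      exact hSb P hP q hq)
  refine (h4.const_mul (pw 2 (-2 - 2 * b) * pw 2 (1 - a + b) * pw 2 (1 - a + b))).congr ?_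
  refine ae_volPos_prod fun q hq P hP => ?_
  have hP : 0 < P := hP
  have hq : 0 < q := hq
  simp only
  rw [reflConv_eq g a b hP hq, pw_mul (by positivity) (by positivity),
    pw_mul (by positivity) (by positivity), pw_div hP (by positivity), pw_div hq (by positivity),
    pw_div two_pos (by positivity), pw_div two_pos (by positivity)]
  change _ = _ * (_ * S (q, P))
  generalize S (q, P) = S'
  have h : pw 2 (-2 - 2 * b) * pw 2 (1 - a + b) * pw 2 (1 - a + b) * (pw (P + 2) (-(σ : ℂ)) *
      (pw q (g - b - 1) * pw (q + 2) (-(g - 1 - b) - (1 - a + b)) * Complex.exp (-(Y * q : ℝ)) *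
      (pw P (g - b - 1) * pw (P + 2) (-(g - 1 - b) - (1 - a + b) + σ) *
        Complex.exp (-(X * P : ℝ))))) =
      Complex.exp (-(X * P + Y * q : ℝ)) * (pw 2 (-2 - 2 * b) *
        (pw P (g - 1 - b) * pw (P + 2) (-(g - 1 - b)) *
          (pw q (g - 1 - b) * pw (q + 2) (-(g - 1 - b)))) *
        (pw 2 (1 - a + b) * pw (P + 2) (-(1 - a + b)) *
          (pw 2 (1 - a + b) * pw (q + 2) (-(1 - a + b))))) := by
    simp only [pw, ← Complex.exp_add]
    congr 1
    push_cast
    ring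
  linear_combination S' * h

/-- Multiplied by Γ(a-b) X^{b-a} and Γ(a-b) Y^{b-a} respectively, J(X, Y; a, b) and J(X, Y; b, a) =
J(Y, X; a, b) are double Laplace transforms of the same symmetric function. -/
lemma reflJ_reflection_of_re_pos {g X Y : ℝ} {a b : ℂ} (ha : a.re < g) (hb : b.re < g) (hX : 0 < X)
    (hY : 0 < Y) (hab : 0 < (a - b).re) :
    pw X (b - a) * reflJ g X Y a b = pw Y (b - a) * reflJ g X Y b a := by
  have h1 := reflJ_mul_Gamma ha hb hX hY hab
  have h2 := reflJ_mul_Gamma ha hb hY hX hab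
  rw [← reflJ_swap hb ha hX hY] at h2
  have h3 : reflJ g X Y a b * (Complex.Gamma (a - b) * pw X (-(a - b))) =
      reflJ g X Y b a * (Complex.Gamma (a - b) * pw Y (-(a - b))) := by
    rw [h1, h2, integral_integral_swap (integrable_exp_mul_reflConv ha hb hX hY hab)]
    refine setIntegral_congr_fun measurableSet_Ioi fun P hP => ?_
    refine setIntegral_congr_fun measurableSet_Ioi fun q hq => ?_
    rw [reflConv_symm g a b hP hq, add_comm (X * P)]
  rw [neg_sub] at h3
  refine mul_left_cancel₀ (Complex.Gamma_ne_zero_of_re_pos hab) ?_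
  linear_combination h3

/-- The modulus is exponential in ε, so on [0, δ] it is at most the sum of its values at the
endpoints. This is the majorant in `tendsto_reflJ`. -/
lemma norm_reflInt_add (g X Y : ℝ) (a b : ℂ) (ε r q : ℝ) :
    ‖reflInt g X Y (a + ε) b r q‖ = ‖reflInt g X Y a b r q‖ *
      Real.exp (ε * (Real.log (r + q + 2) - Real.log r - Real.log (r + 2))) := by
  simp only [reflInt, bdWeight, norm_mul, norm_pw, Complex.norm_exp, ← Real.exp_add]
  congr 1
  simp
  ring

lemma tendsto_reflJ {g X Y : ℝ} {a b : ℂ} (ha : a.re < g) (hb : b.re < g) (hX : 0 < X)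
    (hY : 0 < Y) :
    Filter.Tendsto (fun ε : ℝ => reflJ g X Y (a + ε) b) (nhdsWithin 0 (Set.Ioi 0))
      (nhds (reflJ g X Y a b)) := by
  set δ : ℝ := (g - a.re) / 2 with hδ
  have hδ0 : 0 < δ := by rw [hδ]; linarith
  have hlt : ∀ ε : ℝ, ε ≤ δ → (a + ε).re < g := by
    intro ε hε
    simp only [Complex.add_re, Complex.ofReal_re]
    linarith
  have hev : ∀ᶠ ε : ℝ in nhdsWithin 0 (Set.Ioi 0), ε ∈ Set.Ioc 0 δ := Ioc_mem_nhdsGT hδ0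
  rw [reflJ_eq_prod ha hb hX hY]
  refine Filter.Tendsto.congr' (f₁ := fun ε : ℝ =>
    ∫ z, reflInt g X Y (a + ε) b z.1 z.2 ∂(volPos.prod volPos)) ?_ ?_
  · filter_upwards [hev] with ε hε
    exact (reflJ_eq_prod (hlt ε hε.2) hb hX hY).symm
  refine tendsto_integral_filter_of_dominated_convergence
    (fun z => ‖reflInt g X Y a b z.1 z.2‖ + ‖reflInt g X Y (a + δ) b z.1 z.2‖) ?_ ?_ ?_ ?_
  · filter_upwards [hev] with ε hε
    exact (integrable_reflInt (hlt ε hε.2) hb hX hY).aestronglyMeasurable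
  · filter_upwards [hev] with ε hε
    refine Filter.Eventually.of_forall fun z => ?_
    rw [norm_reflInt_add, norm_reflInt_add, ← mul_one_add]
    gcongr
    set T := Real.log (z.1 + z.2 + 2) - Real.log z.1 - Real.log (z.1 + 2)
    rcases le_total 0 T with h | h
    · have : Real.exp (ε * T) ≤ Real.exp (δ * T) :=
        Real.exp_le_exp.2 (mul_le_mul_of_nonneg_right hε.2 h)
      linarith
    · have : Real.exp (ε * T) ≤ 1 := Real.exp_le_one_iff.2 (mul_nonpos_of_nonneg_of_nonpos hε.1.le h)
      linarith [Real.exp_pos (δ * T)]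
  · exact (integrable_reflInt ha hb hX hY).norm.add (integrable_reflInt (hlt δ le_rfl) hb hX hY).norm
  · refine Filter.Eventually.of_forall fun z => ?_
    have : Continuous fun ε : ℝ => reflInt g X Y (a + ε) b z.1 z.2 := by
      unfold reflInt bdWeight pw
      fun_prop
    have h := this.tendsto 0
    simp only [Complex.ofReal_zero, add_zero] at h
    exact h.mono_left nhdsWithin_le_nhds

/-- The reflection identity for the boundary weights. -/
theorem reflJ_reflection {g X Y : ℝ} {a b : ℂ} (ha : a.re < g) (hb : b.re < g) (hX : 0 < X)
    (hY : 0 < Y) :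
    pw X (b - a) * reflJ g X Y a b = pw Y (b - a) * reflJ g X Y b a := by
  rcases lt_trichotomy 0 (a - b).re with h | h | h
  · exact reflJ_reflection_of_re_pos ha hb hX hY h
  -- For Re a = Re b the transform with Γ(a - b) is unavailable. Shift a by ε > 0 and let ε tend to
  -- 0; by `reflJ_swap` both sides carry the shifted parameter in the same slot.
  · have t1 := tendsto_reflJ ha hb hX hY
    have t2 := tendsto_reflJ ha hb hY hX
    have c1 : ∀ Z : ℝ, Filter.Tendsto (fun ε : ℝ => pw Z (b - (a + ε)))
        (nhdsWithin 0 (Set.Ioi 0)) (nhds (pw Z (b - a))) := by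
      intro Z
      have : Continuous fun ε : ℝ => pw Z (b - (a + ε)) := by
        unfold pw
        fun_prop
      have h := this.tendsto 0
      simp only [Complex.ofReal_zero, add_zero] at h
      exact h.mono_left nhdsWithin_le_nhds
    rw [reflJ_swap hb ha hX hY]
    refine tendsto_nhds_unique ((c1 X).mul t1) (Filter.Tendsto.congr' ?_ ((c1 Y).mul t2))
    have hev : ∀ᶠ ε : ℝ in nhdsWithin 0 (Set.Ioi 0), ε ∈ Set.Ioo 0 (g - a.re) :=
      Ioo_mem_nhdsGT (by linarith)
    filter_upwards [hev] with ε hε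
    have ha' : (a + ε).re < g := by
      simp only [Complex.add_re, Complex.ofReal_re]
      linarith [hε.2]
    have hab' : 0 < (a + ε - b).re := by
      simp only [Complex.add_re, Complex.sub_re, Complex.ofReal_re] at h ⊢
      linarith [hε.1]
    rw [reflJ_reflection_of_re_pos ha' hb hX hY hab', reflJ_swap hb ha' hX hY]
  · have := reflJ_reflection_of_re_pos hb ha hX hY (by simp at h ⊢; linarith)
    rw [← neg_sub b a, pw_neg, pw_neg] at this
    have n1 := pw_ne_zero X (b - a)
    have n2 := pw_ne_zero Y (b - a)
    field_simp at this
    linear_combination -this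

/-- The degenerate reflection identity, with the second coupling equal to `0`. -/
theorem reflJ_zero {g X : ℝ} {a b : ℂ} (hb : b.re < g) (hX : 0 < X) (hab : 0 < (b - a).re) :
    reflJ g X 0 a b = Complex.Gamma (b - a) * pw X (a - b) *
      ∫ r in Set.Ioi 0, bdWeight g b r * Complex.exp (-(X * r : ℝ)) := by
  -- With Y = 0 the q-integral over the half-line takes the place of a convolution. At each fixed P
  -- it is compared with the convolution of the weight of b with p^{b-a-1}: Möbius substitutions
  -- bring both to the same Euler integral.
  have h := integral_mul_Gamma (s := 0) hb hab hX (le_refl 0)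
  simp only [pw_zero, mul_one] at h
  rw [mul_comm, ← neg_sub b a, h, reflJ]
  refine setIntegral_congr_fun measurableSet_Ioi fun P hP => ?_
  have hP : 0 < P := hP
  have h1 : ∀ q, reflInt g X 0 a b P q = Complex.exp (-(X * P : ℝ)) * (bdWeight g a P *
      (pw q (g - 1 - b) * pw (q + 2) (-g - b) * pw (q + P + 2) (a + b))) := by
    intro q
    rw [reflInt, zero_mul, add_zero, bdWeight, bdWeight, add_comm P q]
    ring
  simp only [h1]
  rw [integral_const_mul]
  congr 1
  rw [integral_const_mul]
  have hP2 : P = 2 * (P / (P + 2)) / (1 - P / (P + 2)) := by field_simp; ring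
  have hρ0 : 0 < P / (P + 2) := by positivity
  have hρ1 : P / (P + 2) < 1 := by rw [div_lt_one (by positivity)]; linarith
  generalize P / (P + 2) = ρ at *
  have p2 : 0 < 1 - ρ := by linarith
  subst hP2
  have q1 : 2 * ρ / (1 - ρ) + 2 = 2 / (1 - ρ) := by field_simp; ring
  -- The factor containing the second parameter has exponent 0 here, so its value ρ is a dummy.
  have k1 := integral_Ioo_mobius hρ0 hρ1 hρ0 hρ1 (g - 1 - b) (-g - b) 0 (b - a - 1)
  simp only [pw_zero, mul_one, neg_zero] at k1
  rw [integral_Ioi_mobius hρ0 hρ1]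
  simp only [bdWeight]
  rw [k1, q1, pw_div (by positivity) p2, pw_div (by positivity) p2, pw_mul two_pos hρ0,
    show -2 - (g - 1 - b) - (-g - b) - (a + b) = b - a - 1 by ring,
    show -2 - (g - 1 - b) - (-g - b) - 0 - (b - a - 1) = a + b by ring, ← mul_assoc]
  congr 1
  · simp only [pw, ← Complex.exp_add]
    congr 1
    ring
  · congr 1
    ext v
    ring

/-! ### Integrals over the boundary sites -/

/-- The boundary factor in terms of `a = iλ`. -/
def bd (g β : ℝ) (a : ℂ) (z : ℝ) : ℂ :=
  ((1 + β * Real.exp (-z) : ℝ) : ℂ) ^ (-a - g)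
    * ((1 - β * Real.exp (-z) : ℝ) : ℂ) ^ (-a + g - 1)
    * (heaviside (z - Real.log β) : ℂ)

lemma boundary_eq_bd (g β : ℝ) (l : ℂ) (z : ℝ) : boundary g β l z = bd g β (Complex.I * l) z := rfl

lemma bd_of_lt {g β : ℝ} {a : ℂ} {z : ℝ} (hz : z < Real.log β) : bd g β a z = 0 := by
  rw [bd, heaviside, if_neg (by linarith)]
  simp

@[fun_prop]
lemma measurable_bd (g β : ℝ) (a : ℂ) : Measurable (bd g β a) := by
  have : Measurable heaviside := by
    unfold heaviside
    exact Measurable.ite measurableSet_Ici measurable_const measurable_const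
  unfold bd
  fun_prop

lemma bd_log {g β : ℝ} (hβ : 0 < β) (a : ℂ) {r : ℝ} (hr : 0 < r) :
    bd g β a (Real.log (β * (1 + r))) = bdWeight g a r * pw (1 + r) (2 * a) * pw (1 + r) 1 := by
  have h1 : 0 < 1 + r := by linarith
  have e0 : β * Real.exp (-Real.log (β * (1 + r))) = 1 / (1 + r) := by
    rw [Real.exp_neg, Real.exp_log (by positivity)]
    field_simp
  have e1 : 1 + 1 / (1 + r) = (r + 2) / (1 + r) := by field_simp; ring
  have e2 : 1 - 1 / (1 + r) = r / (1 + r) := by field_simp; ring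
  have e3 : Real.log (β * (1 + r)) - Real.log β = Real.log (1 + r) := by
    rw [Real.log_mul hβ.ne' h1.ne']
    ring
  rw [bd, e0, e1, e2, e3, heaviside, if_pos (Real.log_nonneg (by linarith)),
    ← pw_eq_cpow (by positivity), ← pw_eq_cpow (by positivity), pw_div (by positivity) h1,
    pw_div hr h1, bdWeight, Complex.ofReal_one, mul_one]
  simp only [pw, ← Complex.exp_add]
  congr 1
  ring

/-- Substitution `e^z = β (1 + r)`. -/
lemma integral_bd_mul {g β : ℝ} (hβ : 0 < β) (a : ℂ) (F : ℝ → ℂ) :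
    ∫ z, bd g β a z * F z =
      ∫ r in Set.Ioi 0, bdWeight g a r * pw (1 + r) (2 * a) * F (Real.log (β * (1 + r))) := by
  rw [← setIntegral_eq_integral_of_forall_compl_eq_zero (s := Set.Ici (Real.log β))
    (fun z hz => by rw [bd_of_lt (not_le.1 hz), zero_mul]), integral_Ici_eq_integral_Ioi]
  have himg : Set.Ioi (Real.log β) = (fun r : ℝ => Real.log (β * (1 + r))) '' Set.Ioi 0 := by
    ext z
    constructor
    · intro hz
      have hz : Real.log β < z := hz
      rw [Real.log_lt_iff_lt_exp hβ] at hz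
      refine ⟨Real.exp z / β - 1, ?_, ?_⟩
      · rw [Set.mem_Ioi, sub_pos, lt_div_iff₀ hβ]
        linarith
      · simp only
        rw [add_sub_cancel, mul_div_cancel₀ _ hβ.ne', Real.log_exp]
    · rintro ⟨r, hr, rfl⟩
      have hr : 0 < r := hr
      exact Real.log_lt_log hβ (by nlinarith)
  have hinj : Set.InjOn (fun r : ℝ => Real.log (β * (1 + r))) (Set.Ioi 0) := by
    intro r hr s hs h
    have hr : 0 < r := hr
    have hs : 0 < s := hs
    have := Real.log_injOn_pos (Set.mem_Ioi.2 (by positivity)) (Set.mem_Ioi.2 (by positivity)) h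
    have := mul_left_cancel₀ hβ.ne' this
    linarith
  have hd : ∀ r ∈ Set.Ioi (0 : ℝ), HasDerivWithinAt (fun r : ℝ => Real.log (β * (1 + r)))
      (1 / (1 + r)) (Set.Ioi 0) r := by
    intro r hr
    have hr : 0 < r := hr
    have h1 : 0 < 1 + r := by linarith
    have := ((((hasDerivAt_id r).const_add 1).const_mul β).log (mul_pos hβ h1).ne').hasDerivWithinAt
      (s := Set.Ioi 0)
    refine this.congr_deriv ?_
    simp only [id]
    field_simp
  rw [himg, integral_image_eq_integral_abs_deriv_smul measurableSet_Ioi hd hinj]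
  refine setIntegral_congr_fun measurableSet_Ioi fun r hr => ?_
  have hr : 0 < r := hr
  have h1 : 0 < 1 + r := by linarith
  have h2 : (1 + r : ℂ) ≠ 0 := by exact_mod_cast h1.ne'
  rw [bd_log hβ a hr, pw_one h1, abs_of_pos (by positivity), Complex.real_smul]
  push_cast
  field_simp

/-- The integral over the two boundary sites. -/
def siteJ (g β : ℝ) (X Y : ℝ) (a b : ℂ) : ℂ :=
  ∫ z : ℝ, ∫ u : ℝ, bd g β a z * bd g β b u * (Complex.exp ((b - a) * (z - u : ℝ)) *
    pw (Real.exp (-z) + Real.exp (-u)) (a + b) *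
      Complex.exp (-(X * Real.exp z + Y * Real.exp u : ℝ)))

/-- Under e^z = β(1+r), e^u = β(1+q) one has e^{-z} + e^{-u} = (r+q+2)/(β(1+r)(1+q)). The powers of
1+r, with exponents 2a, b-a and -(a+b), cancel, and so do those of 1+q. -/
lemma siteJ_eq {g β : ℝ} (hβ : 0 < β) (X Y : ℝ) (a b : ℂ) :
    siteJ g β X Y a b = pw β (-(a + b)) * Complex.exp (-(β * X + β * Y : ℝ)) *
      reflJ g (β * X) (β * Y) a b := by
  simp only [siteJ, mul_assoc, integral_const_mul]
  rw [integral_bd_mul hβ, reflJ, ← integral_const_mul, ← integral_const_mul]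
  refine setIntegral_congr_fun measurableSet_Ioi fun r hr => ?_
  have hr : 0 < r := hr
  rw [integral_bd_mul hβ, ← integral_const_mul, ← integral_const_mul, ← integral_const_mul]
  refine setIntegral_congr_fun measurableSet_Ioi fun q hq => ?_
  have hq : 0 < q := hq
  have h1 : 0 < 1 + r := by linarith
  have h2 : 0 < 1 + q := by linarith
  have e1 : Real.exp (-Real.log (β * (1 + r))) + Real.exp (-Real.log (β * (1 + q))) =
      (r + q + 2) / (β * ((1 + r) * (1 + q))) := by
    rw [Real.exp_neg, Real.exp_neg, Real.exp_log (by positivity), Real.exp_log (by positivity)]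
    field_simp
    ring
  rw [e1, Real.exp_log (by positivity), Real.exp_log (by positivity), reflInt,
    pw_div (by positivity) (by positivity), pw_mul hβ (by positivity), pw_mul h1 h2,
    Real.log_mul hβ.ne' h1.ne', Real.log_mul hβ.ne' h2.ne']
  have key : pw (1 + r) (2 * a) * (pw (1 + q) (2 * b) * (Complex.exp ((b - a) *
        (Real.log β + Real.log (1 + r) - (Real.log β + Real.log (1 + q)) : ℝ)) *
      (pw β (-(a + b)) * (pw (1 + r) (-(a + b)) * pw (1 + q) (-(a + b))) *
      Complex.exp (-(X * (β * (1 + r)) + Y * (β * (1 + q)) : ℝ))))) =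
      pw β (-(a + b)) * Complex.exp (-(β * X + β * Y : ℝ)) *
        Complex.exp (-(β * X * r + β * Y * q : ℝ)) := by
    simp only [pw, ← Complex.exp_add]
    congr 1
    push_cast
    ring
  linear_combination bdWeight g a r * bdWeight g b q * pw (r + q + 2) (a + b) * key

theorem siteJ_reflection {g β X Y : ℝ} (hβ : 0 < β) {a b : ℂ} (ha : a.re < g) (hb : b.re < g)
    (hX : 0 < X) (hY : 0 < Y) :
    siteJ g β X Y a b = pw X (a - b) * pw Y (b - a) * siteJ g β X Y b a := by
  have h := reflJ_reflection ha hb (mul_pos hβ hX) (mul_pos hβ hY)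
  rw [pw_mul hβ hX, pw_mul hβ hY] at h
  have h' : pw X (b - a) * reflJ g (β * X) (β * Y) a b = pw Y (b - a) * reflJ g (β * X) (β * Y) b a := by
    refine mul_left_cancel₀ (pw_ne_zero β (b - a)) ?_
    linear_combination h
  have hn : pw X (a - b) * pw X (b - a) = 1 := by
    rw [← pw_add]
    simp
  rw [siteJ_eq hβ, siteJ_eq hβ, add_comm b a]
  linear_combination pw β (-(a + b)) * Complex.exp (-(β * X + β * Y : ℝ)) *
    (pw X (a - b) * h' - reflJ g (β * X) (β * Y) a b * hn)

theorem siteJ_zero {g β X : ℝ} (hβ : 0 < β) {a b : ℂ} (hb : b.re < g)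
    (hX : 0 < X) (hab : 0 < (b - a).re) :
    siteJ g β X 0 a b = Complex.Gamma (b - a) * pw X (a - b) *
      ∫ z : ℝ, bd g β b z * Complex.exp (-(2 * b * z) - (X * Real.exp z : ℝ)) := by
  rw [siteJ_eq hβ, mul_zero, reflJ_zero hb (mul_pos hβ hX) hab, integral_bd_mul hβ,
    ← integral_const_mul, ← integral_const_mul, ← integral_const_mul]
  refine setIntegral_congr_fun measurableSet_Ioi fun r hr => ?_
  have hr : 0 < r := hr
  have h1 : 0 < 1 + r := by linarith
  rw [pw_mul hβ hX, Real.exp_log (by positivity), Real.log_mul hβ.ne' h1.ne']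
  have key : pw β (-(a + b)) * Complex.exp (-(β * X + 0 : ℝ)) * (pw β (a - b) * pw X (a - b)) *
      Complex.exp (-(β * X * r : ℝ)) = pw X (a - b) * (pw (1 + r) (2 * b) *
      Complex.exp (-(2 * b * ((Real.log β + Real.log (1 + r) : ℝ) : ℂ)) - (X * (β * (1 + r)) : ℝ))) := by
    simp only [pw, ← Complex.exp_add]
    congr 1
    push_cast
    ring
  linear_combination Complex.Gamma (b - a) * bdWeight g b r * key

/-- The integral over a single boundary site without couplings. -/
theorem integral_bd_mul_exp {g β : ℝ} (hβ : 0 < β) {a : ℂ} (ha0 : 0 < a.re) (ha : a.re < g) :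
    ∫ z : ℝ, bd g β a z * Complex.exp (-(2 * a * z)) =
      pw (2 * β) (-(2 * a)) * (Complex.Gamma (g - a) * Complex.Gamma (2 * a) / Complex.Gamma (g + a)) := by
  have h2a : (0 : ℝ) < (2 * a).re := by simpa using ha0
  have hb := integral_beta (u := g - a) (v := 2 * a) (by simpa using ha) h2a
  rw [show (g : ℂ) - a + 2 * a = g + a by ring] at hb
  -- Any σ in (0, 1) would do: the factor containing it has exponent 0. A Beta integral remains.
  have hm := integral_Ioi_mobius (σ := 1 / 2) (by norm_num) (by norm_num) (g - 1 - a) (-g - a) 0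
  simp only [pw_zero, mul_one, neg_zero] at hm
  rw [← hb, integral_bd_mul hβ, pw_mul two_pos hβ]
  have : ∀ r ∈ Set.Ioi (0 : ℝ), bdWeight g a r * pw (1 + r) (2 * a) *
      Complex.exp (-(2 * a * (Real.log (β * (1 + r)) : ℝ))) =
      pw β (-(2 * a)) * (pw r (g - 1 - a) * pw (r + 2) (-g - a)) := by
    intro r hr
    have hr : 0 < r := hr
    have h1 : 0 < 1 + r := by linarith
    rw [Real.log_mul hβ.ne' h1.ne', bdWeight]
    have key : pw (1 + r) (2 * a) *
        Complex.exp (-(2 * a * ((Real.log β + Real.log (1 + r) : ℝ) : ℂ))) = pw β (-(2 * a)) := by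
      simp only [pw, ← Complex.exp_add]
      congr 1
      push_cast
      ring
    linear_combination pw r (g - 1 - a) * pw (r + 2) (-g - a) * key
  rw [setIntegral_congr_fun measurableSet_Ioi this, integral_const_mul, hm]
  rw [show -2 - (g - 1 - a) - (-g - a) - 0 = 2 * a - 1 by ring,
    show (1 : ℂ) + (g - 1 - a) + (-g - a) + 0 = -(2 * a) by ring,
    show (g : ℂ) - 1 - a = g - a - 1 by ring]
  ring

/-! ### The one-site integrals in the bulk -/

/-- The weight of a bulk site. -/
def siteWt (ν : ℂ) (α γ t : ℝ) : ℂ :=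
  Complex.exp (ν * t - (α * Real.exp t + γ * Real.exp (-t) : ℝ))

/-- The Macdonald-type integral over a bulk site. -/
def siteK (ν : ℂ) (α γ : ℝ) : ℂ := ∫ t : ℝ, siteWt ν α γ t

lemma continuous_siteWt (ν : ℂ) (α γ : ℝ) : Continuous (siteWt ν α γ) := by
  unfold siteWt
  fun_prop

/-- The reflection t ↦ log(γ/α) - t interchanges the two exponential terms; it is the evenness of
the Macdonald function in its index. -/
lemma siteK_neg {α γ : ℝ} (hα : 0 < α) (hγ : 0 < γ) (ν : ℂ) :
    siteK ν α γ = pw γ ν * pw α (-ν) * siteK (-ν) α γ := by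
  rw [siteK, ← integral_sub_left_eq_self _ _ (Real.log γ - Real.log α), siteK,
    ← integral_const_mul]
  congr 1
  ext t
  have e1 : Real.exp (Real.log γ - Real.log α - t) = γ / α * Real.exp (-t) := by
    rw [sub_eq_add_neg, Real.exp_add, Real.exp_sub, Real.exp_log hα, Real.exp_log hγ]
  have e2 : Real.exp (-(Real.log γ - Real.log α - t)) = α / γ * Real.exp t := by
    rw [show -(Real.log γ - Real.log α - t) = Real.log α - Real.log γ + t by ring, Real.exp_add,
      Real.exp_sub, Real.exp_log hα, Real.exp_log hγ]
  have e3 : α * (γ / α * Real.exp (-t)) + γ * (α / γ * Real.exp t) =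
      α * Real.exp t + γ * Real.exp (-t) := by
    field_simp
    ring
  simp only [siteWt]
  rw [e1, e2, e3]
  simp only [pw, ← Complex.exp_add]
  congr 1
  push_cast
  ring

lemma image_exp_neg : (fun t : ℝ => Real.exp (-t)) '' Set.univ = Set.Ioi 0 := by
  ext r
  constructor
  · rintro ⟨t, -, rfl⟩
    exact Real.exp_pos _
  · intro hr
    exact ⟨-Real.log r, trivial, by simp [Real.exp_log hr]⟩

lemma hasDerivWithinAt_exp_neg (t : ℝ) :
    HasDerivWithinAt (fun t : ℝ => Real.exp (-t)) (-Real.exp (-t)) Set.univ t := by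
  simpa using ((hasDerivAt_neg t).exp).hasDerivWithinAt (s := Set.univ)

lemma injOn_exp_neg : Set.InjOn (fun t : ℝ => Real.exp (-t)) Set.univ := by
  intro t _ s _ h
  simpa using h

lemma abs_smul_pw_mul_exp (ν : ℂ) (γ t : ℝ) :
    |-Real.exp (-t)| • (pw (Real.exp (-t)) (-ν - 1) * Complex.exp (-(γ * Real.exp (-t) : ℝ))) =
      siteWt ν 0 γ t := by
  rw [abs_neg, abs_of_pos (Real.exp_pos _), Complex.real_smul, pw_exp, Complex.ofReal_exp,
    ← mul_assoc, ← Complex.exp_add, ← Complex.exp_add, siteWt]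
  congr 1
  push_cast
  ring

/-- At an open end the e^t coupling is absent, and r = e^{-t} gives a Gamma integral. All Gamma
factors of the exchange relations but that of the degenerate case `siteJ_zero` arise here. -/
lemma siteK_zero {γ : ℝ} (hγ : 0 < γ) {ν : ℂ} (hν : ν.re < 0) :
    siteK ν 0 γ = Complex.Gamma (-ν) * pw γ ν := by
  have h := integral_pw_mul_exp (c := -ν) (by simpa using hν) hγ
  rw [← image_exp_neg, integral_image_eq_integral_abs_deriv_smul MeasurableSet.univ
    (fun t _ => hasDerivWithinAt_exp_neg t) injOn_exp_neg, neg_neg, setIntegral_univ] at h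
  simp only [abs_smul_pw_mul_exp] at h
  exact h

lemma integrable_siteWt_zero {γ : ℝ} (hγ : 0 < γ) {ν : ℂ} (hν : ν.re < 0) :
    Integrable (siteWt ν 0 γ) := by
  have h := integrableOn_pw_mul_exp (c := -ν) (by simpa using hν) hγ
  rw [← image_exp_neg, integrableOn_image_iff_integrableOn_abs_deriv_smul MeasurableSet.univ
    (fun t _ => hasDerivWithinAt_exp_neg t) injOn_exp_neg, integrableOn_univ] at h
  simp only [abs_smul_pw_mul_exp] at h
  exact h

lemma norm_siteWt_real (ν : ℂ) (α γ t : ℝ) :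
    ‖siteWt ν α γ t‖ = Real.exp (ν.re * t - (α * Real.exp t + γ * Real.exp (-t))) := by
  rw [siteWt, Complex.norm_exp, Complex.sub_re, Complex.re_mul_ofReal, Complex.ofReal_re]

lemma exists_mul_sub_exp_le {E : ℝ} (hE : 0 < E) {α : ℝ} (hα : 0 < α) :
    ∃ C : ℝ, ∀ t : ℝ, E * t - α * Real.exp t ≤ C := by
  refine ⟨-E - E * Real.log (α / E), fun t => ?_⟩
  have h := Real.add_one_le_exp (t + Real.log (α / E))
  rw [Real.exp_add, Real.exp_log (by positivity)] at h
  have h2 := mul_le_mul_of_nonneg_left h hE.le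
  have h3 : E * (Real.exp t * (α / E)) = α * Real.exp t := by field_simp
  linarith

lemma integrable_siteWt {ν : ℂ} {α γ : ℝ} (hα : 0 ≤ α) (hγ : 0 < γ) (h : 0 < α ∨ ν.re < 0) :
    Integrable (siteWt ν α γ) := by
  rcases lt_or_ge ν.re 0 with hν | hν
  · refine (integrable_siteWt_zero hγ hν).mono (continuous_siteWt _ _ _).aestronglyMeasurable
      (Filter.Eventually.of_forall fun t => ?_)
    rw [norm_siteWt_real, norm_siteWt_real, Real.exp_le_exp]
    have := mul_nonneg hα (Real.exp_pos t).le
    linarith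
  · have hα : 0 < α := h.resolve_right (not_lt.2 hν)
    obtain ⟨C, hC⟩ := exists_mul_sub_exp_le (E := ν.re + 1) (by linarith) hα
    refine ((integrable_siteWt_zero (ν := -1) hγ (by simp)).norm.const_mul (Real.exp C)).mono'
      (continuous_siteWt _ _ _).aestronglyMeasurable (Filter.Eventually.of_forall fun t => ?_)
    rw [norm_siteWt_real, norm_siteWt_real, ← Real.exp_add, Real.exp_le_exp]
    have := hC t
    simp only [Complex.neg_re, Complex.one_re]
    linarith

/-! ### Interlacing tuples and the common form of the kernels -/

/-- `e^{-x_j}`, equal to `0` when there is no coordinate `j`. -/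
def em {p : ℕ} (x : Fin p → ℝ) (j : ℕ) : ℝ := if h : j < p then Real.exp (-x ⟨j, h⟩) else 0

/-- `e^{x_j}`, equal to `0` when there is no coordinate `j`. -/
def ep {p : ℕ} (x : Fin p → ℝ) (j : ℕ) : ℝ := if h : j < p then Real.exp (x ⟨j, h⟩) else 0

lemma em_of_lt {p : ℕ} (x : Fin p → ℝ) {j : ℕ} (h : j < p) : em x j = Real.exp (-x ⟨j, h⟩) :=
  dif_pos h

lemma ep_of_lt {p : ℕ} (x : Fin p → ℝ) {j : ℕ} (h : j < p) : ep x j = Real.exp (x ⟨j, h⟩) :=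
  dif_pos h

lemma em_of_le {p : ℕ} (x : Fin p → ℝ) {j : ℕ} (h : p ≤ j) : em x j = 0 := dif_neg (not_lt.2 h)

lemma ep_of_le {p : ℕ} (x : Fin p → ℝ) {j : ℕ} (h : p ≤ j) : ep x j = 0 := dif_neg (not_lt.2 h)

lemma em_nonneg {p : ℕ} (x : Fin p → ℝ) (j : ℕ) : 0 ≤ em x j := by
  unfold em
  split_ifs <;> positivity

lemma ep_nonneg {p : ℕ} (x : Fin p → ℝ) (j : ℕ) : 0 ≤ ep x j := by
  unfold ep
  split_ifs <;> positivity

@[fun_prop]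
lemma continuous_em {p : ℕ} (j : ℕ) : Continuous fun x : Fin p → ℝ => em x j := by
  unfold em
  split_ifs <;> fun_prop

@[fun_prop]
lemma continuous_ep {p : ℕ} (j : ℕ) : Continuous fun x : Fin p → ℝ => ep x j := by
  unfold ep
  split_ifs <;> fun_prop

/-- The nearest-neighbour interaction of two interlacing tuples. -/
def link {m p : ℕ} (z : Fin m → ℝ) (x : Fin p → ℝ) : ℝ :=
  ∑ j : Fin p, (ep z j * Real.exp (-x j) + em z (j + 1) * Real.exp (x j))

lemma continuous_link {m p : ℕ} :
    Continuous fun w : (Fin m → ℝ) × (Fin p → ℝ) => link w.1 w.2 := by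
  unfold link
  have h1 : ∀ j, Continuous fun w : (Fin m → ℝ) × (Fin p → ℝ) => ep w.1 j :=
    fun j => (continuous_ep j).comp continuous_fst
  have h2 : ∀ j, Continuous fun w : (Fin m → ℝ) × (Fin p → ℝ) => em w.1 j :=
    fun j => (continuous_em j).comp continuous_fst
  fun_prop

@[fun_prop]
lemma Continuous.link {α : Type*} [TopologicalSpace α] {m p : ℕ} {f : α → Fin m → ℝ}
    {h : α → Fin p → ℝ} (hf : Continuous f) (hh : Continuous h) :
    Continuous fun t => link (f t) (h t) := continuous_link.comp (hf.prodMk hh)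

@[fun_prop]
lemma Measurable.link {α : Type*} [MeasurableSpace α] {m p : ℕ} {f : α → Fin m → ℝ}
    {h : α → Fin p → ℝ} (hf : Measurable f) (hh : Measurable h) :
    Measurable fun t => link (f t) (h t) := continuous_link.measurable.comp (hf.prodMk hh)

lemma link_nonneg {m p : ℕ} (z : Fin m → ℝ) (x : Fin p → ℝ) : 0 ≤ link z x :=
  Finset.sum_nonneg fun _ _ => add_nonneg (mul_nonneg (ep_nonneg _ _) (Real.exp_pos _).le)
    (mul_nonneg (em_nonneg _ _) (Real.exp_pos _).le)

lemma link_succ_left {n : ℕ} (z : Fin (n + 1) → ℝ) (x : Fin n → ℝ) :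
    link z x = ∑ j : Fin n, (Real.exp (z j.castSucc - x j) + Real.exp (x j - z j.succ)) := by
  refine Finset.sum_congr rfl fun j _ => ?_
  rw [ep_of_lt z (by omega : (j : ℕ) < n + 1), em_of_lt z (by omega : (j : ℕ) + 1 < n + 1),
    ← Real.exp_add, ← Real.exp_add]
  congr 2
  exact (sub_eq_neg_add _ _).symm

lemma link_self {n : ℕ} (z x : Fin (n + 1) → ℝ) :
    link z x = ∑ j : Fin n, (Real.exp (z j.castSucc - x j.castSucc) +
      Real.exp (x j.castSucc - z j.succ)) + Real.exp (z (Fin.last n) - x (Fin.last n)) := by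
  rw [link, Fin.sum_univ_castSucc]
  congr 1
  · refine Finset.sum_congr rfl fun j _ => ?_
    rw [ep_of_lt z (by simp : (j.castSucc : ℕ) < n + 1),
      em_of_lt z (by simp : (j.castSucc : ℕ) + 1 < n + 1), ← Real.exp_add, ← Real.exp_add]
    congr 2
    exact (sub_eq_neg_add _ _).symm
  · rw [ep_of_lt z (by simp : (Fin.last n : ℕ) < n + 1), em_of_le z (by simp), zero_mul, add_zero,
      ← Real.exp_add]
    rfl

/-- Regrouping by the coordinates of z prepares integration over z. The zero convention for missing
coordinates lets one formula serve p = M and p = M + 1; z_0 has no e^{-z} term, the wall taking its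
place. -/
lemma link_eq_sum_left {M p : ℕ} (z : Fin (M + 1) → ℝ) (x : Fin p → ℝ) (hp : p ≤ M + 1) :
    link z x = Real.exp (z 0) * em x 0 + ∑ j : Fin M, (Real.exp (z j.succ) * em x (j + 1) +
      Real.exp (-z j.succ) * ep x j) := by
  have h1 : link z x = ∑ j ∈ Finset.range p, (ep z j * em x j + em z (j + 1) * ep x j) := by
    rw [link, Finset.sum_range]
    refine Finset.sum_congr rfl fun j _ => ?_
    rw [em_of_lt x j.2, ep_of_lt x j.2]
  rw [h1, Finset.sum_subset (Finset.range_mono hp), Finset.sum_add_distrib, Finset.sum_add_distrib,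
    Finset.sum_range_succ', Finset.sum_range_succ (fun j => em z (j + 1) * ep x j), em_of_le z le_rfl,
    Finset.sum_range, Finset.sum_range, ep_of_lt z (Nat.succ_pos M)]
  · have e1 : ∀ j : Fin M, ep z (j + 1) = Real.exp (z j.succ) := fun j => ep_of_lt z (by omega)
    have e2 : ∀ j : Fin M, em z (j + 1) = Real.exp (-z j.succ) := fun j => em_of_lt z (by omega)
    simp only [e1, e2]
    simp only [Fin.mk_zero]
    rw [zero_mul]
    ring
  · intro j _ hj
    rw [em_of_le x (by simpa using hj), ep_of_le x (by simpa using hj)]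
    simp

/-- The common form of the integrands of all the kernels, with `a = iλ`. -/
def genInt (g β : ℝ) {M p q : ℕ} (a : ℂ) (x : Fin p → ℝ) (y : Fin q → ℝ) (z : Fin (M + 1) → ℝ) : ℂ :=
  bd g β a (z 0) * Complex.exp (a * ((∑ j, x j + ∑ j, y j - 2 * ∑ j, z j : ℝ) : ℂ)
    - ((link z x + link z y : ℝ) : ℂ))

lemma raisingIntegrand_eq (g β : ℝ) (n : ℕ) (l : ℂ) :
    raisingIntegrand g β n l = genInt g β (Complex.I * l) := by
  funext x y z
  rw [raisingIntegrand, genInt, boundary_eq_bd, link_self, link_succ_left]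
  congr 4
  simp only [Finset.sum_add_distrib]
  ring

lemma baxterIntegrand_eq (g β : ℝ) (n : ℕ) (l : ℂ) :
    baxterIntegrand g β n l = genInt g β (Complex.I * l) := by
  funext x y z
  rw [baxterIntegrand, genInt, boundary_eq_bd, link_succ_left, link_succ_left]
  congr 5
  simp only [Finset.sum_add_distrib]
  ring

lemma redBaxterIntegrand_eq (g β : ℝ) (n : ℕ) (l : ℂ) :
    redBaxterIntegrand g β n l = genInt g β (Complex.I * -l) := by
  funext x y z
  rw [redBaxterIntegrand, genInt, boundary_eq_bd, link_self, link_self]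
  congr 2
  simp only [Finset.sum_add_distrib]
  push_cast
  ring

@[fun_prop]
lemma Measurable.genInt {α : Type*} [MeasurableSpace α] (g β : ℝ) {M p q : ℕ} (a : ℂ)
    {x : α → Fin p → ℝ} {y : α → Fin q → ℝ} {z : α → Fin (M + 1) → ℝ} (hx : Measurable x)
    (hy : Measurable y) (hz : Measurable z) :
    Measurable fun t => genInt g β a (x t) (y t) (z t) := by
  unfold BCToda.genInt
  fun_prop

lemma continuous_genInt_left (g β : ℝ) {M p q : ℕ} (a : ℂ) (y : Fin q → ℝ) (z : Fin (M + 1) → ℝ) :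
    Continuous fun x : Fin p → ℝ => genInt g β a x y z := by
  unfold BCToda.genInt
  fun_prop

lemma norm_genInt (g β : ℝ) {M p q : ℕ} (a : ℂ) (x : Fin p → ℝ) (y : Fin q → ℝ)
    (z : Fin (M + 1) → ℝ) :
    ‖genInt g β a x y z‖ = ‖bd g β a (z 0)‖ *
      Real.exp (a.re * (∑ j, x j + ∑ j, y j - 2 * ∑ j, z j) - (link z x + link z y)) := by
  rw [genInt, norm_mul, Complex.norm_exp, Complex.sub_re, Complex.re_mul_ofReal, Complex.ofReal_re]

/-! ### Decay of the kernels -/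

/-- The exponent of the kernel decays linearly outside a region controlled by `x`. -/
def ExponentBound (β : ℝ) (M p q : ℕ) (α : ℝ) : Prop :=
  ∃ C κ R : ℝ, 0 < κ ∧ 0 ≤ R ∧ ∀ (x : Fin p → ℝ) (y : Fin q → ℝ) (z : Fin (M + 1) → ℝ),
    Real.log β ≤ z 0 → ∃ D : ℝ, 0 ≤ D ∧
      α * (∑ j, x j + ∑ j, y j - 2 * ∑ j, z j) - (link z x + link z y) ≤ C - κ * D ∧
      ‖z‖ ≤ R + ‖x‖ + D ∧ ‖y‖ ≤ R + ‖x‖ + 2 * D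

lemma le_of_exp_le {t T : ℝ} (h : Real.exp t ≤ T) : t ≤ T := by
  linarith [Real.add_one_le_exp t]

lemma link_succ_left_ge {n : ℕ} (z : Fin (n + 1) → ℝ) (x : Fin n → ℝ) (j : Fin n) :
    z j.castSucc - x j ≤ link z x ∧ x j - z j.succ ≤ link z x := by
  have h : Real.exp (z j.castSucc - x j) + Real.exp (x j - z j.succ) ≤ link z x := by
    rw [link_succ_left]
    exact Finset.single_le_sum (f := fun j => Real.exp (z j.castSucc - x j) + Real.exp (x j - z j.succ))
      (fun _ _ => by positivity) (Finset.mem_univ j)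
  constructor <;> apply le_of_exp_le <;> linarith [Real.exp_pos (z j.castSucc - x j),
    Real.exp_pos (x j - z j.succ)]

lemma link_self_ge {n : ℕ} (z x : Fin (n + 1) → ℝ) :
    (∀ j, z j - x j ≤ link z x) ∧ ∀ j : Fin n, x j.castSucc - z j.succ ≤ link z x := by
  have h : ∀ j : Fin n, Real.exp (z j.castSucc - x j.castSucc) +
      Real.exp (x j.castSucc - z j.succ) + Real.exp (z (Fin.last n) - x (Fin.last n)) ≤ link z x := by
    intro j
    rw [link_self]
    have := Finset.single_le_sum (f := fun j : Fin n => Real.exp (z j.castSucc - x j.castSucc) +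
      Real.exp (x j.castSucc - z j.succ)) (fun _ _ => by positivity) (Finset.mem_univ j)
    linarith
  have h0 : Real.exp (z (Fin.last n) - x (Fin.last n)) ≤ link z x := by
    rw [link_self]
    have := Finset.sum_nonneg (s := Finset.univ) (f := fun j : Fin n =>
      Real.exp (z j.castSucc - x j.castSucc) +
      Real.exp (x j.castSucc - z j.succ)) (fun _ _ => by positivity)
    linarith
  refine ⟨fun j => ?_, fun j => ?_⟩
  · refine Fin.lastCases (le_of_exp_le h0) (fun j => le_of_exp_le ?_) j
    have := h j
    linarith [Real.exp_pos (x j.castSucc - z j.succ), Real.exp_pos (z (Fin.last n) - x (Fin.last n))]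
  · apply le_of_exp_le
    have := h j
    linarith [Real.exp_pos (z j.castSucc - x j.castSucc),
      Real.exp_pos (z (Fin.last n) - x (Fin.last n))]

lemma abs_le_of_norm {ι : Type*} [Fintype ι] (x : ι → ℝ) (j : ι) : |x j| ≤ ‖x‖ := norm_le_pi_norm x j

lemma norm_le_of_link_self {β : ℝ} {n : ℕ} {x z : Fin (n + 1) → ℝ} {D : ℝ} (hz : Real.log β ≤ z 0)
    (hD : link z x ≤ D) : ‖z‖ ≤ |Real.log β| + ‖x‖ + D := by
  have hD0 : 0 ≤ D := (link_nonneg z x).trans hD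
  rw [pi_norm_le_iff_of_nonneg (by positivity)]
  obtain ⟨h1, h2⟩ := link_self_ge z x
  intro j
  rw [Real.norm_eq_abs, abs_le]
  constructor
  · refine Fin.cases ?_ (fun j => ?_) j
    · have := neg_abs_le (Real.log β)
      have := norm_nonneg x
      linarith
    · have := h2 j
      have := (abs_le.1 (abs_le_of_norm x j.castSucc)).1
      have := abs_nonneg (Real.log β)
      linarith
  · have := h1 j
    have := (abs_le.1 (abs_le_of_norm x j)).2
    have := abs_nonneg (Real.log β)
    linarith

lemma norm_le_of_link_succ_left {n : ℕ} {y : Fin n → ℝ} {z : Fin (n + 1) → ℝ} {D : ℝ}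
    (hD : link z y ≤ D) : ‖y‖ ≤ ‖z‖ + D := by
  have hD0 : 0 ≤ D := (link_nonneg z y).trans hD
  rw [pi_norm_le_iff_of_nonneg (by positivity)]
  intro j
  obtain ⟨h1, h2⟩ := link_succ_left_ge z y j
  have h3 := (abs_le.1 (abs_le_of_norm z j.castSucc)).1
  have h4 := (abs_le.1 (abs_le_of_norm z j.succ)).2
  rw [Real.norm_eq_abs, abs_le]
  constructor <;> linarith

/-- With D the total interaction, every z_j is confined: above by x_j + D, below by x_{j-1} - D or,
for j = 0, by the wall. Each y_j lies between neighbouring z's up to D. -/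
lemma exponentBound_raising (β : ℝ) (n : ℕ) : ExponentBound β n (n + 1) n 0 := by
  refine ⟨0, 1, |Real.log β|, one_pos, abs_nonneg _, fun x y z hz => ?_⟩
  have h1 := link_nonneg z x
  have h2 := link_nonneg z y
  have h3 := norm_le_of_link_self (x := x) (D := link z x + link z y) hz (by linarith)
  have h4 : ‖y‖ ≤ ‖z‖ + (link z x + link z y) := norm_le_of_link_succ_left (by linarith)
  exact ⟨link z x + link z y, by linarith, by linarith, h3, by linarith⟩

/-- The left side vanishes for t ≤ 0. Half of an exponential thus converts the linear term αt into
the decay -α|t|, and the other half remains for the interaction. -/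
lemma exists_mul_add_abs_le {α : ℝ} (hα : 0 < α) :
    ∃ C : ℝ, ∀ t : ℝ, α * t + α * |t| ≤ C + 1 / 2 * Real.exp t := by
  obtain ⟨C, hC⟩ := exists_mul_sub_exp_le (E := 2 * α) (by positivity) (half_pos one_pos)
  refine ⟨max C 0, fun t => ?_⟩
  rcases le_total 0 t with h | h
  · rw [abs_of_nonneg h]
    have := hC t
    linarith [le_max_left C 0]
  · rw [abs_of_nonpos h]
    linarith [Real.exp_pos t, le_max_right C 0]

/-- The interaction does not stop the last y from going to +∞; the linear term does, as α < 0. Hence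
the sum of |z_j - y_j| in D. -/
lemma exponentBound_redBaxter (β : ℝ) (n : ℕ) {α : ℝ} (hα : α < 0) :
    ExponentBound β n (n + 1) (n + 1) α := by
  obtain ⟨C, hC⟩ := exists_mul_add_abs_le (neg_pos.2 hα)
  have hlink : ∀ z x : Fin (n + 1) → ℝ, ∑ j, Real.exp (z j - x j) ≤ link z x := by
    intro z x
    rw [link_self, Fin.sum_univ_castSucc]
    gcongr with j _
    linarith [Real.exp_pos (x j.castSucc - z j.succ)]
  have hsum : ∀ z x : Fin (n + 1) → ℝ, α * (∑ j, x j - ∑ j, z j) - link z x ≤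
      (n + 1) * C - 1 / 2 * link z x - (-α) * ∑ j, |z j - x j| := by
    intro z x
    have h : ∑ j, (-α * (z j - x j) + -α * |z j - x j|) ≤ ∑ j, (C + 1 / 2 * Real.exp (z j - x j)) :=
      Finset.sum_le_sum fun j _ => hC _
    simp only [Finset.sum_add_distrib, ← Finset.mul_sum, Finset.sum_sub_distrib, Finset.sum_const,
      Finset.card_univ, Fintype.card_fin, nsmul_eq_mul] at h
    push_cast at h
    linarith [hlink z x]
  refine ⟨2 * ((n + 1) * C), min (1 / 2) (-α), |Real.log β|, lt_min (by norm_num) (by linarith),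
    abs_nonneg _, fun x y z hz => ?_⟩
  have h1 := link_nonneg z x
  have h2 := link_nonneg z y
  have h0 : 0 ≤ ∑ j, |z j - y j| := Finset.sum_nonneg fun _ _ => abs_nonneg _
  have h0' : 0 ≤ ∑ j, |z j - x j| := Finset.sum_nonneg fun _ _ => abs_nonneg _
  have h3 := norm_le_of_link_self (x := x) (D := link z x + link z y + ∑ j, |z j - y j|) hz (by linarith)
  refine ⟨link z x + link z y + ∑ j, |z j - y j|, by positivity, ?_, h3, ?_⟩
  · have a1 := hsum z x
    have a2 := hsum z y
    have a3 := mul_le_mul_of_nonneg_right (min_le_left (1 / 2) (-α)) (add_nonneg h1 h2)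
    have a4 := mul_le_mul_of_nonneg_right (min_le_right (1 / 2) (-α)) h0
    have a5 := mul_nonneg (neg_pos.2 hα).le h0'
    linarith
  · have h4 : ‖y‖ ≤ ‖z‖ + ∑ j, |z j - y j| := by
      rw [pi_norm_le_iff_of_nonneg (by positivity)]
      intro j
      have h5 := Finset.single_le_sum (f := fun j => |z j - y j|) (fun _ _ => abs_nonneg _)
        (Finset.mem_univ j)
      have h6 := abs_le_of_norm z j
      have h7 := abs_sub_abs_le_abs_sub (y j) (z j)
      rw [abs_sub_comm] at h7
      rw [Real.norm_eq_abs]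
      linarith
    linarith

/-- Here the last z has no upper barrier, and the linear term with α > 0 provides it. Pairing x_j
and y_j with z_{j+1} leaves -2αz_0 over, hence the term |z_0| in D; for n = 0 it is all of D. -/
lemma exponentBound_baxter (β : ℝ) (n : ℕ) {α : ℝ} (hα : 0 < α) :
    ExponentBound β n n n α := by
  obtain ⟨C, hC⟩ := exists_mul_add_abs_le hα
  have hlink : ∀ (z : Fin (n + 1) → ℝ) (x : Fin n → ℝ), ∑ j, Real.exp (x j - z j.succ) ≤ link z x := by
    intro z x
    rw [link_succ_left]
    gcongr with j _
    linarith [Real.exp_pos (z j.castSucc - x j)]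
  have hsum : ∀ (z : Fin (n + 1) → ℝ) (x : Fin n → ℝ), α * (∑ j, x j - ∑ j : Fin n, z j.succ) -
      link z x ≤ n * C - 1 / 2 * link z x - α * ∑ j : Fin n, |x j - z j.succ| := by
    intro z x
    have h : ∑ j, (α * (x j - z j.succ) + α * |x j - z j.succ|) ≤
        ∑ j, (C + 1 / 2 * Real.exp (x j - z j.succ)) :=
      Finset.sum_le_sum fun j _ => hC _
    simp only [Finset.sum_add_distrib, ← Finset.mul_sum, Finset.sum_sub_distrib, Finset.sum_const,
      Finset.card_univ, Fintype.card_fin, nsmul_eq_mul] at h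
    linarith [hlink z x]
  refine ⟨2 * (n * C) + 3 * (α * |Real.log β|), min (1 / 2) α, 0, lt_min (by norm_num) hα,
    le_rfl, fun x y z hz => ?_⟩
  have h1 := link_nonneg z x
  have h2 := link_nonneg z y
  have h0 : 0 ≤ ∑ j, |x j - z j.succ| := Finset.sum_nonneg fun _ _ => abs_nonneg _
  have h0' : 0 ≤ ∑ j, |y j - z j.succ| := Finset.sum_nonneg fun _ _ => abs_nonneg _
  -- The wall z_0 ≥ log β turns the leftover linear term into decay in |z_0|, up to a constant.
  have hz0 : -(2 * z 0) + |z 0| ≤ 3 * |Real.log β| := by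
    rcases le_total 0 (z 0) with h | h
    · rw [abs_of_nonneg h]
      linarith [abs_nonneg (Real.log β)]
    · rw [abs_of_nonpos h]
      linarith [neg_abs_le (Real.log β)]
  set D := link z x + link z y + ∑ j, |x j - z j.succ| + |z 0| with hD
  have hDz : ‖z‖ ≤ 0 + ‖x‖ + D := by
    rw [pi_norm_le_iff_of_nonneg (by positivity)]
    intro j
    rw [Real.norm_eq_abs]
    refine Fin.cases ?_ (fun j => ?_) j
    · have := norm_nonneg x
      linarith
    · have h5 := Finset.single_le_sum (f := fun j => |x j - z j.succ|) (fun _ _ => abs_nonneg _)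
        (Finset.mem_univ j)
      have h6 := abs_le_of_norm x j
      have h7 := abs_sub_abs_le_abs_sub (z j.succ) (x j)
      rw [abs_sub_comm] at h7
      linarith [abs_nonneg (z 0)]
  have h4 : ‖y‖ ≤ ‖z‖ + D := norm_le_of_link_succ_left (by linarith [abs_nonneg (z 0)])
  refine ⟨D, by positivity, ?_, hDz, by linarith⟩
  have a1 := hsum z x
  have a2 := hsum z y
  have a3 := mul_le_mul_of_nonneg_right (min_le_left (1 / 2) α) (add_nonneg h1 h2)
  have a4 := mul_le_mul_of_nonneg_right (min_le_right (1 / 2) α) (add_nonneg h0 (abs_nonneg (z 0)))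
  have a5 := mul_nonneg hα.le h0'
  have a6 := mul_le_mul_of_nonneg_left hz0 hα.le
  rw [Fin.sum_univ_succ z]
  linarith

lemma exists_exp_neg_mul_pow_le {κ : ℝ} (hκ : 0 < κ) (N : ℕ) :
    ∃ C : ℝ, 0 ≤ C ∧ ∀ D : ℝ, 0 ≤ D → Real.exp (-(κ * D)) ≤ C * ((1 + D) ^ N)⁻¹ := by
  obtain ⟨C, hC⟩ := exists_rpow_mul_exp_neg_le N hκ
  have h : ∀ D : ℝ, 0 ≤ D → Real.exp (-(κ * D)) ≤ Real.exp κ * C * ((1 + D) ^ N)⁻¹ := by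
    intro D hD
    have := hC (1 + D) (by linarith)
    rw [Real.rpow_natCast] at this
    rw [← div_eq_mul_inv, le_div_iff₀ (by positivity)]
    calc Real.exp (-(κ * D)) * (1 + D) ^ N
        = Real.exp κ * ((1 + D) ^ N * Real.exp (-(κ * (1 + D)))) := by
          rw [mul_left_comm, ← Real.exp_add, mul_comm]
          ring_nf
      _ ≤ _ := by gcongr
  refine ⟨Real.exp κ * C, ?_, h⟩
  have := h 0 le_rfl
  simp only [mul_zero, neg_zero, Real.exp_zero, add_zero, one_pow, inv_one, mul_one] at this
  linarith

/-- Rapid decay of an integral kernel `∫ k(x, y, z) dz`, uniformly up to polynomials in `x`. -/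
def RapidDecay {M p q : ℕ} (k : (Fin p → ℝ) → (Fin q → ℝ) → (Fin (M + 1) → ℝ) → ℂ) (w : ℝ → ℝ) :
    Prop :=
  ∀ N : ℕ, ∃ C : ℝ, 0 ≤ C ∧ ∀ x y z, ‖k x y z‖ ≤
    C * (1 + ‖x‖) ^ (2 * N) * (((1 + ‖y‖) ^ N)⁻¹ * (((1 + ‖z‖) ^ N)⁻¹ * w (z 0)))

/-- Both 1 + ‖y‖ and 1 + ‖z‖ are at most 2(1+R)(1+‖x‖)(1+D), and e^{-κD} beats (1+D)^{-2N}: N powers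
for each, at the price of (1+‖x‖)^{2N}. -/
lemma rapidDecay_genInt {g β : ℝ} {M p q : ℕ} {a : ℂ} (h : ExponentBound β M p q a.re) :
    RapidDecay (genInt g β (M := M) (p := p) (q := q) a) fun t => ‖bd g β a t‖ := by
  obtain ⟨C, κ, R, hκ, hR, hb⟩ := h
  intro N
  obtain ⟨C', hC'0, hC'⟩ := exists_exp_neg_mul_pow_le hκ (2 * N)
  refine ⟨Real.exp C * C' * (2 * (1 + R)) ^ (2 * N), by positivity, fun x y z => ?_⟩
  rcases lt_or_ge (z 0) (Real.log β) with hz | hz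
  · rw [norm_genInt, bd_of_lt hz, norm_zero, zero_mul]
    positivity
  obtain ⟨D, hD0, hD1, hD2, hD3⟩ := hb x y z hz
  rw [norm_genInt]
  have hx := norm_nonneg x
  have e1 : 1 + ‖z‖ ≤ 2 * (1 + R) * (1 + ‖x‖) * (1 + D) := by
    nlinarith [mul_nonneg hR hx, mul_nonneg hR hD0, mul_nonneg hx hD0,
      mul_nonneg hR (mul_nonneg hx hD0)]
  have e2 : 1 + ‖y‖ ≤ 2 * (1 + R) * (1 + ‖x‖) * (1 + D) := by
    nlinarith [mul_nonneg hR hx, mul_nonneg hR hD0, mul_nonneg hx hD0,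
      mul_nonneg hR (mul_nonneg hx hD0)]
  have e3 : (1 + ‖y‖) ^ N * (1 + ‖z‖) ^ N ≤
      (2 * (1 + R)) ^ (2 * N) * (1 + ‖x‖) ^ (2 * N) * (1 + D) ^ (2 * N) := by
    calc _ ≤ (2 * (1 + R) * (1 + ‖x‖) * (1 + D)) ^ N * (2 * (1 + R) * (1 + ‖x‖) * (1 + D)) ^ N := by
          gcongr
      _ = _ := by rw [← pow_add, ← two_mul, mul_pow, mul_pow]
  have e4 : ((1 + D) ^ (2 * N))⁻¹ ≤ (2 * (1 + R)) ^ (2 * N) * (1 + ‖x‖) ^ (2 * N) *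
      (((1 + ‖y‖) ^ N)⁻¹ * ((1 + ‖z‖) ^ N)⁻¹) := by
    rw [← mul_inv, ← div_eq_mul_inv, le_div_iff₀ (by positivity), inv_mul_le_iff₀ (by positivity)]
    linarith
  calc ‖bd g β a (z 0)‖ * Real.exp _ ≤ ‖bd g β a (z 0)‖ * (Real.exp C * Real.exp (-(κ * D))) := by
        rw [← Real.exp_add, ← sub_eq_add_neg]
        gcongr
    _ ≤ ‖bd g β a (z 0)‖ * (Real.exp C * (C' * ((2 * (1 + R)) ^ (2 * N) * (1 + ‖x‖) ^ (2 * N) *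
          (((1 + ‖y‖) ^ N)⁻¹ * ((1 + ‖z‖) ^ N)⁻¹)))) := by
        gcongr
        exact (hC' D hD0).trans (by gcongr)
    _ = _ := by ring

lemma norm_bd_le {g β : ℝ} (hβ : 0 < β) (a : ℂ) {z : ℝ} (hz : Real.log β < z) :
    ‖bd g β a z‖ ≤ 2 ^ |a.re + g| *
      (1 + ((z - Real.log β) / (1 + (z - Real.log β))) ^ (g - 1 - a.re)) := by
  set t := z - Real.log β with ht
  have ht0 : 0 < t := sub_pos.2 hz
  have hv : β * Real.exp (-z) = Real.exp (-t) := by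
    rw [ht, neg_sub, Real.exp_sub, Real.exp_log hβ, Real.exp_neg]
    rfl
  have hv1 : Real.exp (-t) ≤ (1 + t)⁻¹ := by
    rw [Real.exp_neg]
    exact inv_anti₀ (by linarith) (by linarith [Real.add_one_le_exp t])
  have hv2 : t / (1 + t) ≤ 1 - Real.exp (-t) := by
    have : t / (1 + t) = 1 - (1 + t)⁻¹ := by field_simp; ring
    linarith
  have hv3 : 0 < t / (1 + t) := by positivity
  have hv0 := Real.exp_pos (-t)
  have hpos : 0 < 1 - Real.exp (-t) := hv3.trans_le hv2
  rw [bd, hv, heaviside, if_pos ht0.le, Complex.ofReal_one, mul_one, norm_mul,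
    Complex.norm_cpow_eq_rpow_re_of_pos (by linarith), Complex.norm_cpow_eq_rpow_re_of_pos hpos]
  have e1 : (-a - (g : ℂ)).re = -(a.re + g) := by
    simp only [Complex.sub_re, Complex.neg_re, Complex.ofReal_re]
    ring
  have e2 : (-a + (g : ℂ) - 1).re = g - 1 - a.re := by
    simp only [Complex.sub_re, Complex.add_re, Complex.neg_re, Complex.ofReal_re, Complex.one_re]
    ring
  rw [e1, e2]
  gcongr
  · calc (1 + Real.exp (-t)) ^ (-(a.re + g)) ≤ (1 + Real.exp (-t)) ^ |a.re + g| :=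
          Real.rpow_le_rpow_of_exponent_le (by linarith) (neg_le_abs _)
      _ ≤ 2 ^ |a.re + g| := Real.rpow_le_rpow (by linarith) (by linarith) (abs_nonneg _)
  · rcases le_total 0 (g - 1 - a.re) with h | h
    · have : (1 - Real.exp (-t)) ^ (g - 1 - a.re) ≤ 1 := Real.rpow_le_one hpos.le (by linarith) h
      have : 0 ≤ (t / (1 + t)) ^ (g - 1 - a.re) := by positivity
      linarith
    · have := Real.rpow_le_rpow_of_nonpos hv3 hv2 h
      linarith

/-- At the wall the boundary factor behaves like a power with exponent g - 1 - Re a > -1; away from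
it the factor is bounded and (1+|t|)^{-2} suffices. -/
lemma integrable_norm_bd_mul {g β : ℝ} (hβ : 0 < β) {a : ℂ} (ha : a.re < g) :
    Integrable fun t : ℝ => ((1 + |t|) ^ 2)⁻¹ * ‖bd g β a t‖ := by
  set e := g - 1 - a.re with he
  set A : ℝ := 2 ^ |a.re + g| with hA
  have hA0 : 0 ≤ A := by positivity
  have hd : Integrable fun t : ℝ => ((1 + |t|) ^ 2)⁻¹ := by
    have := integrable_one_add_norm (E := ℝ) (μ := volume) (r := 2) (by simp)
    refine this.congr (Filter.Eventually.of_forall fun t => ?_)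
    simp only [Real.norm_eq_abs]
    rw [Real.rpow_neg (by positivity), Real.rpow_two]
  have hm : AEStronglyMeasurable (fun t : ℝ => ((1 + |t|) ^ 2)⁻¹ * ‖bd g β a t‖) :=
    Measurable.aestronglyMeasurable (by fun_prop)
  have hsplit : (Set.univ : Set ℝ) = Set.Iic (Real.log β) ∪
      (Set.Ioc (Real.log β) (Real.log β + 1) ∪ Set.Ioi (Real.log β + 1)) := by
    rw [Set.Ioc_union_Ioi_eq_Ioi (by linarith), Set.Iic_union_Ioi]
  rw [← integrableOn_univ, hsplit]
  refine IntegrableOn.union ?_ (IntegrableOn.union ?_ ?_)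
  · rw [integrableOn_Iic_iff_integrableOn_Iio]
    refine integrableOn_zero.congr_fun (fun t ht => ?_) measurableSet_Iio
    rw [bd_of_lt ht]
    simp
  · have hi : IntervalIntegrable (fun t : ℝ => (t - Real.log β) ^ e) volume (0 + Real.log β)
        (1 + Real.log β) :=
      (intervalIntegral.intervalIntegrable_rpow' (by linarith)).comp_sub_right (Real.log β)
    rw [intervalIntegrable_iff_integrableOn_Ioc_of_le (by linarith), zero_add, add_comm 1] at hi
    have hc : IntegrableOn (fun _ : ℝ => (1 : ℝ)) (Set.Ioc (Real.log β) (Real.log β + 1)) := by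
      simp
    refine ((((hc.add hc).add (hi.const_mul (2⁻¹ ^ e))).const_mul A)).mono' hm.restrict ?_
    refine (ae_restrict_iff' measurableSet_Ioc).2 (Filter.Eventually.of_forall fun t ht => ?_)
    have h0 : 0 < t - Real.log β := sub_pos.2 ht.1
    have h1 : t - Real.log β ≤ 1 := by linarith [ht.2]
    have hb := norm_bd_le (g := g) hβ a ht.1
    rw [norm_mul, norm_norm, norm_inv, norm_pow, Real.norm_eq_abs, abs_of_pos (by positivity)]
    have h2 : ((1 + |t|) ^ 2)⁻¹ ≤ 1 := inv_le_one_of_one_le₀ (one_le_pow₀ (by linarith [abs_nonneg t]))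
    have h3 : ((t - Real.log β) / (1 + (t - Real.log β))) ^ e ≤ 1 + 2⁻¹ ^ e * (t - Real.log β) ^ e := by
      rcases le_total 0 e with h | h
      · have := Real.rpow_le_one (x := (t - Real.log β) / (1 + (t - Real.log β))) (by positivity)
          (by rw [div_le_one (by linarith)]; linarith) h
        have : 0 ≤ (2⁻¹ : ℝ) ^ e * (t - Real.log β) ^ e := by positivity
        linarith
      · have := Real.rpow_le_rpow_of_nonpos (x := 2⁻¹ * (t - Real.log β))
          (y := (t - Real.log β) / (1 + (t - Real.log β))) (by positivity)
          (by rw [le_div_iff₀ (by linarith)]; nlinarith) h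
        rw [Real.mul_rpow (by norm_num) h0.le] at this
        linarith
    calc _ ≤ 1 * ‖bd g β a t‖ := by gcongr
      _ ≤ A * (1 + ((t - Real.log β) / (1 + (t - Real.log β))) ^ e) := by rw [one_mul]; exact hb
      _ ≤ A * (1 + (1 + 2⁻¹ ^ e * (t - Real.log β) ^ e)) := by gcongr
      _ = _ := by simp only [Pi.add_apply]; ring
  · refine ((hd.const_mul (A * (2 + 2⁻¹ ^ e))).integrableOn (s := Set.Ioi (Real.log β + 1))).mono'
      hm.restrict ?_
    refine (ae_restrict_iff' measurableSet_Ioi).2 (Filter.Eventually.of_forall fun t ht => ?_)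
    have ht : Real.log β + 1 < t := ht
    have h0 : 1 < t - Real.log β := by linarith
    have hb := norm_bd_le (g := g) hβ a (by linarith : Real.log β < t)
    rw [norm_mul, norm_norm, norm_inv, norm_pow, Real.norm_eq_abs, abs_of_pos (by positivity), mul_comm]
    gcongr
    refine hb.trans ?_
    have h3 : ((t - Real.log β) / (1 + (t - Real.log β))) ^ e ≤ 1 + 2⁻¹ ^ e := by
      rcases le_total 0 e with h | h
      · have := Real.rpow_le_one (x := (t - Real.log β) / (1 + (t - Real.log β)))
          (div_nonneg (by linarith) (by linarith))
          (by rw [div_le_one (by linarith)]; linarith) h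
        have : 0 ≤ (2⁻¹ : ℝ) ^ e := by positivity
        linarith
      · have := Real.rpow_le_rpow_of_nonpos (x := 2⁻¹)
          (y := (t - Real.log β) / (1 + (t - Real.log β))) (by positivity)
          (by rw [le_div_iff₀ (by linarith)]; linarith) h
        linarith
    exact mul_le_mul_of_nonneg_left (by linarith) hA0

/-- An integrable power weight on `ℝⁿ`. -/
def decWt {n : ℕ} (y : Fin n → ℝ) : ℝ := ((1 + ‖y‖) ^ (n + 1))⁻¹

lemma decWt_nonneg {n : ℕ} (y : Fin n → ℝ) : 0 ≤ decWt y := by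
  unfold decWt
  positivity

lemma integrable_decWt (n : ℕ) : Integrable (decWt (n := n)) := by
  have := integrable_one_add_norm (E := Fin n → ℝ) (μ := volume) (r := (n + 1 : ℕ)) (by simp)
  refine this.congr (Filter.Eventually.of_forall fun t => ?_)
  simp only [decWt]
  rw [Real.rpow_neg (by positivity), Real.rpow_natCast]

/-- An integrable weight for the auxiliary variables of the kernels. -/
def auxWt (g β : ℝ) (a : ℂ) {M : ℕ} (z : Fin (M + 1) → ℝ) : ℝ :=
  ((1 + ‖z‖) ^ (M + 3))⁻¹ * ‖bd g β a (z 0)‖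

lemma auxWt_nonneg (g β : ℝ) (a : ℂ) {M : ℕ} (z : Fin (M + 1) → ℝ) : 0 ≤ auxWt g β a z := by
  unfold auxWt
  positivity

lemma measurePreserving_zero_succ (n : ℕ) :
    MeasurePreserving (MeasurableEquiv.piFinSuccAbove (fun _ : Fin (n + 1) => ℝ) 0)
      volume (volume.prod volume) :=
  volume_preserving_piFinSuccAbove (fun _ : Fin (n + 1) => ℝ) 0

lemma integral_zero_succ_mul {n : ℕ} (f : ℝ → ℂ) (h : (Fin n → ℝ) → ℂ) :
    ∫ z : Fin (n + 1) → ℝ, f (z 0) * h (fun j => z j.succ) = (∫ t, f t) * ∫ y, h y := by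
  rw [← integral_prod_mul, ← (measurePreserving_zero_succ n).integral_comp']
  rfl

lemma integrable_zero_succ_mul {n : ℕ} {f : ℝ → ℝ} {h : (Fin n → ℝ) → ℝ} (hf : Integrable f)
    (hh : Integrable h) :
    Integrable fun z : Fin (n + 1) → ℝ => f (z 0) * h (fun j => z j.succ) :=
  ((measurePreserving_zero_succ n).integrable_comp_emb (MeasurableEquiv.measurableEmbedding _)).2
    (hf.mul_prod hh)

lemma integrable_auxWt {g β : ℝ} (hβ : 0 < β) {a : ℂ} (ha : a.re < g) (M : ℕ) :
    Integrable (auxWt g β a (M := M)) := by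
  refine (integrable_zero_succ_mul (integrable_norm_bd_mul hβ ha) (integrable_decWt M)).mono'
    (Measurable.aestronglyMeasurable ?_) (Filter.Eventually.of_forall fun z => ?_)
  · unfold auxWt
    fun_prop
  -- The exponent M + 3 splits as 2 for z_0 and M + 1 for the other M coordinates.
  · rw [Real.norm_of_nonneg (auxWt_nonneg _ _ _ _), auxWt, decWt, mul_right_comm, ← mul_inv]
    have h1 : |z 0| ≤ ‖z‖ := abs_le_of_norm z 0
    have h2 : ‖fun j : Fin M => z j.succ‖ ≤ ‖z‖ :=
      (pi_norm_le_iff_of_nonneg (norm_nonneg _)).2 fun j => norm_le_pi_norm z j.succ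
    gcongr
    calc (1 + |z 0|) ^ 2 * (1 + ‖fun j : Fin M => z j.succ‖) ^ (M + 1)
        ≤ (1 + ‖z‖) ^ 2 * (1 + ‖z‖) ^ (M + 1) := by gcongr
      _ = (1 + ‖z‖) ^ (M + 3) := by ring

lemma exists_genInt_le {g β : ℝ} {M p q : ℕ} {a : ℂ} (h : ExponentBound β M p q a.re) (K : ℕ) :
    ∃ (C : ℝ) (N : ℕ), 0 ≤ C ∧ ∀ (x : Fin p → ℝ) (y : Fin q → ℝ) (z : Fin (M + 1) → ℝ),
      ‖genInt g β a x y z‖ * (1 + ‖y‖) ^ K ≤ C * (1 + ‖x‖) ^ N * (decWt y * auxWt g β a z) := by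
  -- K powers absorb the growth in y; q + 1 and M + 3 are the exponents in `decWt` and `auxWt`.
  obtain ⟨C, hC0, hC⟩ := rapidDecay_genInt (g := g) h (K + (q + 1) + (M + 3))
  refine ⟨C, 2 * (K + (q + 1) + (M + 3)), hC0, fun x y z => ?_⟩
  have hy := norm_nonneg y
  have hz := norm_nonneg z
  have h1 : ((1 + ‖y‖) ^ (K + (q + 1) + (M + 3)))⁻¹ * (1 + ‖y‖) ^ K ≤ decWt y := by
    rw [decWt, inv_mul_le_iff₀ (by positivity), ← div_eq_mul_inv, le_div_iff₀ (by positivity), ← pow_add]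
    exact pow_le_pow_right₀ (by linarith) (by omega)
  have h2 : ((1 + ‖z‖) ^ (K + (q + 1) + (M + 3)))⁻¹ ≤ ((1 + ‖z‖) ^ (M + 3))⁻¹ :=
    inv_anti₀ (by positivity) (pow_le_pow_right₀ (by linarith) (by omega))
  calc _ ≤ C * (1 + ‖x‖) ^ (2 * (K + (q + 1) + (M + 3))) *
        (((1 + ‖y‖) ^ (K + (q + 1) + (M + 3)))⁻¹ *
          (((1 + ‖z‖) ^ (K + (q + 1) + (M + 3)))⁻¹ * ‖bd g β a (z 0)‖)) * (1 + ‖y‖) ^ K := by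
        gcongr
        exact hC x y z
    _ = C * (1 + ‖x‖) ^ (2 * (K + (q + 1) + (M + 3))) *
        ((((1 + ‖y‖) ^ (K + (q + 1) + (M + 3)))⁻¹ * (1 + ‖y‖) ^ K) *
          (((1 + ‖z‖) ^ (K + (q + 1) + (M + 3)))⁻¹ * ‖bd g β a (z 0)‖)) := by ring
    _ ≤ _ := by
        unfold auxWt
        have := decWt_nonneg y
        gcongr

/-! ### Polynomially bounded functions -/

lemma exists_eval_abs_le {n : ℕ} (P : MvPolynomial (Fin n) ℝ) :
    ∃ (C : ℝ) (N : ℕ), 0 ≤ C ∧ ∀ x : Fin n → ℝ,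
      |MvPolynomial.eval (fun i => |x i|) P| ≤ C * (1 + ‖x‖) ^ N := by
  induction P using MvPolynomial.induction_on with
  | C c =>
    refine ⟨|c|, 0, abs_nonneg c, fun x => ?_⟩
    simp
  | add p q hp hq =>
    obtain ⟨C, N, hC0, hC⟩ := hp
    obtain ⟨D, K, hD0, hD⟩ := hq
    refine ⟨C + D, N + K, by positivity, fun x => ?_⟩
    have hx := norm_nonneg x
    rw [map_add]
    refine (abs_add_le _ _).trans ((add_le_add (hC x) (hD x)).trans ?_)
    rw [add_mul]
    gcongr <;> linarith
  | mul_X p i hp =>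
    obtain ⟨C, N, hC0, hC⟩ := hp
    refine ⟨C, N + 1, hC0, fun x => ?_⟩
    have hx := norm_nonneg x
    rw [map_mul, MvPolynomial.eval_X, abs_mul, abs_abs, pow_succ, ← mul_assoc]
    have := abs_le_of_norm x i
    gcongr
    · exact hC x
    · linarith

lemma mem_polyBdd_iff {n : ℕ} {φ : (Fin n → ℝ) → ℂ} :
    φ ∈ PolyBdd n ↔ Continuous φ ∧ ∃ (C : ℝ) (N : ℕ), 0 ≤ C ∧ ∀ x, ‖φ x‖ ≤ C * (1 + ‖x‖) ^ N := by
  constructor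
  · rintro ⟨hc, P, hP⟩
    obtain ⟨C, N, hC0, hC⟩ := exists_eval_abs_le P
    exact ⟨hc, C, N, hC0, fun x => (hP x).trans ((le_abs_self _).trans (hC x))⟩
  · rintro ⟨hc, C, N, hC0, hC⟩
    refine ⟨hc, MvPolynomial.C C * (1 + ∑ i, MvPolynomial.X i) ^ N, fun x => (hC x).trans ?_⟩
    simp only [map_mul, map_pow, map_add, map_sum, MvPolynomial.eval_C, MvPolynomial.eval_X, map_one]
    have : ‖x‖ ≤ ∑ i, |x i| := by
      have h0 : 0 ≤ ∑ i, |x i| := Finset.sum_nonneg fun _ _ => abs_nonneg _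
      rw [pi_norm_le_iff_of_nonneg h0]
      intro i
      exact Finset.single_le_sum (f := fun i => |x i|) (fun _ _ => abs_nonneg _) (Finset.mem_univ i)
    gcongr

/-! ### The integral operators -/

lemma integrable_genInt_mul {g β : ℝ} (hβ : 0 < β) {M p q : ℕ} {a : ℂ} (ha : a.re < g)
    (h : ExponentBound β M p q a.re) {φ : (Fin q → ℝ) → ℂ} (hφ : φ ∈ PolyBdd q) :
    (∃ (C : ℝ) (N : ℕ), 0 ≤ C ∧ ∀ (x : Fin p → ℝ) (v : (Fin q → ℝ) × (Fin (M + 1) → ℝ)),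
      ‖genInt g β a x v.1 v.2 * φ v.1‖ ≤ C * (1 + ‖x‖) ^ N * (decWt v.1 * auxWt g β a v.2)) ∧
    ∀ x : Fin p → ℝ, Integrable fun v : (Fin q → ℝ) × (Fin (M + 1) → ℝ) =>
      genInt g β a x v.1 v.2 * φ v.1 := by
  obtain ⟨hc, C, K, hC0, hC⟩ := mem_polyBdd_iff.1 hφ
  obtain ⟨D, N, hD0, hD⟩ := exists_genInt_le (g := g) h K
  have hb : ∀ (x : Fin p → ℝ) (v : (Fin q → ℝ) × (Fin (M + 1) → ℝ)),
      ‖genInt g β a x v.1 v.2 * φ v.1‖ ≤ C * D * (1 + ‖x‖) ^ N * (decWt v.1 * auxWt g β a v.2) := by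
    intro x v
    rw [norm_mul]
    calc _ ≤ ‖genInt g β a x v.1 v.2‖ * (C * (1 + ‖v.1‖) ^ K) := by gcongr; exact hC _
      _ = C * (‖genInt g β a x v.1 v.2‖ * (1 + ‖v.1‖) ^ K) := by ring
      _ ≤ C * (D * (1 + ‖x‖) ^ N * (decWt v.1 * auxWt g β a v.2)) :=
          mul_le_mul_of_nonneg_left (hD _ _ _) hC0
      _ = _ := by ring
  refine ⟨⟨C * D, N, by positivity, hb⟩, fun x => ?_⟩
  refine (((integrable_decWt q).mul_prod (integrable_auxWt hβ ha M)).const_mul _).mono'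
    (Measurable.aestronglyMeasurable ?_) (Filter.Eventually.of_forall (hb x))
  have := hc.measurable
  fun_prop

theorem wellDefined_genInt {g β : ℝ} (hβ : 0 < β) {M p q : ℕ} {a : ℂ} (ha : a.re < g)
    (h : ExponentBound β M p q a.re) (c : ℂ) :
    WellDefined c (genInt g β (M := M) (p := p) (q := q) a) := by
  refine ⟨fun x y => ?_, fun φ hφ => ?_⟩
  · obtain ⟨C, N, hC0, hC⟩ := exists_genInt_le (g := g) h 0
    refine ((integrable_auxWt hβ ha M).const_mul (C * (1 + ‖x‖) ^ N * decWt y)).mono'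
      (Measurable.aestronglyMeasurable (by fun_prop)) (Filter.Eventually.of_forall fun z => ?_)
    have := hC x y z
    rw [pow_zero, mul_one] at this
    linarith
  · obtain ⟨⟨C, N, hC0, hC⟩, hi⟩ := integrable_genInt_mul (M := M) (p := p) hβ ha h hφ
    have e1 : ∀ x y, (c * ∫ z, genInt g β (M := M) (p := p) a x y z) * φ y =
        c * ∫ z, genInt g β (M := M) (p := p) a x y z * φ y := by
      intro x y
      rw [integral_mul_const, mul_assoc]
    have hI : ∀ x, integralOp (fun x y => c * ∫ z, genInt g β (M := M) (p := p) a x y z) φ x =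
        c * ∫ v : (Fin q → ℝ) × (Fin (M + 1) → ℝ), genInt g β a x v.1 v.2 * φ v.1 := by
      intro x
      simp only [integralOp, e1]
      rw [integral_const_mul, Measure.volume_eq_prod, integral_prod _ (hi x)]
    refine ⟨fun x => ?_, mem_polyBdd_iff.2 ⟨?_, ?_⟩⟩
    · simp only [e1]
      exact (hi x).integral_prod_left.const_mul c
    · rw [show integralOp (fun x y => c * ∫ z, genInt g β (M := M) (p := p) a x y z) φ = _ from
        funext hI]
      refine continuous_const.mul (continuous_iff_continuousAt.2 fun x₀ => ?_)
      refine continuousAt_of_dominated (bound := fun v => C * (2 + ‖x₀‖) ^ N *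
        (decWt v.1 * auxWt g β a v.2)) (Filter.Eventually.of_forall fun x => (hi x).aestronglyMeasurable)
        ?_ (((integrable_decWt q).mul_prod (integrable_auxWt hβ ha M)).const_mul _) ?_
      · filter_upwards [Metric.ball_mem_nhds x₀ one_pos] with x hx
        refine Filter.Eventually.of_forall fun v => (hC x v).trans ?_
        have h1 : ‖x‖ ≤ 1 + ‖x₀‖ := by
          have h2 := norm_sub_norm_le x x₀
          have h3 : ‖x - x₀‖ < 1 := by simpa [dist_eq_norm] using hx
          linarith
        have h4 := decWt_nonneg v.1
        have h5 := auxWt_nonneg g β a v.2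
        have h6 : 1 + ‖x‖ ≤ 2 + ‖x₀‖ := by linarith
        gcongr C * ?_ ^ N * _
      · exact Filter.Eventually.of_forall fun v =>
          ((continuous_genInt_left g β a v.1 v.2).mul continuous_const).continuousAt
    · refine ⟨‖c‖ * (C * ∫ v : (Fin q → ℝ) × (Fin (M + 1) → ℝ), decWt v.1 * auxWt g β a v.2), N,
        ?_, fun x => ?_⟩
      · have : 0 ≤ ∫ v : (Fin q → ℝ) × (Fin (M + 1) → ℝ), decWt v.1 * auxWt g β a v.2 :=
          integral_nonneg fun v => mul_nonneg (decWt_nonneg _) (auxWt_nonneg _ _ _ _)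
        positivity
      · rw [hI, norm_mul]
        have : ‖∫ v : (Fin q → ℝ) × (Fin (M + 1) → ℝ), genInt g β a x v.1 v.2 * φ v.1‖ ≤
            ∫ v : (Fin q → ℝ) × (Fin (M + 1) → ℝ), C * (1 + ‖x‖) ^ N *
              (decWt v.1 * auxWt g β a v.2) :=
          norm_integral_le_of_norm_le
            (((integrable_decWt q).mul_prod (integrable_auxWt hβ ha M)).const_mul _)
            (Filter.Eventually.of_forall (hC x))
        rw [integral_const_mul] at this
        calc _ ≤ ‖c‖ * _ := mul_le_mul_of_nonneg_left this (norm_nonneg c)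
          _ = _ := by ring

/-! ### Composition of two operators -/

/-- The integral operator with kernel `c ∫ genInt a x y z dz`. -/
def genOp (g β : ℝ) (M : ℕ) {p q : ℕ} (c a : ℂ) (φ : (Fin q → ℝ) → ℂ) : (Fin p → ℝ) → ℂ :=
  integralOp (fun x y => c * ∫ z : Fin (M + 1) → ℝ, genInt g β a x y z) φ

/-- The integrand of the kernel of a composition of two operators. -/
def compInt (g β : ℝ) {M K p r q : ℕ} (a b : ℂ) (x : Fin p → ℝ) (y : Fin q → ℝ)
    (v : (Fin r → ℝ) × ((Fin (M + 1) → ℝ) × (Fin (K + 1) → ℝ))) : ℂ :=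
  genInt g β a x v.1 v.2.1 * genInt g β b v.1 y v.2.2

section Composition

variable {g β : ℝ} {M K p r q : ℕ} {a b : ℂ}

/-- The bound on the inner kernel grows like a power of the intermediate variable; the outer kernel
is then estimated with that many extra powers of decay. -/
lemma exists_compInt_le (hA : ExponentBound β M p r a.re) (hB : ExponentBound β K r q b.re) (L : ℕ) :
    ∃ (C : ℝ) (N : ℕ), 0 ≤ C ∧ ∀ (x : Fin p → ℝ) (y : Fin q → ℝ)
      (v : (Fin r → ℝ) × ((Fin (M + 1) → ℝ) × (Fin (K + 1) → ℝ))),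
      ‖compInt g β a b x y v‖ * (1 + ‖y‖) ^ L ≤ C * (1 + ‖x‖) ^ N *
        ((decWt v.1 * decWt y) * (auxWt g β a v.2.1 * auxWt g β b v.2.2)) := by
  obtain ⟨D, N, hD0, hD⟩ := exists_genInt_le (g := g) hB L
  obtain ⟨C, N', hC0, hC⟩ := exists_genInt_le (g := g) hA N
  refine ⟨C * D, N', by positivity, fun x y v => ?_⟩
  have h1 := decWt_nonneg y
  have h2 := auxWt_nonneg g β b v.2.2
  rw [compInt, norm_mul, mul_assoc]
  calc _ ≤ ‖genInt g β a x v.1 v.2.1‖ * (D * (1 + ‖v.1‖) ^ N * (decWt y * auxWt g β b v.2.2)) :=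
        mul_le_mul_of_nonneg_left (hD _ _ _) (norm_nonneg _)
    _ = D * (decWt y * auxWt g β b v.2.2) * (‖genInt g β a x v.1 v.2.1‖ * (1 + ‖v.1‖) ^ N) := by ring
    _ ≤ D * (decWt y * auxWt g β b v.2.2) *
        (C * (1 + ‖x‖) ^ N' * (decWt v.1 * auxWt g β a v.2.1)) :=
        mul_le_mul_of_nonneg_left (hC _ _ _) (by positivity)
    _ = _ := by ring

lemma measurable_compInt (g β : ℝ) (a b : ℂ) (x : Fin p → ℝ) (y : Fin q → ℝ) :
    Measurable (compInt g β (M := M) (K := K) (r := r) a b x y) := by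
  unfold compInt
  fun_prop

lemma integrable_compInt (hβ : 0 < β) (ha : a.re < g) (hb : b.re < g)
    (hA : ExponentBound β M p r a.re) (hB : ExponentBound β K r q b.re)
    (x : Fin p → ℝ) (y : Fin q → ℝ) :
    Integrable (compInt g β (M := M) (K := K) (r := r) a b x y) := by
  obtain ⟨C, N, hC0, hC⟩ := exists_compInt_le (g := g) hA hB 0
  refine (((integrable_decWt r).mul_prod ((integrable_auxWt hβ ha M).mul_prod
    (integrable_auxWt hβ hb K))).const_mul (C * (1 + ‖x‖) ^ N * decWt y)).mono'
    (measurable_compInt g β a b x y).aestronglyMeasurable (Filter.Eventually.of_forall fun v => ?_)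
  have := hC x y v
  rw [pow_zero, mul_one] at this
  linarith

theorem genOp_genOp (hβ : 0 < β) (ha : a.re < g) (hb : b.re < g)
    (hA : ExponentBound β M p r a.re) (hB : ExponentBound β K r q b.re) (c d : ℂ)
    {φ : (Fin q → ℝ) → ℂ} (hφ : φ ∈ PolyBdd q) (x : Fin p → ℝ) :
    genOp g β M c a (genOp g β K (p := r) d b φ) x =
      ∫ y, (c * d * ∫ v, compInt g β (M := M) (K := K) (r := r) a b x y v) * φ y := by
  obtain ⟨hφc, C₁, L, hC₁, hφb⟩ := mem_polyBdd_iff.1 hφ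
  obtain ⟨C, N, hC0, hC⟩ := exists_compInt_le (g := g) hA hB L
  have hint : Integrable (fun t : ((Fin r → ℝ) × (Fin q → ℝ)) ×
      ((Fin (M + 1) → ℝ) × (Fin (K + 1) → ℝ)) =>
      genInt g β a x t.1.1 t.2.1 * genInt g β b t.1.1 t.1.2 t.2.2 * φ t.1.2) := by
    refine ((((integrable_decWt r).mul_prod (integrable_decWt q)).mul_prod
      ((integrable_auxWt hβ ha M).mul_prod (integrable_auxWt hβ hb K))).const_mul
      (C₁ * (C * (1 + ‖x‖) ^ N))).mono'
      (Measurable.aestronglyMeasurable ?_) (Filter.Eventually.of_forall fun t => ?_)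
    · have := hφc.measurable
      fun_prop
    · have h1 := hC x t.1.2 (t.1.1, t.2)
      rw [norm_mul]
      calc _ ≤ ‖compInt g β a b x t.1.2 (t.1.1, t.2)‖ * (C₁ * (1 + ‖t.1.2‖) ^ L) :=
            mul_le_mul_of_nonneg_left (hφb _) (norm_nonneg _)
        _ = C₁ * (‖compInt g β a b x t.1.2 (t.1.1, t.2)‖ * (1 + ‖t.1.2‖) ^ L) := by ring
        _ ≤ _ := mul_le_mul_of_nonneg_left h1 hC₁
        _ = _ := by ring
  have hint2 : Integrable (fun s : (Fin r → ℝ) × (Fin q → ℝ) =>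
      (∫ z : Fin (M + 1) → ℝ, genInt g β a x s.1 z) *
        (∫ u : Fin (K + 1) → ℝ, genInt g β b s.1 s.2 u) * φ s.2) := by
    refine hint.integral_prod_left.congr (Filter.Eventually.of_forall fun s => ?_)
    simp only
    rw [integral_mul_const, Measure.volume_eq_prod, integral_prod_mul]
  have e1 : ∀ w : Fin r → ℝ, (c * ∫ z : Fin (M + 1) → ℝ, genInt g β a x w z) *
      (∫ y, (d * ∫ u : Fin (K + 1) → ℝ, genInt g β b w y u) * φ y) =
      c * d * ∫ y, (∫ z : Fin (M + 1) → ℝ, genInt g β a x w z) *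
        (∫ u : Fin (K + 1) → ℝ, genInt g β b w y u) * φ y := by
    intro w
    simp only [mul_assoc, integral_const_mul]
    ring
  simp only [genOp, integralOp, e1]
  rw [integral_const_mul, integral_integral_swap hint2, ← integral_const_mul]
  congr 1
  ext y
  rw [integral_mul_const, ← mul_assoc]
  congr 2
  rw [Measure.volume_eq_prod, integral_prod _ (integrable_compInt hβ ha hb hA hB x y)]
  congr 1
  ext w
  simp only [compInt]
  rw [Measure.volume_eq_prod, integral_prod_mul]

end Composition

/-! ### Reflection of the intermediate variables -/

/-- The part of the composed integrand that does not involve the intermediate variables. -/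
def coreInt (g β : ℝ) {M K p q : ℕ} (a b : ℂ) (x : Fin p → ℝ) (y : Fin q → ℝ)
    (z : Fin (M + 1) → ℝ) (u : Fin (K + 1) → ℝ) : ℂ :=
  bd g β a (z 0) * bd g β b (u 0) * Complex.exp (a * (∑ j, x j - 2 * ∑ j, z j : ℝ) +
    b * (∑ j, y j - 2 * ∑ j, u j : ℝ) - (link z x + link u y : ℝ))

/-- The weight of the intermediate variables. -/
def midWt {M K r : ℕ} (s : ℂ) (z : Fin (M + 1) → ℝ) (u : Fin (K + 1) → ℝ) (w : Fin r → ℝ) : ℂ :=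
  Complex.exp (s * (∑ j, w j : ℝ) - (link z w + link u w : ℝ))

/-- The factor produced by reflecting the intermediate variables. -/
def reflFac {M K : ℕ} (z : Fin (M + 1) → ℝ) (u : Fin (K + 1) → ℝ) : ℝ :=
  (Real.exp (z 0) + Real.exp (u 0)) * Real.exp (∑ j : Fin M, z j.succ + ∑ j : Fin K, u j.succ)

/-- The composed integrand after reflection of the intermediate variables. -/
def midInt (g β : ℝ) {M K p r q : ℕ} (a b : ℂ) (x : Fin p → ℝ) (y : Fin q → ℝ)
    (v : (Fin r → ℝ) × ((Fin (M + 1) → ℝ) × (Fin (K + 1) → ℝ))) : ℂ :=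
  coreInt g β a b x y v.2.1 v.2.2 * pw (reflFac v.2.1 v.2.2) (a + b) *
    midWt (-(a + b)) v.2.1 v.2.2 v.1

lemma compInt_eq (g β : ℝ) {M K p r q : ℕ} (a b : ℂ) (x : Fin p → ℝ) (y : Fin q → ℝ)
    (v : (Fin r → ℝ) × ((Fin (M + 1) → ℝ) × (Fin (K + 1) → ℝ))) :
    compInt g β a b x y v = coreInt g β a b x y v.2.1 v.2.2 * midWt (a + b) v.2.1 v.2.2 v.1 := by
  rw [compInt, genInt, genInt, coreInt, midWt, mul_mul_mul_comm, ← Complex.exp_add,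
    mul_assoc (bd g β a (v.2.1 0) * bd g β b (v.2.2 0)), ← Complex.exp_add]
  congr 2
  push_cast
  ring

lemma midWt_eq_prod {M K r : ℕ} (s : ℂ) (z : Fin (M + 1) → ℝ) (u : Fin (K + 1) → ℝ)
    (w : Fin r → ℝ) :
    midWt s z u w = ∏ j : Fin r, siteWt s (em z (j + 1) + em u (j + 1)) (ep z j + ep u j) (w j) := by
  simp only [midWt, siteWt]
  rw [← Complex.exp_sum]
  congr 1
  rw [Finset.sum_sub_distrib, ← Finset.mul_sum, ← Complex.ofReal_sum, ← Complex.ofReal_sum]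
  congr 2
  simp only [link]
  rw [← Finset.sum_add_distrib]
  refine Finset.sum_congr rfl fun j _ => ?_
  ring

lemma integral_midWt {M K : ℕ} (r : ℕ) (s : ℂ) (z : Fin (M + 1) → ℝ) (u : Fin (K + 1) → ℝ) :
    ∫ w : Fin r → ℝ, midWt s z u w =
      ∏ j : Fin r, siteK s (em z (j + 1) + em u (j + 1)) (ep z j + ep u j) := by
  simp only [midWt_eq_prod]
  exact integral_fintype_prod_volume_eq_prod (fun (j : Fin r) t =>
    siteWt s (em z (j + 1) + em u (j + 1)) (ep z j + ep u j) t)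

lemma integrable_midWt {M K r : ℕ} (hM : r ≤ M + 1) {s : ℂ}
    (h : r ≤ M ∨ s.re < 0) (z : Fin (M + 1) → ℝ) (u : Fin (K + 1) → ℝ) :
    Integrable fun w : Fin r → ℝ => midWt s z u w := by
  simp only [midWt_eq_prod]
  refine Integrable.fintype_prod (f := fun (j : Fin r) t =>
    siteWt s (em z (j + 1) + em u (j + 1)) (ep z j + ep u j) t) fun j => ?_
  refine integrable_siteWt (add_nonneg (em_nonneg _ _) (em_nonneg _ _))
    (add_pos_of_pos_of_nonneg ?_ (ep_nonneg _ _)) ?_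
  · rw [ep_of_lt z (by omega)]
    exact Real.exp_pos _
  · refine h.imp_left fun h => add_pos_of_pos_of_nonneg ?_ (em_nonneg _ _)
    rw [em_of_lt z (by omega)]
    exact Real.exp_pos _

lemma norm_midWt {M K r : ℕ} (s : ℂ) (z : Fin (M + 1) → ℝ) (u : Fin (K + 1) → ℝ) (w : Fin r → ℝ) :
    (‖midWt s z u w‖ : ℂ) = midWt (s.re : ℂ) z u w := by
  rw [midWt, midWt, Complex.norm_exp, Complex.ofReal_exp, Complex.sub_re, Complex.re_mul_ofReal,
    Complex.ofReal_re]
  push_cast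
  rfl

/-- The reflection of the intermediate variables: from `r` to `r'` variables with constant `κ`. -/
def MidReflection (M K r r' : ℕ) (s κ : ℂ) : Prop :=
  ∀ (z : Fin (M + 1) → ℝ) (u : Fin (K + 1) → ℝ),
    (Integrable fun w : Fin r' → ℝ => midWt (-s) z u w) ∧
    pw (reflFac z u) s * ∫ w : Fin r' → ℝ, midWt (-s) z u w = κ * ∫ w : Fin r → ℝ, midWt s z u w

lemma prod_pw {ι : Type*} (S : Finset ι) {f : ι → ℝ} (hf : ∀ i ∈ S, 0 < f i) (s : ℂ) :
    ∏ i ∈ S, pw (f i) s = pw (∏ i ∈ S, f i) s := by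
  simp only [pw]
  rw [← Complex.exp_sum, Real.log_prod (fun i hi => (hf i hi).ne'), Complex.ofReal_sum,
    Finset.mul_sum]

lemma prod_siteK_neg {n : ℕ} {A B : Fin n → ℝ} (hA : ∀ j, 0 < A j) (hB : ∀ j, 0 < B j) (s : ℂ) :
    ∏ j, siteK s (B j) (A j) = pw (∏ j, A j) s * pw (∏ j, B j) (-s) * ∏ j, siteK (-s) (B j) (A j) := by
  rw [← prod_pw _ (fun j _ => hA j), ← prod_pw _ (fun j _ => hB j), ← Finset.prod_mul_distrib,
    ← Finset.prod_mul_distrib]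
  exact Finset.prod_congr rfl fun j _ => siteK_neg (hB j) (hA j) s

lemma ep_add_ep {M K : ℕ} (z : Fin M → ℝ) (u : Fin K → ℝ) {j : ℕ} (hz : j < M) (hu : j < K) :
    ep z j + ep u j = (em z j + em u j) * Real.exp (z ⟨j, hz⟩ + u ⟨j, hu⟩) := by
  rw [ep_of_lt z hz, ep_of_lt u hu, em_of_lt z hz, em_of_lt u hu, add_mul, ← Real.exp_add,
    ← Real.exp_add, add_comm]
  congr 2 <;> ring

lemma em_add_em_pos {M K : ℕ} (z : Fin M → ℝ) (u : Fin K → ℝ) {j : ℕ} (hz : j < M) :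
    0 < em z j + em u j := by
  refine add_pos_of_pos_of_nonneg ?_ (em_nonneg _ _)
  rw [em_of_lt z hz]
  exact Real.exp_pos _

lemma ep_add_ep_pos {M K : ℕ} (z : Fin M → ℝ) (u : Fin K → ℝ) {j : ℕ} (hz : j < M) :
    0 < ep z j + ep u j := by
  refine add_pos_of_pos_of_nonneg ?_ (ep_nonneg _ _)
  rw [ep_of_lt z hz]
  exact Real.exp_pos _

lemma ep_zero {M : ℕ} (z : Fin (M + 1) → ℝ) : ep z 0 = Real.exp (z 0) := ep_of_lt z (Nat.succ_pos M)

/-- Since e^z + e^u = (e^{-z} + e^{-u}) e^{z+u}, the coupling of w_{j+1} on one side and of w_j on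
the other cancel up to exponentials. Only the first coupling and `reflFac`'s exponential survive; z
has one coordinate more than u, so the last w still has both couplings and no Gamma function
appears. -/
lemma midReflection_of_succ (K : ℕ) (s : ℂ) : MidReflection (K + 1) K (K + 1) (K + 1) s 1 := by
  intro z u
  refine ⟨integrable_midWt (by omega) (Or.inl le_rfl) z u, ?_⟩
  rw [integral_midWt, integral_midWt, one_mul,
    prod_siteK_neg (fun j => ep_add_ep_pos z u (by omega)) (fun j => em_add_em_pos z u (by omega)) s]
  congr 1
  have hA : ∏ j : Fin (K + 1), (ep z j + ep u j) =
      reflFac z u * ∏ j : Fin (K + 1), (em z (j + 1) + em u (j + 1)) := by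
    rw [Fin.prod_univ_succ, Fin.prod_univ_castSucc (fun j : Fin (K + 1) => em z (j + 1) + em u (j + 1))]
    have h1 : ∀ j : Fin K, ep z (j.succ : Fin (K + 1)) + ep u (j.succ : Fin (K + 1)) =
        (em z (j.castSucc + 1) + em u (j.castSucc + 1)) *
          Real.exp (z j.castSucc.succ + u j.succ) :=
      fun j => ep_add_ep z u (by simp) (by simp)
    have h2 : em z ((Fin.last K : Fin (K + 1)) + 1) + em u ((Fin.last K : Fin (K + 1)) + 1) =
        Real.exp (-z (Fin.last K).succ) := by
      rw [em_of_le u (by simp), add_zero, em_of_lt z (by simp)]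
      rfl
    simp only [h1, h2, Finset.prod_mul_distrib, ← Real.exp_sum, Fin.val_zero, ep_zero, reflFac,
      Fin.sum_univ_castSucc (fun j : Fin (K + 1) => z j.succ), Real.exp_add, Real.exp_neg]
    field_simp
  have hB : 0 < ∏ j : Fin (K + 1), (em z (j + 1) + em u (j + 1)) :=
    Finset.prod_pos fun j _ => em_add_em_pos z u (by omega)
  have hP : 0 < reflFac z u := by unfold reflFac; positivity
  rw [hA, pw_mul hP hB, pw_neg]
  field_simp [pw_ne_zero]

/-- The last w has no coordinate beyond it in z or u, so it integrates to a Gamma function; the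
other M sites reflect and telescope. Read in the two directions, this removes or adds an
intermediate variable. -/
lemma prod_siteK_last {M : ℕ} {s : ℂ} (hs : s.re < 0) (z u : Fin (M + 1) → ℝ) :
    ∫ w : Fin (M + 1) → ℝ, midWt s z u w =
      Complex.Gamma (-s) * pw (reflFac z u) s * ∫ w : Fin M → ℝ, midWt (-s) z u w := by
  rw [integral_midWt, integral_midWt, Fin.prod_univ_castSucc]
  have h0 : em z ((Fin.last M : Fin (M + 1)) + 1) + em u ((Fin.last M : Fin (M + 1)) + 1) = 0 := by
    rw [em_of_le u (by simp), em_of_le z (by simp), add_zero]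
  rw [h0, siteK_zero (ep_add_ep_pos z u (by simp)) hs]
  simp only [Fin.val_castSucc]
  rw [prod_siteK_neg (fun j => ep_add_ep_pos z u (by omega)) (fun j => em_add_em_pos z u (by omega)) s]
  have hA : (∏ j : Fin M, (ep z j + ep u j)) * (ep z (Fin.last M) + ep u (Fin.last M)) =
      reflFac z u * ∏ j : Fin M, (em z (j + 1) + em u (j + 1)) := by
    have h1 : ∀ j : Fin M, ep z (j.succ : Fin (M + 1)) + ep u (j.succ : Fin (M + 1)) =
        (em z (j + 1) + em u (j + 1)) * Real.exp (z j.succ + u j.succ) :=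
      fun j => ep_add_ep z u (by simp) (by simp)
    have h2 := Fin.prod_univ_castSucc (fun j : Fin (M + 1) => ep z j + ep u j)
    simp only [Fin.val_castSucc] at h2
    rw [← h2, Fin.prod_univ_succ]
    simp only [h1, Finset.prod_mul_distrib, ← Real.exp_sum, Fin.val_zero, ep_zero, reflFac,
      Finset.sum_add_distrib]
    ring
  have hB : 0 < ∏ j : Fin M, (em z (j + 1) + em u (j + 1)) :=
    Finset.prod_pos fun j _ => em_add_em_pos z u (by omega)
  have hA' : 0 < ∏ j : Fin M, (ep z j + ep u j) :=
    Finset.prod_pos fun j _ => ep_add_ep_pos z u (by omega)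
  have hP : 0 < reflFac z u := by unfold reflFac; positivity
  have h3 := congrArg (fun t => pw t s) hA
  simp only [pw_mul hP hB, pw_mul hA' (ep_add_ep_pos z u (by simp : (Fin.last M : ℕ) < M + 1))] at h3
  have h4 : pw (∏ j : Fin M, (em z (j + 1) + em u (j + 1))) (-s) *
      pw (∏ j : Fin M, (em z (j + 1) + em u (j + 1))) s = 1 := by
    rw [← pw_add, neg_add_cancel, pw_zero]
  linear_combination (Complex.Gamma (-s) * (∏ j : Fin M, siteK (-s) (em z (j + 1) + em u (j + 1))
    (ep z j + ep u j))) * (pw (∏ j : Fin M, (em z (j + 1) + em u (j + 1))) (-s) * h3 +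
      pw (reflFac z u) s * h4)

lemma midReflection_lower (M : ℕ) {s : ℂ} (hs : s.re < 0) :
    MidReflection M M (M + 1) M s (Complex.Gamma (-s))⁻¹ := by
  intro z u
  refine ⟨integrable_midWt (by omega) (Or.inl le_rfl) z u, ?_⟩
  have := Complex.Gamma_ne_zero_of_re_pos (s := -s) (by simpa using hs)
  rw [prod_siteK_last hs]
  field_simp

lemma midReflection_raise (M : ℕ) {s : ℂ} (hs : 0 < s.re) :
    MidReflection M M M (M + 1) s (Complex.Gamma s) := by
  intro z u
  have hs' : (-s).re < 0 := by simpa using hs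
  refine ⟨integrable_midWt le_rfl (Or.inr hs') z u, ?_⟩
  rw [prod_siteK_last hs', neg_neg, pw_neg]
  field_simp [pw_ne_zero]

@[fun_prop]
lemma Measurable.reflFac {α : Type*} [MeasurableSpace α] {M K : ℕ} {z : α → Fin (M + 1) → ℝ}
    {u : α → Fin (K + 1) → ℝ} (hz : Measurable z) (hu : Measurable u) :
    Measurable fun t => reflFac (z t) (u t) := by
  unfold BCToda.reflFac
  fun_prop

lemma measurable_midInt (g β : ℝ) {M K p r q : ℕ} (a b : ℂ) (x : Fin p → ℝ) (y : Fin q → ℝ) :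
    Measurable (midInt g β (M := M) (K := K) (r := r) a b x y) := by
  unfold midInt coreInt midWt
  fun_prop

/-- Taking moduli replaces the spectral parameter in the weight of w by its real part, so the
reflection at Re(a + b) identifies the w-integral of |`midInt`| with a constant times that of
|`compInt`|. Tonelli then gives integrability. -/
theorem integrable_midInt {g β : ℝ} {M K p r r' q : ℕ} {a b : ℂ} {x : Fin p → ℝ} {y : Fin q → ℝ}
    {κ κ₀ : ℂ} (hF : Integrable (compInt g β (M := M) (K := K) (r := r) a b x y))
    (h : MidReflection M K r r' (a + b) κ) (h₀ : MidReflection M K r r' ((a + b).re : ℂ) κ₀) :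
    Integrable (midInt g β (M := M) (K := K) (r := r') a b x y) ∧
      ∫ v, midInt g β (M := M) (K := K) (r := r') a b x y v =
        κ * ∫ v, compInt g β (M := M) (K := K) (r := r) a b x y v := by
  have hn : ∀ v : (Fin (M + 1) → ℝ) × (Fin (K + 1) → ℝ),
      ((∫ w : Fin r' → ℝ, ‖midInt g β a b x y (w, v)‖ : ℝ) : ℂ) =
        κ₀ * ((∫ w : Fin r → ℝ, ‖compInt g β a b x y (w, v)‖ : ℝ) : ℂ) := by
    intro v
    rw [← integral_complex_ofReal, ← integral_complex_ofReal]
    simp only [compInt_eq, midInt, norm_mul, Complex.ofReal_mul, norm_midWt, integral_const_mul]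
    have h1 := (h₀ v.1 v.2).2
    have h2 : (‖pw (reflFac v.1 v.2) (a + b)‖ : ℂ) = pw (reflFac v.1 v.2) ((a + b).re : ℂ) := by
      rw [norm_pw, pw_ofReal]
    rw [h2, Complex.neg_re, Complex.ofReal_neg, mul_assoc, h1]
    ring
  have hI : Integrable (midInt g β (M := M) (K := K) (r := r') a b x y) := by
    rw [Measure.volume_eq_prod, integrable_prod_iff' (measurable_midInt g β a b x y).aestronglyMeasurable]
    refine ⟨Filter.Eventually.of_forall fun v => (h v.1 v.2).1.const_mul
      (coreInt g β a b x y v.1 v.2 * pw (reflFac v.1 v.2) (a + b)), ?_⟩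
    have h3 := (hF.swap.norm.integral_prod_left.ofReal (𝕜 := ℂ)).const_mul κ₀
    have h4 := (h3.congr (Filter.Eventually.of_forall fun v => (hn v).symm)).re
    simpa using h4
  refine ⟨hI, ?_⟩
  rw [show ∫ v, compInt g β a b x y v = _ from integral_prod_symm _ hF, ← integral_const_mul]
  refine (integral_prod_symm _ hI).trans ?_
  congr 1
  ext v
  simp only [compInt_eq, midInt, integral_const_mul]
  rw [mul_assoc, (h v.1 v.2).2]
  ring

/-! ### Integration over both chains at fixed intermediate variables -/

/-- The product of the bulk site integrals of a chain between `x` and `w`. -/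
def chainK (M : ℕ) {p r : ℕ} (ν : ℂ) (x : Fin p → ℝ) (w : Fin r → ℝ) : ℂ :=
  ∏ j : Fin M, siteK ν (em x (j + 1) + em w (j + 1)) (ep x j + ep w j)

/-- The bulk weight of a chain between `x` and `w`. -/
def chainWt {M p r : ℕ} (ν : ℂ) (x : Fin p → ℝ) (w : Fin r → ℝ) (t : Fin M → ℝ) : ℂ :=
  ∏ j : Fin M, siteWt ν (em x (j + 1) + em w (j + 1)) (ep x j + ep w j) (t j)

lemma integral_chainWt (M : ℕ) {p r : ℕ} (ν : ℂ) (x : Fin p → ℝ) (w : Fin r → ℝ) :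
    ∫ t : Fin M → ℝ, chainWt ν x w t = chainK M ν x w :=
  integral_fintype_prod_volume_eq_prod (fun (j : Fin M) t =>
    siteWt ν (em x (j + 1) + em w (j + 1)) (ep x j + ep w j) t)

lemma chainWt_eq_exp {M p r : ℕ} (hp : p ≤ M + 1) (hr : r ≤ M + 1) (ν : ℂ) (x : Fin p → ℝ)
    (w : Fin r → ℝ) (z : Fin (M + 1) → ℝ) :
    chainWt ν x w (fun j => z j.succ) = Complex.exp (ν * (∑ j : Fin M, z j.succ : ℝ) -
      (link z x + link z w - (em x 0 + em w 0) * Real.exp (z 0) : ℝ)) := by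
  simp only [chainWt, siteWt]
  rw [← Complex.exp_sum, Finset.sum_sub_distrib, ← Finset.mul_sum, ← Complex.ofReal_sum,
    ← Complex.ofReal_sum, link_eq_sum_left z x hp, link_eq_sum_left z w hr]
  congr 3
  simp only [Finset.sum_add_distrib, add_mul]
  simp only [mul_comm]
  ring

/-- The integrand of `siteJ`. -/
def siteInt (g β X Y : ℝ) (a b : ℂ) (z u : ℝ) : ℂ :=
  bd g β a z * bd g β b u * (Complex.exp ((b - a) * (z - u : ℝ)) *
    pw (Real.exp (-z) + Real.exp (-u)) (a + b) *
      Complex.exp (-(X * Real.exp z + Y * Real.exp u : ℝ)))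

section

variable {g β : ℝ} {M K p r q : ℕ}

/-- `reflFac` to the power a + b turns e^{-2aΣz - 2bΣu} into e^{(b-a)Σz + (a-b)Σu}. With w fixed, z
and u then interact only through their first coordinates. -/
lemma midInt_eq (hp : p ≤ M + 1) (hr : r ≤ M + 1) (hr' : r ≤ K + 1) (hq : q ≤ K + 1) (a b : ℂ)
    (x : Fin p → ℝ) (y : Fin q → ℝ) (w : Fin r → ℝ) (z : Fin (M + 1) → ℝ) (u : Fin (K + 1) → ℝ) :
    midInt g β a b x y (w, (z, u)) =
      Complex.exp (a * (∑ j, x j : ℝ) + b * (∑ j, y j : ℝ) - (a + b) * (∑ j, w j : ℝ)) *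
        (siteInt g β (em x 0 + em w 0) (em y 0 + em w 0) a b (z 0) (u 0) *
          chainWt (b - a) x w (fun j => z j.succ) * chainWt (a - b) y w (fun j => u j.succ)) := by
  have e1 : reflFac z u = (Real.exp (-z 0) + Real.exp (-u 0)) *
      Real.exp (z 0 + u 0 + (∑ j : Fin M, z j.succ + ∑ j : Fin K, u j.succ)) := by
    simp only [reflFac, Real.exp_add, Real.exp_neg]
    field_simp
    ring
  rw [chainWt_eq_exp hp hr, chainWt_eq_exp hq hr']
  simp only [midInt, coreInt, midWt, siteInt, e1]
  rw [pw_mul (by positivity) (Real.exp_pos _), pw_exp, Fin.sum_univ_succ z, Fin.sum_univ_succ u]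
  set Sz := ∑ j : Fin M, z j.succ
  set Su := ∑ j : Fin K, u j.succ
  set Sx := ∑ j, x j
  set Sy := ∑ j, y j
  set Sw := ∑ j, w j
  have key : Complex.exp (a * (Sx - 2 * (z 0 + Sz) : ℝ) + b * (Sy - 2 * (u 0 + Su) : ℝ) -
        (link z x + link u y : ℝ)) * Complex.exp ((a + b) * (z 0 + u 0 + (Sz + Su) : ℝ)) *
        Complex.exp (-(a + b) * (Sw : ℝ) - (link z w + link u w : ℝ)) =
      Complex.exp (a * (Sx : ℝ) + b * (Sy : ℝ) - (a + b) * (Sw : ℝ)) *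
        (Complex.exp ((b - a) * (z 0 - u 0 : ℝ)) *
          Complex.exp (-((em x 0 + em w 0) * Real.exp (z 0) + (em y 0 + em w 0) * Real.exp (u 0) : ℝ)) *
        Complex.exp ((b - a) * (Sz : ℝ) - (link z x + link z w - (em x 0 + em w 0) * Real.exp (z 0) : ℝ)) *
        Complex.exp ((a - b) * (Su : ℝ) -
          (link u y + link u w - (em y 0 + em w 0) * Real.exp (u 0) : ℝ))) := by
    simp only [← Complex.exp_add]
    congr 1
    push_cast
    ring
  linear_combination (bd g β a (z 0) * bd g β b (u 0) *
    pw (Real.exp (-z 0) + Real.exp (-u 0)) (a + b)) * key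

lemma integral_midInt_fiber (hp : p ≤ M + 1) (hr : r ≤ M + 1) (hr' : r ≤ K + 1) (hq : q ≤ K + 1)
    (a b : ℂ) (x : Fin p → ℝ) (y : Fin q → ℝ) (w : Fin r → ℝ)
    (hi : Integrable fun v : (Fin (M + 1) → ℝ) × (Fin (K + 1) → ℝ) => midInt g β a b x y (w, v)) :
    ∫ v : (Fin (M + 1) → ℝ) × (Fin (K + 1) → ℝ), midInt g β a b x y (w, v) =
      Complex.exp (a * (∑ j, x j : ℝ) + b * (∑ j, y j : ℝ) - (a + b) * (∑ j, w j : ℝ)) *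
        (siteJ g β (em x 0 + em w 0) (em y 0 + em w 0) a b *
          chainK M (b - a) x w * chainK K (a - b) y w) := by
  refine (integral_prod _ hi).trans ?_
  simp only [midInt_eq hp hr hr' hq, integral_const_mul]
  congr 1
  have h1 : ∀ z : Fin (M + 1) → ℝ, ∫ u : Fin (K + 1) → ℝ,
      siteInt g β (em x 0 + em w 0) (em y 0 + em w 0) a b (z 0) (u 0) *
          chainWt (b - a) x w (fun j => z j.succ) * chainWt (a - b) y w (fun j => u j.succ) =
      ((∫ t, siteInt g β (em x 0 + em w 0) (em y 0 + em w 0) a b (z 0) t) *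
        chainWt (b - a) x w (fun j => z j.succ)) * chainK K (a - b) y w := by
    intro z
    rw [← integral_chainWt, ← integral_mul_const]
    exact integral_zero_succ_mul (fun t => siteInt g β (em x 0 + em w 0) (em y 0 + em w 0) a b (z 0) t *
      chainWt (b - a) x w (fun j => z j.succ)) (chainWt (a - b) y w)
  simp only [h1]
  rw [integral_mul_const]
  congr 1
  rw [← integral_chainWt]
  exact integral_zero_succ_mul
    (fun s => ∫ t, siteInt g β (em x 0 + em w 0) (em y 0 + em w 0) a b s t) (chainWt (b - a) x w)

end

lemma chainK_comm (M : ℕ) {p r : ℕ} (ν : ℂ) (x : Fin p → ℝ) (w : Fin r → ℝ) :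
    chainK M ν x w = chainK M ν w x := by
  simp only [chainK, add_comm (em x _), add_comm (ep x _)]

lemma em_add_em_eq {M K : ℕ} (z : Fin M → ℝ) (u : Fin K → ℝ) {j : ℕ} (hz : j < M) (hu : j < K) :
    em z j + em u j = (ep z j + ep u j) * Real.exp (-z ⟨j, hz⟩ + -u ⟨j, hu⟩) := by
  rw [ep_add_ep z u hz hu, mul_assoc, ← Real.exp_add, show ∀ s t : ℝ, s + t + (-s + -t) = 0 by
    intro s t; ring, Real.exp_zero, mul_one]

/-- The telescoping of `midReflection_of_succ` with x, w now playing the outer tuples. The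
uncancelled first coupling is the one seen by the boundary site, so its power matches that in
`siteJ_reflection`. -/
lemma chainK_neg (M : ℕ) (ν : ℂ) (x : Fin (M + 1) → ℝ) (w : Fin M → ℝ) :
    pw (em x 0 + em w 0) (-ν) * chainK M ν x w =
      Complex.exp (ν * (∑ j, x j + ∑ j, w j : ℝ)) * chainK M (-ν) x w := by
  rw [chainK, prod_siteK_neg (fun j => ep_add_ep_pos x w (by omega))
    (fun j => em_add_em_pos x w (by omega)) ν, ← chainK]
  have hA : (em x 0 + em w 0) * ∏ j : Fin M, (em x (j + 1) + em w (j + 1)) =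
      (∏ j : Fin M, (ep x j + ep w j)) * Real.exp (-(∑ j, x j + ∑ j, w j)) := by
    have h1 : ∀ j : Fin M, em x (j.castSucc : Fin (M + 1)) + em w (j.castSucc : Fin (M + 1)) =
        (ep x j + ep w j) * Real.exp (-x j.castSucc + -w j) :=
      fun j => em_add_em_eq x w (by simp) (by simp)
    have h2 := Fin.prod_univ_succ (fun j : Fin (M + 1) => em x j + em w j)
    simp only [Fin.val_succ, Fin.val_zero] at h2
    have h3 : em x (Fin.last M) + em w (Fin.last M) = Real.exp (-x (Fin.last M)) := by
      rw [em_of_le w (by simp), add_zero, em_of_lt x (by simp)]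
    rw [← h2, Fin.prod_univ_castSucc, h3]
    simp only [h1, Finset.prod_mul_distrib, ← Real.exp_sum, Fin.sum_univ_castSucc (fun j => x j),
      mul_assoc, ← Real.exp_add]
    congr 2
    simp only [Finset.sum_add_distrib, Finset.sum_neg_distrib]
    ring
  have hB : 0 < ∏ j : Fin M, (em x (j + 1) + em w (j + 1)) :=
    Finset.prod_pos fun j _ => em_add_em_pos x w (by omega)
  have hA' : 0 < ∏ j : Fin M, (ep x j + ep w j) :=
    Finset.prod_pos fun j _ => ep_add_ep_pos x w (by omega)
  have h3 := congrArg (fun t => pw t (-ν)) hA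
  simp only [pw_mul (em_add_em_pos x w (Nat.succ_pos M)) hB, pw_mul hA' (Real.exp_pos _), pw_exp] at h3
  have h4 : pw (∏ j : Fin M, (ep x j + ep w j)) ν * pw (∏ j : Fin M, (ep x j + ep w j)) (-ν) = 1 := by
    rw [← pw_add, add_neg_cancel, pw_zero]
  have h5 : Complex.exp (-ν * (-(∑ j, x j + ∑ j, w j) : ℝ)) =
      Complex.exp (ν * (∑ j, x j + ∑ j, w j : ℝ)) := by
    push_cast
    ring_nf
  rw [h5] at h3
  linear_combination chainK M (-ν) x w * (pw (∏ j : Fin M, (ep x j + ep w j)) ν * h3 +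
    Complex.exp (ν * (∑ j, x j + ∑ j, w j : ℝ)) * h4)

lemma chainK_neg' (M : ℕ) (ν : ℂ) (x : Fin M → ℝ) (w : Fin (M + 1) → ℝ) :
    pw (em x 0 + em w 0) (-ν) * chainK M ν x w =
      Complex.exp (ν * (∑ j, x j + ∑ j, w j : ℝ)) * chainK M (-ν) x w := by
  rw [add_comm (em x 0), chainK_comm, chainK_neg, add_comm (∑ j, x j), chainK_comm]

/-- For tuples of equal length M + 1 the last of M + 1 bulk sites has no e^t coupling. It yields
Γ(-ν), and the chain loses one site. -/
lemma chainK_succ (M : ℕ) {ν : ℂ} (hν : ν.re < 0) (x w : Fin (M + 1) → ℝ) :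
    pw (em x 0 + em w 0) (-ν) * chainK (M + 1) ν x w =
      Complex.Gamma (-ν) * (Complex.exp (ν * (∑ j, x j + ∑ j, w j : ℝ)) * chainK M (-ν) x w) := by
  rw [chainK, Fin.prod_univ_castSucc]
  have h0 : em x ((Fin.last M : Fin (M + 1)) + 1) + em w ((Fin.last M : Fin (M + 1)) + 1) = 0 := by
    rw [em_of_le x (by simp), em_of_le w (by simp), add_zero]
  rw [h0, siteK_zero (ep_add_ep_pos x w (by simp)) hν]
  simp only [Fin.val_castSucc]
  rw [prod_siteK_neg (fun j => ep_add_ep_pos x w (by omega))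
    (fun j => em_add_em_pos x w (by omega)) ν, ← chainK]
  have hA : (em x 0 + em w 0) * ∏ j : Fin M, (em x (j + 1) + em w (j + 1)) =
      (∏ j : Fin M, (ep x j + ep w j)) * (ep x (Fin.last M) + ep w (Fin.last M)) *
        Real.exp (-(∑ j, x j + ∑ j, w j)) := by
    have h1 : ∀ j : Fin (M + 1), em x j + em w j = (ep x j + ep w j) * Real.exp (-x j + -w j) :=
      fun j => em_add_em_eq x w j.2 j.2
    have h2 := Fin.prod_univ_succ (fun j : Fin (M + 1) => em x j + em w j)
    simp only [Fin.val_succ, Fin.val_zero] at h2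
    have h3 := Fin.prod_univ_castSucc (fun j : Fin (M + 1) => ep x j + ep w j)
    simp only [Fin.val_castSucc] at h3
    rw [← h2, ← h3]
    simp only [h1, Finset.prod_mul_distrib, ← Real.exp_sum]
    congr 2
    simp only [Finset.sum_add_distrib, Finset.sum_neg_distrib]
    ring
  have hB : 0 < ∏ j : Fin M, (em x (j + 1) + em w (j + 1)) :=
    Finset.prod_pos fun j _ => em_add_em_pos x w (by omega)
  have hA' : 0 < ∏ j : Fin M, (ep x j + ep w j) :=
    Finset.prod_pos fun j _ => ep_add_ep_pos x w (by omega)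
  have hL : 0 < ep x (Fin.last M) + ep w (Fin.last M) := ep_add_ep_pos x w (by simp)
  have h3 := congrArg (fun t => pw t (-ν)) hA
  simp only [pw_mul (em_add_em_pos x w (Nat.succ_pos M)) hB, pw_mul (mul_pos hA' hL) (Real.exp_pos _),
    pw_mul hA' hL, pw_exp] at h3
  have h4 : pw (∏ j : Fin M, (ep x j + ep w j)) ν * pw (∏ j : Fin M, (ep x j + ep w j)) (-ν) = 1 := by
    rw [← pw_add, add_neg_cancel, pw_zero]
  have h4' : pw (ep x (Fin.last M) + ep w (Fin.last M)) ν *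
      pw (ep x (Fin.last M) + ep w (Fin.last M)) (-ν) = 1 := by
    rw [← pw_add, add_neg_cancel, pw_zero]
  have h5 : Complex.exp (-ν * (-(∑ j, x j + ∑ j, w j) : ℝ)) =
      Complex.exp (ν * (∑ j, x j + ∑ j, w j : ℝ)) := by
    push_cast
    ring_nf
  rw [h5] at h3
  linear_combination Complex.Gamma (-ν) * chainK M (-ν) x w *
    (pw (∏ j : Fin M, (ep x j + ep w j)) ν * pw (ep x (Fin.last M) + ep w (Fin.last M)) ν * h3 +
    Complex.exp (ν * (∑ j, x j + ∑ j, w j : ℝ)) * (h4 * (pw (ep x (Fin.last M) + ep w (Fin.last M)) ν *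
      pw (ep x (Fin.last M) + ep w (Fin.last M)) (-ν)) + h4'))

/-- Exchange of the spectral parameters in the reflected kernel, given the exchange in both chains. -/
theorem integral_midInt_exchange {g β : ℝ} (hβ : 0 < β) {M K M' K' p r q : ℕ} (hp : p ≤ M + 1)
    (hr : r ≤ M + 1) (hr' : r ≤ K + 1) (hq : q ≤ K + 1) (hp' : p ≤ M' + 1) (hr₂ : r ≤ M' + 1)
    (hr₂' : r ≤ K' + 1) (hq' : q ≤ K' + 1) (hx : 0 < p ∨ 0 < r) (hy : 0 < q ∨ 0 < r)
    {a b κ₁ κ₂ : ℂ} (ha : a.re < g) (hb : b.re < g) (x : Fin p → ℝ) (y : Fin q → ℝ)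
    (h₁ : Integrable (midInt g β (M := M) (K := K) (r := r) a b x y))
    (h₂ : Integrable (midInt g β (M := M') (K := K') (r := r) b a x y))
    (hz : ∀ w : Fin r → ℝ, pw (em x 0 + em w 0) (-(b - a)) * chainK M (b - a) x w =
      κ₁ * (Complex.exp ((b - a) * (∑ j, x j + ∑ j, w j : ℝ)) * chainK M' (-(b - a)) x w))
    (hu : ∀ w : Fin r → ℝ, pw (em y 0 + em w 0) (-(a - b)) * chainK K (a - b) y w =
      κ₂ * (Complex.exp ((a - b) * (∑ j, y j + ∑ j, w j : ℝ)) * chainK K' (-(a - b)) y w)) :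
    ∫ v, midInt g β (M := M) (K := K) (r := r) a b x y v =
      κ₁ * κ₂ * ∫ v, midInt g β (M := M') (K := K') (r := r) b a x y v := by
  have hpos : ∀ {n m : ℕ} (t : Fin n → ℝ) (w : Fin m → ℝ), (0 < n ∨ 0 < m) → 0 < em t 0 + em w 0 := by
    rintro n m t w (h | h)
    · exact em_add_em_pos t w h
    · rw [add_comm]
      exact em_add_em_pos w t h
  rw [show ∫ v, midInt g β (M := M') (K := K') (r := r) b a x y v = _ from integral_prod _ h₂,
    ← integral_const_mul]
  refine (integral_prod _ h₁).trans (integral_congr_ae ?_)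
  -- Integrability in (z, u) is known for almost every w only, which is enough.
  filter_upwards [h₁.prod_right_ae, h₂.prod_right_ae] with w hw₁ hw₂
  rw [integral_midInt_fiber hp hr hr' hq a b x y w hw₁,
    integral_midInt_fiber hp' hr₂ hr₂' hq' b a x y w hw₂,
    siteJ_reflection hβ ha hb (hpos x w hx) (hpos y w hy)]
  have hz := hz w
  have hu := hu w
  rw [neg_sub] at hz hu
  have key : Complex.exp (a * (∑ j, x j : ℝ) + b * (∑ j, y j : ℝ) - (a + b) * (∑ j, w j : ℝ)) *
      (Complex.exp ((b - a) * (∑ j, x j + ∑ j, w j : ℝ)) *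
        Complex.exp ((a - b) * (∑ j, y j + ∑ j, w j : ℝ))) =
      Complex.exp (b * (∑ j, x j : ℝ) + a * (∑ j, y j : ℝ) - (b + a) * (∑ j, w j : ℝ)) := by
    simp only [← Complex.exp_add]
    congr 1
    push_cast
    ring
  rw [← key]
  linear_combination (Complex.exp (a * (∑ j, x j : ℝ) + b * (∑ j, y j : ℝ) - (a + b) * (∑ j, w j : ℝ)) *
    siteJ g β (em x 0 + em w 0) (em y 0 + em w 0) b a) *
    (hz * (pw (em y 0 + em w 0) (b - a) * chainK K (a - b) y w) +
      κ₁ * (Complex.exp ((b - a) * (∑ j, x j + ∑ j, w j : ℝ)) * chainK M' (a - b) x w) * hu)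

/-! ### Exchange relations for the operators -/

lemma integral_fin_zero (f : (Fin 0 → ℝ) → ℂ) : ∫ y, f y = f default := by
  rw [integral_unique]
  simp only [Measure.real, volume_pi, Measure.pi_univ, Finset.univ_eq_empty, Finset.prod_empty,
    ENNReal.toReal_one, one_smul]
  exact congrArg f (Subsingleton.elim _ _)

lemma integral_fin_one (f : ℝ → ℂ) : ∫ z : Fin 1 → ℝ, f (z 0) = ∫ t, f t := by
  have := integral_zero_succ_mul (n := 0) f (fun _ => 1)
  rw [integral_fin_zero] at this
  simpa using this

section

variable {g β : ℝ} {a b c d : ℂ}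

theorem genOp_exchange (hβ : 0 < β) {M K M' K' p r r' q : ℕ} (ha : a.re < g) (hb : b.re < g)
    (hA : ExponentBound β M p r a.re) (hB : ExponentBound β K r q b.re)
    (hB' : ExponentBound β M' p r' b.re) (hA' : ExponentBound β K' r' q a.re) {κ : ℂ}
    (h : ∀ (x : Fin p → ℝ) (y : Fin q → ℝ),
      ∫ v, compInt g β (M := M) (K := K) (r := r) a b x y v =
        κ * ∫ v, compInt g β (M := M') (K := K') (r := r') b a x y v)
    {φ : (Fin q → ℝ) → ℂ} (hφ : φ ∈ PolyBdd q) :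
    (genOp g β M c a (genOp g β K (p := r) d b φ) : (Fin p → ℝ) → ℂ) =
      κ • genOp g β M' d b (genOp g β K' (p := r') c a φ) := by
  funext x
  rw [Pi.smul_apply, genOp_genOp hβ ha hb hA hB c d hφ, genOp_genOp hβ hb ha hB' hA' d c hφ,
    smul_eq_mul, ← integral_const_mul]
  congr 1
  ext y
  rw [h]
  ring

/-- Raising the number of w's to n + 1 makes both chains reflect without Gamma functions. The factor
Γ(a+b) from the raising is common to both orders and cancels. -/
theorem genOp_baxter_comm (hβ : 0 < β) (n : ℕ) (ha0 : 0 < a.re) (ha : a.re < g) (hb0 : 0 < b.re)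
    (hb : b.re < g) {φ : (Fin n → ℝ) → ℂ} (hφ : φ ∈ PolyBdd n) :
    (genOp g β n c a (genOp g β n (p := n) d b φ) : (Fin n → ℝ) → ℂ) =
      genOp g β n d b (genOp g β n (p := n) c a φ) := by
  have hA := exponentBound_baxter β n ha0
  have hB := exponentBound_baxter β n hb0
  have hs : 0 < (a + b).re := by simpa using add_pos ha0 hb0
  have hs' : 0 < (b + a).re := by rwa [add_comm]
  have hr {s : ℂ} (hs : 0 < s.re) : 0 < ((s.re : ℝ) : ℂ).re := by simpa using hs
  rw [genOp_exchange (κ := 1) hβ ha hb hA hB hB hA (fun x y => ?_) hφ, one_smul]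
  obtain ⟨i₁, e₁⟩ := integrable_midInt (integrable_compInt hβ ha hb hA hB x y)
    (midReflection_raise n hs) (midReflection_raise n (hr hs))
  obtain ⟨i₂, e₂⟩ := integrable_midInt (integrable_compInt hβ hb ha hB hA x y)
    (midReflection_raise n hs') (midReflection_raise n (hr hs'))
  have := integral_midInt_exchange (κ₁ := 1) (κ₂ := 1) hβ (by omega) (by omega) (by omega) (by omega)
    (by omega) (by omega) (by omega) (by omega) (Or.inr (by omega)) (Or.inr (by omega)) ha hb x y i₁ i₂
    (fun w => by rw [one_mul, chainK_neg']) (fun w => by rw [one_mul, chainK_neg'])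
  rw [e₁, e₂, add_comm b a] at this
  refine mul_left_cancel₀ (Complex.Gamma_ne_zero_of_re_pos hs) ?_
  linear_combination this

/-- The mirror image of the Baxter case: Re(a + b) < 0 calls for lowering the number of w's from n +
1 to n, with common factor 1/Γ(-a-b). -/
theorem genOp_redBaxter_comm (hβ : 0 < β) (hg : 0 < g) (n : ℕ) (ha : a.re < 0) (hb : b.re < 0)
    {φ : (Fin (n + 1) → ℝ) → ℂ} (hφ : φ ∈ PolyBdd (n + 1)) :
    (genOp g β n c a (genOp g β n (p := n + 1) d b φ) : (Fin (n + 1) → ℝ) → ℂ) =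
      genOp g β n d b (genOp g β n (p := n + 1) c a φ) := by
  have hA := exponentBound_redBaxter β n ha
  have hB := exponentBound_redBaxter β n hb
  have hs : (a + b).re < 0 := by simpa using add_neg ha hb
  have hs' : (b + a).re < 0 := by rwa [add_comm]
  have hr {s : ℂ} (hs : s.re < 0) : ((s.re : ℝ) : ℂ).re < 0 := by simpa using hs
  have ha' := ha.trans hg
  have hb' := hb.trans hg
  rw [genOp_exchange (κ := 1) hβ ha' hb' hA hB hB hA (fun x y => ?_) hφ, one_smul]
  obtain ⟨i₁, e₁⟩ := integrable_midInt (integrable_compInt hβ ha' hb' hA hB x y)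
    (midReflection_lower n hs) (midReflection_lower n (hr hs))
  obtain ⟨i₂, e₂⟩ := integrable_midInt (integrable_compInt hβ hb' ha' hB hA x y)
    (midReflection_lower n hs') (midReflection_lower n (hr hs'))
  have := integral_midInt_exchange (κ₁ := 1) (κ₂ := 1) hβ (by omega) (by omega) (by omega) (by omega)
    (by omega) (by omega) (by omega) (by omega) (Or.inl (by omega)) (Or.inl (by omega)) ha' hb' x y i₁ i₂
    (fun w => by rw [one_mul, chainK_neg]) (fun w => by rw [one_mul, chainK_neg])
  rw [e₁, e₂, add_comm b a] at this
  refine mul_left_cancel₀ (inv_ne_zero (Complex.Gamma_ne_zero_of_re_pos (s := -(a + b))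
    (by rw [Complex.neg_re]; linarith))) ?_
  linear_combination this

/-- Γ(a+b) comes from adding an intermediate variable on the right-hand side, Γ(a-b) from the
surplus bulk site in the x-chain on the left. -/
theorem genOp_baxter_raising (hβ : 0 < β) (n : ℕ) (ha0 : 0 < a.re) (ha : a.re < g) (hb : b.re = 0)
    {φ : (Fin n → ℝ) → ℂ} (hφ : φ ∈ PolyBdd n) :
    (genOp g β (n + 1) c a (genOp g β n (p := n + 1) d b φ) : (Fin (n + 1) → ℝ) → ℂ) =
      (Complex.Gamma (a + b) * Complex.Gamma (a - b)) •
        genOp g β n d b (genOp g β n (p := n) c a φ) := by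
  have hA := exponentBound_baxter β (n + 1) ha0
  have hA' := exponentBound_baxter β n ha0
  have hB : ExponentBound β n (n + 1) n b.re := by rw [hb]; exact exponentBound_raising β n
  have hb' : b.re < g := by linarith
  have hs : 0 < (b + a).re := by rw [Complex.add_re]; linarith
  have hr : 0 < (((b + a).re : ℝ) : ℂ).re := by simpa using hs
  refine genOp_exchange hβ ha hb' hA hB hB hA' (fun x y => ?_) hφ
  obtain ⟨i₁, e₁⟩ := integrable_midInt (integrable_compInt hβ ha hb' hA hB x y)
    (midReflection_of_succ n (a + b)) (midReflection_of_succ n _)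
  obtain ⟨i₂, e₂⟩ := integrable_midInt (integrable_compInt hβ hb' ha hB hA' x y)
    (midReflection_raise n hs) (midReflection_raise n hr)
  have := integral_midInt_exchange (κ₁ := Complex.Gamma (a - b)) (κ₂ := 1) hβ (by omega) (by omega)
    (by omega) (by omega) (by omega) (by omega) (by omega) (by omega) (Or.inr (by omega))
    (Or.inr (by omega)) ha hb' x y i₁ i₂
    (fun w => by rw [chainK_succ n (by rw [Complex.sub_re]; linarith), neg_sub])
    (fun w => by rw [one_mul, chainK_neg'])
  rw [e₁, e₂, add_comm b a] at this
  linear_combination this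

theorem genOp_raising_raising (hβ : 0 < β) (hg : 0 < g) (n : ℕ) (ha : a.re = 0) (hb : b.re = 0)
    {φ : (Fin n → ℝ) → ℂ} (hφ : φ ∈ PolyBdd n) :
    (genOp g β (n + 1) c a (genOp g β n (p := n + 1) d b φ) : (Fin (n + 2) → ℝ) → ℂ) =
      genOp g β (n + 1) d b (genOp g β n (p := n + 1) c a φ) := by
  have hA : ∀ n, ExponentBound β n (n + 1) n a.re := by rw [ha]; exact exponentBound_raising β
  have hB : ∀ n, ExponentBound β n (n + 1) n b.re := by rw [hb]; exact exponentBound_raising β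
  have ha' : a.re < g := by linarith
  have hb' : b.re < g := by linarith
  rw [genOp_exchange (κ := 1) hβ ha' hb' (hA _) (hB _) (hB _) (hA _) (fun x y => ?_) hφ, one_smul]
  obtain ⟨i₁, e₁⟩ := integrable_midInt (integrable_compInt hβ ha' hb' (hA _) (hB _) x y)
    (midReflection_of_succ n (a + b)) (midReflection_of_succ n _)
  obtain ⟨i₂, e₂⟩ := integrable_midInt (integrable_compInt hβ hb' ha' (hB _) (hA _) x y)
    (midReflection_of_succ n (b + a)) (midReflection_of_succ n _)
  have := integral_midInt_exchange (κ₁ := 1) (κ₂ := 1) hβ (by omega) (by omega) (by omega) (by omega)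
    (by omega) (by omega) (by omega) (by omega) (Or.inl (by omega)) (Or.inr (by omega)) ha' hb' x y i₁ i₂
    (fun w => by rw [one_mul, chainK_neg]) (fun w => by rw [one_mul, chainK_neg'])
  rw [e₁, e₂] at this
  linear_combination this

/-- Γ(-a-b) comes from removing an intermediate variable on the left, Γ(b-a) from the surplus bulk
site in the y-chain. -/
theorem genOp_redBaxter_raising (hβ : 0 < β) (hg : 0 < g) (n : ℕ) (ha : a.re < 0) (hb : b.re = 0)
    {φ : (Fin (n + 1) → ℝ) → ℂ} (hφ : φ ∈ PolyBdd (n + 1)) :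
    (genOp g β (n + 1) c a (genOp g β (n + 1) (p := n + 2) d b φ) : (Fin (n + 2) → ℝ) → ℂ) =
      (Complex.Gamma (-a - b) * Complex.Gamma (-a + b)) •
        genOp g β (n + 1) d b (genOp g β n (p := n + 1) c a φ) := by
  have hA := fun n => exponentBound_redBaxter β n ha
  have hB : ∀ n, ExponentBound β n (n + 1) n b.re := by rw [hb]; exact exponentBound_raising β
  have ha' : a.re < g := by linarith
  have hb' : b.re < g := by linarith
  have hs : (a + b).re < 0 := by rw [Complex.add_re]; linarith
  have hr : (((a + b).re : ℝ) : ℂ).re < 0 := by simpa using hs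
  refine genOp_exchange hβ ha' hb' (hA _) (hB _) (hB _) (hA _) (fun x y => ?_) hφ
  obtain ⟨i₁, e₁⟩ := integrable_midInt (integrable_compInt hβ ha' hb' (hA _) (hB _) x y)
    (midReflection_lower (n + 1) hs) (midReflection_lower (n + 1) hr)
  obtain ⟨i₂, e₂⟩ := integrable_midInt (integrable_compInt hβ hb' ha' (hB _) (hA _) x y)
    (midReflection_of_succ n (b + a)) (midReflection_of_succ n _)
  have := integral_midInt_exchange (κ₁ := 1) (κ₂ := Complex.Gamma (b - a)) hβ (by omega) (by omega)
    (by omega) (by omega) (by omega) (by omega) (by omega) (by omega) (Or.inl (by omega))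
    (Or.inr (by omega)) ha' hb' x y i₁ i₂
    (fun w => by rw [one_mul, chainK_neg])
    (fun w => by rw [chainK_succ n (by rw [Complex.sub_re]; linarith), neg_sub])
  have hΓ := Complex.Gamma_ne_zero_of_re_pos (s := -(a + b)) (by rw [Complex.neg_re]; linarith)
  rw [e₁, e₂, inv_mul_eq_iff_eq_mul₀ hΓ] at this
  rw [this, neg_add, ← sub_eq_add_neg, ← sub_eq_neg_add]
  ring

/-- The lowest exchange relation of the reduced Baxter operator. -/
theorem genOp_redBaxter_raising_zero (hβ : 0 < β) (hg : 0 < g) (ha : a.re < 0) (hb : b.re = 0)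
    {φ : (Fin 0 → ℝ) → ℂ} (hφ : φ ∈ PolyBdd 0) :
    (genOp g β 0 c a (genOp g β 0 (p := 1) d b φ) : (Fin 1 → ℝ) → ℂ) =
      (Complex.Gamma (-a - b) * Complex.Gamma (-a + b)) • genOp g β 0 d b (c • φ) := by
  have hA := exponentBound_redBaxter β 0 ha
  have hB : ExponentBound β 0 1 0 b.re := by rw [hb]; exact exponentBound_raising β 0
  have ha' : a.re < g := by linarith
  have hb' : b.re < g := by linarith
  have hs : (a + b).re < 0 := by rw [Complex.add_re]; linarith
  have hr : (((a + b).re : ℝ) : ℂ).re < 0 := by simpa using hs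
  funext x
  rw [Pi.smul_apply, genOp_genOp hβ ha' hb' hA hB c d hφ, genOp, integralOp, smul_eq_mul,
    ← integral_const_mul]
  congr 1
  ext y
  obtain ⟨i₁, e₁⟩ := integrable_midInt (integrable_compInt hβ ha' hb' hA hB x y)
    (midReflection_lower 0 hs) (midReflection_lower 0 hr)
  have hΓ := Complex.Gamma_ne_zero_of_re_pos (s := -(a + b)) (by rw [Complex.neg_re]; linarith)
  have hi : Integrable fun v : (Fin 1 → ℝ) × (Fin 1 → ℝ) =>
      midInt g β (r := 0) a b x y (default, v) := by
    -- The space of w's is a single point, so an almost everywhere statement holds at it.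
    obtain ⟨w, hw⟩ := i₁.prod_right_ae.exists
    rwa [Subsingleton.elim w default] at hw
  have e₂ : ∫ v, midInt g β (M := 0) (K := 0) (r := 0) a b x y v =
      Complex.Gamma (b - a) * ∫ z : Fin 1 → ℝ, genInt g β b x y z := by
    refine (integral_prod _ i₁).trans ?_
    rw [integral_fin_zero, integral_midInt_fiber (by omega) (by omega) (by omega) (by omega) a b x y
      default hi]
    -- Neither y nor w has coordinates, so the coupling of u_0 is zero. `siteJ_reflection` does not
    -- apply, and `siteJ_zero` integrates u out with the factor Γ(b-a).
    have h0 : ∀ t : Fin 0 → ℝ, em t 0 = 0 := fun t => em_of_le t le_rfl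
    have h1 : em x 0 = Real.exp (-x 0) := em_of_lt x one_pos
    rw [h0, h0, h1, add_zero, add_zero, siteJ_zero hβ hb' (Real.exp_pos _)
      (by rw [Complex.sub_re]; linarith), pw_exp, ← integral_fin_one]
    simp only [chainK, Finset.univ_eq_empty, Finset.prod_empty, Finset.sum_empty, mul_one,
      Fin.sum_univ_one]
    rw [← integral_const_mul, ← integral_const_mul, ← integral_const_mul]
    congr 1
    ext z
    rw [genInt, link_self, link_succ_left, show ∑ j, z j = z 0 from Fin.sum_univ_one z]
    simp only [Finset.univ_eq_empty, Finset.sum_empty, Fin.sum_univ_one, zero_add, add_zero]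
    have key : Complex.exp (a * (x 0 : ℝ) + b * ((0 : ℝ) : ℂ) - (a + b) * ((0 : ℝ) : ℂ)) *
        (Complex.exp ((a - b) * (-x 0 : ℝ)) *
          Complex.exp (-(2 * b * (z 0 : ℝ)) - (Real.exp (-x 0) * Real.exp (z 0) : ℝ))) =
        Complex.exp (b * (x 0 - 2 * z 0 : ℝ) - (Real.exp (z (Fin.last 0) - x (Fin.last 0)) : ℝ)) := by
      rw [← Complex.exp_add, ← Complex.exp_add, ← Real.exp_add]
      congr 1
      rw [show z (Fin.last 0) - x (Fin.last 0) = -x 0 + z 0 from sub_eq_neg_add _ _]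
      push_cast
      ring
    rw [← key]
    ring
  rw [e₁, inv_mul_eq_iff_eq_mul₀ hΓ] at e₂
  rw [e₂, neg_add, ← sub_eq_add_neg, ← sub_eq_neg_add, Pi.smul_apply, smul_eq_mul]
  ring

lemma genOp_zero (hβ : 0 < β) (ha0 : 0 < a.re) (ha : a.re < g) (φ : (Fin 0 → ℝ) → ℂ) :
    (genOp g β 0 c a φ : (Fin 0 → ℝ) → ℂ) = (c * (pw (2 * β) (-(2 * a)) *
      (Complex.Gamma (g - a) * Complex.Gamma (2 * a) / Complex.Gamma (g + a)))) • φ := by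
  funext x
  rw [genOp, integralOp, integral_fin_zero, ← integral_bd_mul_exp hβ ha0 ha, ← integral_fin_one,
    Pi.smul_apply, smul_eq_mul, Subsingleton.elim x default]
  congr 3
  ext z
  rw [genInt, link_succ_left, show ∑ j, z j = z 0 from Fin.sum_univ_one z]
  simp only [Finset.univ_eq_empty, Finset.sum_empty]
  congr 2
  push_cast
  ring

end

/-! ### Return to the original operators -/

lemma raising_eq_genOp (g β : ℝ) (n : ℕ) (l : ℂ) (φ : (Fin n → ℝ) → ℂ) :
    raising g β n l φ = genOp g β n (coef g β l) (Complex.I * l) φ := by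
  rw [genOp, ← raisingIntegrand_eq]
  rfl

lemma redBaxter_succ_eq_genOp (g β : ℝ) (n : ℕ) (l : ℂ) (φ : (Fin (n + 1) → ℝ) → ℂ) :
    redBaxter g β (n + 1) l φ = genOp g β n (coef g β (-l)) (Complex.I * -l) φ := by
  rw [genOp, ← redBaxterIntegrand_eq]
  rfl

lemma re_I_mul (l : ℂ) : (Complex.I * l).re = -l.im := by simp

/-- For n = 0 the prescribed scalar is the value of the general formula, a Beta integral over the
single boundary site. The Baxter relations therefore need no separate case n = 0. -/
lemma baxter_eq_genOp {g β : ℝ} (hβ : 0 < β) (n : ℕ) {l : ℂ} (hl : l.im ∈ Set.Ioo (-g) 0)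
    (φ : (Fin n → ℝ) → ℂ) :
    baxter g β n l φ = genOp g β n (coef g β l) (Complex.I * l) φ := by
  rcases n with _ | n
  · have h0 : 0 < (Complex.I * l).re := by rw [re_I_mul]; linarith [hl.2]
    have h1 : (Complex.I * l).re < g := by rw [re_I_mul]; linarith [hl.1]
    have hΓ := Complex.Gamma_ne_zero_of_re_pos (s := g - Complex.I * l)
      (by rw [Complex.sub_re, Complex.ofReal_re]; linarith)
    rw [genOp_zero hβ h0 h1, baxter, coef, coef, ← pw_eq_cpow (by positivity),
      ← pw_eq_cpow (by positivity), mul_neg, sub_neg_eq_add,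
      show -(Complex.I * l) = Complex.I * l + -(2 * (Complex.I * l)) by ring, pw_add,
      ← mul_assoc 2 Complex.I]
    congr 1
    field_simp
  · rw [genOp, ← baxterIntegrand_eq]
    rfl

end BCToda

end

theorem proposition2p3 (g β : ℝ) (hg : 0 < g) (hβ : 0 < β) :
    -- all the operators are well defined on polynomially bounded continuous functions
    ((∀ (n : ℕ) (l : ℂ), l.im ∈ Set.Ioo (-g) 0 →
        BCToda.WellDefined (BCToda.coef g β l) (BCToda.baxterIntegrand g β (n + 1) l)) ∧
      (∀ (n : ℕ) (l : ℂ), l.im < 0 →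
        BCToda.WellDefined (BCToda.coef g β (-l)) (BCToda.redBaxterIntegrand g β n l)) ∧
      (∀ (n : ℕ) (l : ℝ),
        BCToda.WellDefined (BCToda.coef g β l) (BCToda.raisingIntegrand g β n l))) ∧
    -- commutativity of the Baxter operators
    (∀ (n : ℕ) (l r : ℂ), l.im ∈ Set.Ioo (-g) 0 → r.im ∈ Set.Ioo (-g) 0 →
      ∀ φ ∈ BCToda.PolyBdd n,
        BCToda.baxter g β n l (BCToda.baxter g β n r φ) =
          BCToda.baxter g β n r (BCToda.baxter g β n l φ)) ∧
    -- commutativity of the reduced Baxter operators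
    (∀ (n : ℕ) (l r : ℂ), l.im < 0 → r.im < 0 →
      ∀ φ ∈ BCToda.PolyBdd n,
        BCToda.redBaxter g β n l (BCToda.redBaxter g β n r φ) =
          BCToda.redBaxter g β n r (BCToda.redBaxter g β n l φ)) ∧
    -- exchange relation of Baxter and raising operators, from `n` to `n + 1` variables
    (∀ (n : ℕ) (l : ℂ) (r : ℝ), l.im ∈ Set.Ioo (-g) 0 →
      ∀ φ ∈ BCToda.PolyBdd n,
        BCToda.baxter g β (n + 1) l (BCToda.raising g β n r φ) =
          (Complex.Gamma (Complex.I * l + Complex.I * r) *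
            Complex.Gamma (Complex.I * l - Complex.I * r)) •
              BCToda.raising g β n r (BCToda.baxter g β n l φ)) ∧
    -- exchange relation of reduced Baxter and raising operators
    (∀ (n : ℕ) (l : ℂ) (r : ℝ), l.im < 0 →
      ∀ φ ∈ BCToda.PolyBdd n,
        BCToda.redBaxter g β (n + 1) l (BCToda.raising g β n r φ) =
          (Complex.Gamma (Complex.I * l + Complex.I * r) *
            Complex.Gamma (Complex.I * l - Complex.I * r)) •
              BCToda.raising g β n r (BCToda.redBaxter g β n l φ)) ∧
    -- exchange relation of the raising operators, from `n` to `n + 2` variables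
    (∀ (n : ℕ) (l r : ℝ), ∀ φ ∈ BCToda.PolyBdd n,
      BCToda.raising g β (n + 1) l (BCToda.raising g β n r φ) =
        BCToda.raising g β (n + 1) r (BCToda.raising g β n l φ)) := by
  have ra : ∀ {l : ℂ}, l.im ∈ Set.Ioo (-g) 0 → 0 < (Complex.I * l).re ∧ (Complex.I * l).re < g := by
    intro l hl
    rw [BCToda.re_I_mul]
    exact ⟨by linarith [hl.2], by linarith [hl.1]⟩
  have rb : ∀ {l : ℂ}, l.im < 0 → (Complex.I * -l).re < 0 := by
    intro l hl
    rw [BCToda.re_I_mul, Complex.neg_im]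
    linarith
  have rc : ∀ l : ℝ, (Complex.I * (l : ℂ)).re = 0 := by
    intro l
    rw [BCToda.re_I_mul, Complex.ofReal_im, neg_zero]
  refine ⟨⟨fun n l hl => ?_, fun n l hl => ?_, fun n l => ?_⟩, fun n l r hl hr φ hφ => ?_,
    fun n l r hl hr φ hφ => ?_, fun n l r hl φ hφ => ?_, fun n l r hl φ hφ => ?_,
    fun n l r φ hφ => ?_⟩
  · rw [BCToda.baxterIntegrand_eq]
    exact BCToda.wellDefined_genInt hβ (ra hl).2 (BCToda.exponentBound_baxter β _ (ra hl).1) _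
  · rw [BCToda.redBaxterIntegrand_eq]
    exact BCToda.wellDefined_genInt hβ ((rb hl).trans hg) (BCToda.exponentBound_redBaxter β _ (rb hl)) _
  · rw [BCToda.raisingIntegrand_eq]
    refine BCToda.wellDefined_genInt hβ (by rw [rc]; exact hg) ?_ _
    rw [rc]
    exact BCToda.exponentBound_raising β n
  · simp only [BCToda.baxter_eq_genOp hβ n hl, BCToda.baxter_eq_genOp hβ n hr]
    exact BCToda.genOp_baxter_comm hβ n (ra hl).1 (ra hl).2 (ra hr).1 (ra hr).2 hφ
  · rcases n with _ | n
    · simp only [BCToda.redBaxter]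
      rw [smul_comm]
    · simp only [BCToda.redBaxter_succ_eq_genOp]
      exact BCToda.genOp_redBaxter_comm hβ hg n (rb hl) (rb hr) hφ
  · simp only [BCToda.baxter_eq_genOp hβ _ hl, BCToda.raising_eq_genOp]
    exact BCToda.genOp_baxter_raising hβ n (ra hl).1 (ra hl).2 (rc r) hφ
  -- The reduced operator has a = -iλ, so Γ(iλ ± iρ) is Γ(-a ± b) with b = iρ.
  · have e : Complex.I * l = -(Complex.I * -l) := by ring
    rw [e, sub_eq_add_neg, mul_comm (Complex.Gamma _), ← sub_eq_add_neg]
    rcases n with _ | n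
    · rw [BCToda.redBaxter_succ_eq_genOp, BCToda.raising_eq_genOp, BCToda.raising_eq_genOp,
        BCToda.redBaxter]
      exact BCToda.genOp_redBaxter_raising_zero hβ hg (rb hl) (rc r) hφ
    · simp only [BCToda.redBaxter_succ_eq_genOp, BCToda.raising_eq_genOp]
      exact BCToda.genOp_redBaxter_raising hβ hg n (rb hl) (rc r) hφ
  · simp only [BCToda.raising_eq_genOp]
    exact BCToda.genOp_raising_raising hβ hg n (rc l) (rc r) hφ
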